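/- **Setting.** Let $\mathbb G$ be a Carnot group of step two: its Lie algebra is $\mathfrak g=V_1\oplus V_2$ with $[V_1,V_1]=V_2\neq\{0\}$ and $[V_1,V_2]=\{0\}$, it carries an inner product with $V_1\perp V_2$, and $\mathbb G$ is identified with $\mathfrak g$ through the exponential map, so that $g\circ g'=g+g'+\tfrac12[g,g']$. The Haar measure $dg$ is the Lebesgue measure of $\mathfrak g$, and $\mathbb G$ carries the left-invariant Riemannian metric $\langle\cdot,\cdot\rangle$ that extends the inner product. Let $X_1,\dots,X_m$ be the left-invariant vector fields generated by an orthonormal basis of $V_1$, and put $$|\nabla_H u|^2=\sum_i (X_iu)^2,\qquad \nabla_H^2u=\Big[\tfrac12(X_iX_ju+X_jX_iu)\Big]_{i,j=1}^m .$$ The function $u$ is *$H_2$-convex in $\Omega$* if in $\Omega$ the first and second elementary symmetric functions of the eigenvalues of $\nabla^2_Hu$ are nonnegative, i.e. $\Delta_Hu=\operatorname{tr}\nabla_H^2u\ge 0$ and $(\Delta_H u)^2-\|\nabla_H^2u\|^2\ge0$. $\Gamma^3(\overline\Omega)$ is the class of functions whose horizontal derivatives $X_{j_1}\cdots X_{j_s}u$,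 $s\le 3$, exist in $\Omega$ and extend continuously to $\overline\Omega$. For a bounded open set $\Omega\subset\mathbb G$ of class $C^2$ let $\boldsymbol\nu$ be the outer Riemannian unit normal, $\sigma$ the Riemannian surface measure on $\partial\Omega$, $\boldsymbol N^H=\sum_j\langle\boldsymbol\nu,X_j\rangle X_j$, $W=|\boldsymbol N^H|$, $d\sigma_H=W\,d\sigma$ (the $H$-perimeter measure), $\Sigma=\{g\in\partial\Omega: W(g)=0\}$, and $\boldsymbol\nu^H=\boldsymbol N^H/W$ on $\partial\Omega\setminus\Sigma$. The horizontal mean curvature of $\partial\Omega$ at a point of $\partial\Omega\setminus\Sigma$ is $$\mathcal H=-\sum_{i=1}^{m-1}\langle\nabla^H_{\boldsymbol e_i}\boldsymbol e_i,\boldsymbol\nu^H\rangle ,$$ where $\boldsymbol e_1,\dots,\boldsymbol e_{m-1}$ is a local orthonormal $C^1$ frame of $T\partial\Omega\cap\operatorname{span}(X_1,\dots,X_m)$ and $\nabla^H_XY=\sum_j X(Y_j)X_j$ for horizontal $X$ and $Y=\sum_jY_jX_j$ (the horizontal part of the Levi-Civita connection); thus $\mathcal H\geq 0$ for convex sets.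 The values of $\mathcal H$ on $\Sigma$ do not matter, since $\sigma_H(\Sigma)=0$. **Theorem.** Let $\mathbb G$ be a Carnot group of step two and $\Omega\subset\mathbb G$ a bounded open set of class $C^2$. Let $u\in\Gamma^3(\overline\Omega)\cap C^2(\overline\Omega)$ be $H_2$-convex in $\Omega$ with $u=0$ on $\partial\Omega$. Then the integrals below are finite, and $$\sum_{i,j=1}^m\int_\Omega([X_i,X_j]u)^2\,dg\ \le\ \frac43\int_{\partial\Omega}\mathcal H\,|\nabla_Hu|^2\,d\sigma_H .$$ In particular, if $\mathbb G=\mathbb H^n$, $n\ge1$, is the Heisenberg group with the group law $(x,y,t)\circ(x',y',t')=(x+x',y+y',t+t'+\tfrac12(x\cdot y'-x'\cdot y))$ and the Euclidean inner product on $\mathbb R^{2n+1}$, and $T=\partial/\partial t$, then $$\int_\Omega(Tu)^2\,dg\ \le\ \frac{2}{3n}\int_{\partial\Omega}\mathcal H\,|\nabla_Hu|^2\,d\sigma_H .$$ -/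

import Mathlib

open MeasureTheory Filter Topology Set

noncomputable section

/-- A Carnot group of step two, given by its stratified Lie algebra `E = V₁ ⊕ V₂` and read in
exponential coordinates (`exp : E → G` is a global diffeomorphism, so `G` is identified with `E`).
The inner product of `E` is the one for which the two layers are orthogonal. -/
structure StepTwoCarnot (E : Type*) [NormedAddCommGroup E] [InnerProductSpace ℝ E] where
  /-- the Lie bracket of the Lie algebra -/
  bracket : E →ₗ[ℝ] E →ₗ[ℝ] E
  bracket_self : ∀ x, bracket x x = 0
  jacobi : ∀ x y z,
    bracket x (bracket y z) = bracket (bracket x y) z + bracket y (bracket x z)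
  /-- the horizontal layer -/
  V₁ : Submodule ℝ E
  /-- the vertical layer -/
  V₂ : Submodule ℝ E
  ortho : V₁ ⟂ V₂
  sup_eq_top : V₁ ⊔ V₂ = ⊤
  span_bracket : Submodule.span ℝ {z | ∃ x ∈ V₁, ∃ y ∈ V₁, bracket x y = z} = V₂
  bracket_V₂ : ∀ x ∈ V₁, ∀ z ∈ V₂, bracket x z = 0
  /-- the step is two and not one -/
  V₂_ne_bot : V₂ ≠ ⊥

namespace StepTwoCarnot

variable {E : Type*} [NormedAddCommGroup E] [InnerProductSpace ℝ E]

/-- The group law: the Baker-Campbell-Hausdorff product, which stops at order two. -/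
def mul (𝔾 : StepTwoCarnot E) (x y : E) : E := x + y + (1 / 2 : ℝ) • 𝔾.bracket x y

/-- The inverse of `x = exp x` is `exp (-x)`. -/
def inv (_𝔾 : StepTwoCarnot E) (x : E) : E := -x

theorem bracket_swap (𝔾 : StepTwoCarnot E) (x y : E) : 𝔾.bracket x y = -𝔾.bracket y x := by
  have h := 𝔾.bracket_self (x + y)
  simp only [map_add, LinearMap.add_apply, 𝔾.bracket_self, zero_add, add_zero] at h
  rw [add_comm] at h
  exact eq_neg_of_add_eq_zero_left h

theorem bracket_central (𝔾 : StepTwoCarnot E) (x z : E) (hz : z ∈ 𝔾.V₂) :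
    𝔾.bracket x z = 0 := by
  have hx : x ∈ 𝔾.V₁ ⊔ 𝔾.V₂ := by rw [𝔾.sup_eq_top]; trivial
  obtain ⟨a, ha, b, hb, rfl⟩ := Submodule.mem_sup.1 hx
  rw [map_add, LinearMap.add_apply, 𝔾.bracket_V₂ a ha z hz, zero_add, 𝔾.bracket_swap]
  rw [← 𝔾.span_bracket] at hb
  refine neg_eq_zero.2 ?_
  clear hx
  induction hb using Submodule.span_induction with
  | mem w hw =>
    obtain ⟨p, hp, q, hq, rfl⟩ := hw
    rw [𝔾.bracket_swap, neg_eq_zero]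
    have h := 𝔾.jacobi p q z
    rw [𝔾.bracket_V₂ q hq z hz, 𝔾.bracket_V₂ p hp z hz] at h
    simpa using h.symm
  | zero => simp
  | add u v _ _ hu hv => rw [map_add, hu, hv, add_zero]
  | smul c u _ hu => rw [map_smul, hu, smul_zero]

theorem bracket_mem (𝔾 : StepTwoCarnot E) (x y : E) : 𝔾.bracket x y ∈ 𝔾.V₂ := by
  have hx : x ∈ 𝔾.V₁ ⊔ 𝔾.V₂ := by rw [𝔾.sup_eq_top]; trivial
  have hy : y ∈ 𝔾.V₁ ⊔ 𝔾.V₂ := by rw [𝔾.sup_eq_top]; trivial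
  obtain ⟨a, ha, b, hb, rfl⟩ := Submodule.mem_sup.1 hx
  obtain ⟨c, hc, d, hd, rfl⟩ := Submodule.mem_sup.1 hy
  rw [map_add (𝔾.bracket (a + b)), 𝔾.bracket_central (a + b) d hd, add_zero, map_add,
    LinearMap.add_apply, 𝔾.bracket_swap b c, 𝔾.bracket_central c b hb, neg_zero, add_zero,
    ← 𝔾.span_bracket]
  exact Submodule.subset_span ⟨a, ha, c, hc, rfl⟩

/-- With this law `E` is a group. -/
@[reducible]
def group (𝔾 : StepTwoCarnot E) : Group E where
  mul := 𝔾.mul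
  one := (0 : E)
  inv := 𝔾.inv
  mul_assoc x y z := by
    change 𝔾.mul (𝔾.mul x y) z = 𝔾.mul x (𝔾.mul y z)
    have h1 : 𝔾.bracket (𝔾.bracket x y) z = 0 := by
      rw [𝔾.bracket_swap, 𝔾.bracket_central z _ (𝔾.bracket_mem x y), neg_zero]
    have h2 : 𝔾.bracket x (𝔾.bracket y z) = 0 := 𝔾.bracket_central x _ (𝔾.bracket_mem y z)
    simp only [mul, map_add, map_smul, LinearMap.add_apply, LinearMap.smul_apply, h1, h2,
      smul_zero, add_zero, smul_add]
    abel
  one_mul x := by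
    change 𝔾.mul 0 x = x
    simp [mul]
  mul_one x := by
    change 𝔾.mul x 0 = x
    simp [mul]
  inv_mul_cancel x := by
    change 𝔾.mul (𝔾.inv x) x = 0
    simp [mul, inv, 𝔾.bracket_self]

/-- The left-invariant vector field `g ↦ (L_g)_* v`. -/
def leftInv (𝔾 : StepTwoCarnot E) (v g : E) : E := fderiv ℝ (fun h => 𝔾.mul g h) 0 v

/-- The derivative of `f` along the left-invariant vector field generated by `v`, taken along its
integral curve `s ↦ g exp(s v)`. -/
def lieD (𝔾 : StepTwoCarnot E) (v : E) (f : E → ℝ) (g : E) : ℝ :=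
  deriv (fun s : ℝ => f (𝔾.mul g (s • v))) 0

/-- The left-invariant Riemannian metric that agrees with the inner product at the identity. -/
def metric (𝔾 : StepTwoCarnot E) (g v w : E) : ℝ :=
  inner ℝ (fderiv ℝ (fun h => 𝔾.mul (𝔾.inv g) h) g v)
    (fderiv ℝ (fun h => 𝔾.mul (𝔾.inv g) h) g w)

end StepTwoCarnot

/-! ### Open sets of class `C²` -/

section Domain

variable {E : Type*} [NormedAddCommGroup E] [InnerProductSpace ℝ E]

/-- `φ` is a `C²` defining function of `Ω` near the boundary point `g`. -/
def IsLocalDefining (Ω : Set E) (φ : E → ℝ) (g : E) : Prop :=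
  ContDiffAt ℝ 2 φ g ∧ φ g = 0 ∧ fderiv ℝ φ g ≠ 0 ∧ ∀ᶠ p in 𝓝 g, (p ∈ Ω ↔ φ p < 0)

/-- A bounded open set of class `C²`. -/
def IsC2BoundedOpen (Ω : Set E) : Prop :=
  IsOpen Ω ∧ Bornology.IsBounded Ω ∧ ∀ g ∈ frontier Ω, ∃ φ, IsLocalDefining Ω φ g

end Domain

namespace StepTwoCarnot

variable {E : Type*} [NormedAddCommGroup E] [InnerProductSpace ℝ E]

/-! ### Horizontal calculus

`b` is an orthonormal basis `e₁, …, e_m` of the horizontal layer. -/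

section Calculus

variable {m : ℕ} (𝔾 : StepTwoCarnot E) (b : OrthonormalBasis (Fin m) ℝ 𝔾.V₁)

/-- `X_i f`. -/
def X (i : Fin m) (f : E → ℝ) : E → ℝ := 𝔾.lieD (b i : E) f

/-- `[X_i, X_j] f`. -/
def comm (i j : Fin m) (f : E → ℝ) (g : E) : ℝ :=
  𝔾.X b i (𝔾.X b j f) g - 𝔾.X b j (𝔾.X b i f) g

/-- The symmetrized horizontal Hessian. -/
def symHess (f : E → ℝ) (g : E) : Matrix (Fin m) (Fin m) ℝ :=
  Matrix.of fun i j => (𝔾.X b i (𝔾.X b j f) g + 𝔾.X b j (𝔾.X b i f) g) / 2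

theorem symHess_isHermitian (f : E → ℝ) (g : E) : (𝔾.symHess b f g).IsHermitian := by
  ext i j
  simp [symHess, add_comm]

/-- The `k`-th elementary symmetric function of the eigenvalues of the symmetrized Hessian. -/
def symF (k : ℕ) (f : E → ℝ) (g : E) : ℝ :=
  ∑ t ∈ Finset.powersetCard k Finset.univ,
    ∏ i ∈ t, (𝔾.symHess_isHermitian b f g).eigenvalues i

/-- `f` is `H_r`-convex in `Ω`. -/
def HConvexOn (r : ℕ) (Ω : Set E) (f : E → ℝ) : Prop :=
  ∀ k, 1 ≤ k → k ≤ r → ∀ g ∈ Ω, 0 ≤ 𝔾.symF b k f g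

/-- The class `Γ^k` up to the boundary: the iterated horizontal derivatives of order at most `k`
exist in `Ω` and extend continuously to the closure of `Ω`. -/
def GammaClosure (Ω : Set E) : ℕ → (E → ℝ) → Prop
  | 0, f => ∃ F : E → ℝ, ContinuousOn F (closure Ω) ∧ EqOn f F Ω
  | k + 1, f => (∃ F : E → ℝ, ContinuousOn F (closure Ω) ∧ EqOn f F Ω) ∧
      ∀ i, (∀ g ∈ Ω, DifferentiableAt ℝ (fun s : ℝ => f (𝔾.mul g (s • (b i : E)))) 0) ∧
        GammaClosure Ω k (𝔾.X b i f)

/-- The square length of the horizontal gradient of `f` at a point of the closure of `Ω`, for `f`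
of class `C¹` up to the boundary. -/
def hGradSq (Ω : Set E) (f : E → ℝ) (g : E) : ℝ :=
  ∑ i, (fderivWithin ℝ f (closure Ω) g (𝔾.leftInv (b i : E) g)) ^ 2

end Calculus

/-! ### The boundary -/

section Boundary

/-- `ν` is the outer Riemannian unit normal of `Ω` at `g`: a positive multiple of it is the
Riemannian gradient of a local defining function. -/
def IsOuterNormal (𝔾 : StepTwoCarnot E) (Ω : Set E) (g ν : E) : Prop :=
  𝔾.metric g ν ν = 1 ∧ ∃ φ, IsLocalDefining Ω φ g ∧
    ∃ c : ℝ, 0 < c ∧ ∀ v, fderiv ℝ φ g v = c * 𝔾.metric g ν v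

open Classical in
/-- The outer Riemannian unit normal (zero where there is none). -/
def outerNormal (𝔾 : StepTwoCarnot E) (Ω : Set E) (g : E) : E :=
  if h : ∃ ν, 𝔾.IsOuterNormal Ω g ν then h.choose else 0

/-- The Riemannian area element of a parametrization `ψ` at `y`, the square root of the Gram
determinant of its partial derivatives in the left-invariant metric. -/
def areaElement (𝔾 : StepTwoCarnot E) {d : ℕ} (ψ : EuclideanSpace ℝ (Fin d) → E)
    (y : EuclideanSpace ℝ (Fin d)) : ℝ :=
  Real.sqrt (Matrix.det (Matrix.of fun i j : Fin d =>
    𝔾.metric (ψ y) (fderiv ℝ ψ y (EuclideanSpace.single i 1))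
      (fderiv ℝ ψ y (EuclideanSpace.single j 1))))

/-- `ψ` is an injective `C¹` immersion of the open set `U` into the set `S`. -/
def IsLocalParam (S : Set E) {d : ℕ} (U : Set (EuclideanSpace ℝ (Fin d)))
    (ψ : EuclideanSpace ℝ (Fin d) → E) : Prop :=
  IsOpen U ∧ ContDiffOn ℝ 1 ψ U ∧ InjOn ψ U ∧ (∀ y ∈ U, Function.Injective (fderiv ℝ ψ y)) ∧
    MapsTo ψ U S

/-- The Riemannian surface measure `σ` of the boundary of `Ω`, the measure which on the image of
each local parametrization is the image of the area element. It is obtained from these image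
measures, which agree on overlaps, as their least upper bound. -/
def surfaceMeasure [MeasurableSpace E] [BorelSpace E] (𝔾 : StepTwoCarnot E) (Ω : Set E) :
    Measure E :=
  sSup {μ | ∃ (U : Set (EuclideanSpace ℝ (Fin (Module.finrank ℝ E - 1))))
    (ψ : EuclideanSpace ℝ (Fin (Module.finrank ℝ E - 1)) → E),
    IsLocalParam (frontier Ω) U ψ ∧
    μ = Measure.map ψ
      ((volume.restrict U).withDensity fun y => ENNReal.ofReal (𝔾.areaElement ψ y))}

variable {m : ℕ} (𝔾 : StepTwoCarnot E) (b : OrthonormalBasis (Fin m) ℝ 𝔾.V₁)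

/-- The outer horizontal normal `N^H = ∑ ⟨ν, X_j⟩ X_j`, by its components in the frame
`X₁, …, X_m`. -/
def hNormal (Ω : Set E) (g : E) : EuclideanSpace ℝ (Fin m) :=
  WithLp.toLp 2 fun j => 𝔾.metric g (𝔾.outerNormal Ω g) (𝔾.leftInv (b j : E) g)

/-- The angle function `W = |N^H|`. -/
def angle (Ω : Set E) (g : E) : ℝ := ‖𝔾.hNormal b Ω g‖

/-- The characteristic set. -/
def charSet (Ω : Set E) : Set E := {g ∈ frontier Ω | 𝔾.angle b Ω g = 0}

/-- The horizontal Gauss map `ν^H = N^H / |N^H|`. -/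
def hGauss (Ω : Set E) (g : E) : EuclideanSpace ℝ (Fin m) :=
  (𝔾.angle b Ω g)⁻¹ • 𝔾.hNormal b Ω g

/-- The horizontal Levi-Civita connection `∇^H_v Y` at `g`, for a horizontal vector
`v = ∑ v_k X_k` and a horizontal field `Y = ∑ Y_j X_j`, in components: it differentiates the
components of `Y`, as brackets of horizontal left-invariant fields are vertical and hence
the horizontal part of `∇_{X_k} X_j` is zero. -/
def hConn (v : EuclideanSpace ℝ (Fin m)) (Y : E → EuclideanSpace ℝ (Fin m)) (g : E) :
    EuclideanSpace ℝ (Fin m) :=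
  fderiv ℝ Y g (∑ k, v k • 𝔾.leftInv (b k : E) g)

/-- `h` is the horizontal mean curvature of the boundary at the noncharacteristic point `g`,
computed in an orthonormal `C¹` frame `e₁, …, e_{m-1}` of the horizontal tangent bundle of the
boundary near `g`. The sign is the one for which convex sets have nonnegative curvature with
respect to the outer normal. -/
def IsHMeanCurvature (Ω : Set E) (g : E) (h : ℝ) : Prop :=
  ∃ e : Fin (m - 1) → E → EuclideanSpace ℝ (Fin m),
    (∀ i, ContDiffAt ℝ 1 (e i) g) ∧
    (∀ᶠ p in 𝓝[frontier Ω] g, Orthonormal ℝ (fun i => e i p) ∧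
      ∀ i, inner ℝ (e i p) (𝔾.hNormal b Ω p) = 0) ∧
    h = -∑ i, inner ℝ (𝔾.hConn b (e i g) (e i) g) (𝔾.hGauss b Ω g)

open Classical in
/-- The horizontal mean curvature off the characteristic set. -/
def hMeanCurvatureAux (Ω : Set E) (g : E) : ℝ :=
  if h : ∃ x, 𝔾.IsHMeanCurvature b Ω g x then h.choose else 0

open Classical in
/-- The horizontal mean curvature of the boundary; at a characteristic point it is the limit of
the values at noncharacteristic points (arbitrary if there is no limit). -/
def hMeanCurvature (Ω : Set E) (g : E) : ℝ :=
  if g ∈ 𝔾.charSet b Ω then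
    limUnder (𝓝[frontier Ω \ 𝔾.charSet b Ω] g) (𝔾.hMeanCurvatureAux b Ω)
  else 𝔾.hMeanCurvatureAux b Ω g

/-- The `H`-perimeter measure `dσ_H = W dσ`. -/
def perimeterMeasure [MeasurableSpace E] [BorelSpace E] (Ω : Set E) : Measure E :=
  (𝔾.surfaceMeasure Ω).withDensity fun g => ENNReal.ofReal (𝔾.angle b Ω g)

end Boundary

end StepTwoCarnot

/-! ### The Heisenberg group -/

/-- The underlying space of the Heisenberg group: points `(x, y, t)`. -/
abbrev HeisSpace (n : ℕ) : Type := EuclideanSpace ℝ (Fin n ⊕ Fin n ⊕ Unit)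

/-- The vector `∂/∂t` at the origin. -/
def heisT (n : ℕ) : HeisSpace n := EuclideanSpace.single (Sum.inr (Sum.inr ())) 1

/-- The symplectic form `x · y' - x' · y`. -/
def heisForm (n : ℕ) : HeisSpace n →ₗ[ℝ] HeisSpace n →ₗ[ℝ] ℝ :=
  LinearMap.mk₂ ℝ
    (fun p q => ∑ j : Fin n,
      (p (Sum.inl j) * q (Sum.inr (Sum.inl j)) - q (Sum.inl j) * p (Sum.inr (Sum.inl j))))
    (fun p p' q => by
      simp only [PiLp.add_apply, ← Finset.sum_add_distrib]
      exact Finset.sum_congr rfl fun j _ => by ring)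
    (fun c p q => by
      simp only [PiLp.smul_apply, smul_eq_mul, Finset.mul_sum]
      exact Finset.sum_congr rfl fun j _ => by ring)
    (fun p q q' => by
      simp only [PiLp.add_apply, ← Finset.sum_add_distrib]
      exact Finset.sum_congr rfl fun j _ => by ring)
    (fun c p q => by
      simp only [PiLp.smul_apply, smul_eq_mul, Finset.mul_sum]
      exact Finset.sum_congr rfl fun j _ => by ring)

/-- The bracket `[(x, y, t), (x', y', t')] = (0, 0, x · y' - x' · y)`. -/
def heisBracket (n : ℕ) : HeisSpace n →ₗ[ℝ] HeisSpace n →ₗ[ℝ] HeisSpace n :=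
  (heisForm n).compr₂ (LinearMap.toSpanSingleton ℝ (HeisSpace n) (heisT n))

theorem heisBracket_apply (n : ℕ) (p q : HeisSpace n) :
    heisBracket n p q = heisForm n p q • heisT n := rfl

theorem heisForm_apply (n : ℕ) (p q : HeisSpace n) :
    heisForm n p q = ∑ j : Fin n,
      (p (Sum.inl j) * q (Sum.inr (Sum.inl j)) - q (Sum.inl j) * p (Sum.inr (Sum.inl j))) := rfl

theorem heisForm_heisT (n : ℕ) (p : HeisSpace n) : heisForm n p (heisT n) = 0 := by
  simp [heisForm_apply, heisT]

theorem heisForm_heisT_left (n : ℕ) (p : HeisSpace n) : heisForm n (heisT n) p = 0 := by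
  simp [heisForm_apply, heisT]

/-- The Heisenberg group `ℍⁿ`, `n ≥ 1`, with the group law
`(x, y, t) ∘ (x', y', t') = (x + x', y + y', t + t' + (x · y' - x' · y) / 2)`. -/
def heisenberg (n : ℕ) (hn : 1 ≤ n) : StepTwoCarnot (HeisSpace n) where
  bracket := heisBracket n
  bracket_self p := by
    simp [heisBracket_apply, heisForm_apply]
  jacobi p q r := by
    simp [heisBracket_apply, heisForm_heisT, heisForm_heisT_left]
  V₁ := (ℝ ∙ heisT n)ᗮ
  V₂ := ℝ ∙ heisT n
  ortho := (Submodule.isOrtho_orthogonal_right _).symm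
  sup_eq_top := by
    rw [sup_comm]
    exact Submodule.sup_orthogonal_of_hasOrthogonalProjection
  span_bracket := by
    refine le_antisymm (Submodule.span_le.2 ?_) ?_
    · rintro z ⟨p, -, q, -, rfl⟩
      exact Submodule.smul_mem _ _ (Submodule.mem_span_singleton_self _)
    · rw [Submodule.span_singleton_le_iff_mem]
      refine Submodule.subset_span ⟨EuclideanSpace.single (Sum.inl ⟨0, hn⟩) 1, ?_,
        EuclideanSpace.single (Sum.inr (Sum.inl ⟨0, hn⟩)) 1, ?_, ?_⟩
      · rw [Submodule.mem_orthogonal_singleton_iff_inner_right]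
        simp [heisT, EuclideanSpace.inner_single_left]
      · rw [Submodule.mem_orthogonal_singleton_iff_inner_right]
        simp [heisT, EuclideanSpace.inner_single_left]
      · simp [heisBracket_apply, heisForm_apply]
  bracket_V₂ p _ z hz := by
    obtain ⟨c, rfl⟩ := Submodule.mem_span_singleton.1 hz
    simp [heisBracket_apply, heisForm_heisT]
  V₂_ne_bot := by
    simp [heisT]

end

/-!
For the flux `V_i = ∑_j (X_i u X_j X_j u + (X_i X_j u - 2 X_j X_i u) X_j u)` one has
`div (∑_i V_i X_i) = 2 F₂ + (3/4) ∑_{i,j} ([X_i, X_j] u) ^ 2`, where `F₂` is the second elementary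
symmetric function of the eigenvalues of `∇_H² u`: the third derivatives cancel because
`[X_i, X_j]` commutes with every `X_k`. On the boundary `u = 0`, so that `X_i u` is proportional to
`⟨ν, X_i⟩`, and the tangential derivatives of this relation turn `∑_i V_i ⟨ν, X_i⟩` into
`W 𝓗 |∇_H u| ^ 2`. Hence
`2 ∫_Ω F₂ + (3/4) ∑_{i,j} ∫_Ω ([X_i, X_j] u) ^ 2 = ∫_{∂Ω} 𝓗 |∇_H u| ^ 2 dσ_H`,
and `F₂ ≥ 0` gives the estimate. On the Heisenberg group `[X_i, X_j] u = ω_{ij} T u`, where the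
matrix `ω` of the symplectic form is orthogonal of size `2n`, so that `∑_{i,j} ω_{ij} ^ 2 = 2n`.

As `u` is only of class `C²`, the identity for the divergence is proved in the sense of
distributions, by mollification, and the divergence theorem for a continuous field with a continuous
distributional divergence is obtained by testing with cut-off functions of the height above the
boundary graphs, whose gradients concentrate on the boundary.
-/

/-! ### Left-invariant derivatives -/

namespace StepTwoCarnot

section Algebra

variable {E : Type*} [NormedAddCommGroup E] [InnerProductSpace ℝ E] (𝔾 : StepTwoCarnot E)

theorem bracket_bracket (x y z : E) : 𝔾.bracket x (𝔾.bracket y z) = 0 :=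
  𝔾.bracket_central x _ (𝔾.bracket_mem y z)

theorem bracket_bracket_left (x y z : E) : 𝔾.bracket (𝔾.bracket x y) z = 0 := by
  rw [𝔾.bracket_swap, 𝔾.bracket_bracket, neg_zero]

theorem isNilpotent_bracket (x : E) : IsNilpotent (𝔾.bracket x) :=
  ⟨2, LinearMap.ext fun y => by simp [pow_two, bracket_bracket]⟩

theorem isNilpotent_bracket_flip (v : E) : IsNilpotent (𝔾.bracket.flip v) :=
  ⟨2, LinearMap.ext fun x => by simp [pow_two, bracket_bracket_left]⟩

variable [FiniteDimensional ℝ E]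

/-- The Lie bracket as a continuous bilinear map. -/
noncomputable def bracketCLM : E →L[ℝ] E →L[ℝ] E :=
  LinearMap.toContinuousLinearMap
    ((LinearMap.toContinuousLinearMap (𝕜 := ℝ) (E := E) (F' := E)).toLinearMap ∘ₗ 𝔾.bracket)

@[simp]
theorem bracketCLM_apply (x y : E) : 𝔾.bracketCLM x y = 𝔾.bracket x y := rfl

/-- The differential of the left translation by `g`. It is the same at every point, because the
translation is affine in exponential coordinates. -/
noncomputable def leftInvCLM (g : E) : E →L[ℝ] E :=
  ContinuousLinearMap.id ℝ E + (1 / 2 : ℝ) • 𝔾.bracketCLM g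

theorem hasFDerivAt_mul (g h : E) : HasFDerivAt (fun h => 𝔾.mul g h) (𝔾.leftInvCLM g) h :=
  ((hasFDerivAt_id h).const_add g).add ((𝔾.bracketCLM g).hasFDerivAt.const_smul (1 / 2 : ℝ))

theorem leftInvCLM_apply (g v : E) : 𝔾.leftInvCLM g v = 𝔾.leftInv v g := by
  rw [leftInv, (𝔾.hasFDerivAt_mul g 0).fderiv]

theorem leftInv_eq (v g : E) : 𝔾.leftInv v g = v + (1 / 2 : ℝ) • 𝔾.bracket g v := by
  rw [← leftInvCLM_apply]
  rfl

theorem leftInv_bracket (v w g : E) : 𝔾.leftInv (𝔾.bracket v w) g = 𝔾.bracket v w := by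
  rw [leftInv_eq, bracket_bracket, smul_zero, add_zero]

theorem leftInv_neg_leftInv (v g : E) : 𝔾.leftInv (𝔾.leftInv v g) (-g) = v := by
  simp [leftInv_eq, bracket_bracket]

theorem leftInv_leftInv_neg (v g : E) : 𝔾.leftInv (𝔾.leftInv v (-g)) g = v := by
  simpa only [neg_neg] using 𝔾.leftInv_neg_leftInv v (-g)

theorem metric_eq_inner (g v w : E) :
    𝔾.metric g v w = inner ℝ (𝔾.leftInv v (-g)) (𝔾.leftInv w (-g)) := by
  rw [metric, (𝔾.hasFDerivAt_mul (𝔾.inv g) g).fderiv, leftInvCLM_apply, leftInvCLM_apply, inv]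

theorem metric_leftInv (g v w : E) :
    𝔾.metric g (𝔾.leftInv v g) (𝔾.leftInv w g) = inner ℝ v w := by
  rw [metric_eq_inner, leftInv_neg_leftInv, leftInv_neg_leftInv]

theorem contDiff_leftInvCLM {n : WithTop ℕ∞} : ContDiff ℝ n 𝔾.leftInvCLM :=
  contDiff_const.add (𝔾.bracketCLM.contDiff.const_smul _)

theorem contDiff_leftInv (v : E) {n : WithTop ℕ∞} : ContDiff ℝ n (𝔾.leftInv v) := by
  rw [show 𝔾.leftInv v = fun g => 𝔾.leftInvCLM g v from
    funext fun g => (𝔾.leftInvCLM_apply g v).symm]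
  exact 𝔾.contDiff_leftInvCLM.clm_apply contDiff_const

theorem continuous_leftInv (v : E) : Continuous (𝔾.leftInv v) :=
  (𝔾.contDiff_leftInv v (n := 0)).continuous

theorem hasFDerivAt_leftInv (v g : E) :
    HasFDerivAt (𝔾.leftInv v) ((1 / 2 : ℝ) • 𝔾.bracketCLM.flip v) g := by
  rw [show 𝔾.leftInv v = fun g => v + (1 / 2 : ℝ) • 𝔾.bracketCLM.flip v g from
    funext fun g => 𝔾.leftInv_eq v g]
  exact ((𝔾.bracketCLM.flip v).hasFDerivAt.const_smul _).const_add _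

theorem trace_fderiv_leftInv (v g : E) :
    LinearMap.trace ℝ E (fderiv ℝ (𝔾.leftInv v) g : E →ₗ[ℝ] E) = 0 := by
  rw [(𝔾.hasFDerivAt_leftInv v g).fderiv, ContinuousLinearMap.toLinearMap_smul, map_smul,
    show (𝔾.bracketCLM.flip v : E →ₗ[ℝ] E) = 𝔾.bracket.flip v from rfl,
    (LinearMap.isNilpotent_trace_of_isNilpotent (𝔾.isNilpotent_bracket_flip v)).eq_zero, smul_zero]

theorem det_leftInvCLM (g : E) : LinearMap.det (𝔾.leftInvCLM g : E →ₗ[ℝ] E) = 1 := by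
  set N : Module.End ℝ E := -((1 / 2 : ℝ) • 𝔾.bracket g) with hN
  have hnil : IsNilpotent N := ((𝔾.isNilpotent_bracket g).smul _).neg
  have h := LinearMap.eval_charpoly N 1
  rw [hnil.charpoly_eq_X_pow_finrank, Polynomial.eval_pow, Polynomial.eval_X,
    one_pow] at h
  rw [h]
  congr 1
  ext x
  simp [hN, leftInvCLM]

end Algebra

section LeftInvDeriv

variable {E : Type*} [NormedAddCommGroup E] [InnerProductSpace ℝ E] (𝔾 : StepTwoCarnot E)

/-- The derivative of `f` along the left-invariant field generated by `v`, computed with the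
differential of `f`. -/
noncomputable def leftInvDeriv (v : E) (f : E → ℝ) (g : E) : ℝ := fderiv ℝ f g (𝔾.leftInv v g)

variable {v w z : E} {f h : E → ℝ} {g : E} {n k : WithTop ℕ∞}

theorem leftInvDeriv_mul (hf : DifferentiableAt ℝ f g) (hh : DifferentiableAt ℝ h g) :
    𝔾.leftInvDeriv v (fun p => f p * h p) g =
      f g * 𝔾.leftInvDeriv v h g + h g * 𝔾.leftInvDeriv v f g := by
  simp [leftInvDeriv, fderiv_fun_mul hf hh]

theorem leftInvDeriv_eventuallyEq (hfh : f =ᶠ[𝓝 g] h) :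
    𝔾.leftInvDeriv v f =ᶠ[𝓝 g] 𝔾.leftInvDeriv v h := by
  filter_upwards [hfh.fderiv (𝕜 := ℝ)] with p hp
  rw [leftInvDeriv, hp, leftInvDeriv]

theorem leftInvDeriv_eq_zero_of_notMem_tsupport (hg : g ∉ tsupport f) :
    𝔾.leftInvDeriv v f g = 0 := by
  rw [leftInvDeriv, fderiv_of_notMem_tsupport ℝ hg, zero_apply]

theorem hasCompactSupport_leftInvDeriv (hf : HasCompactSupport f) :
    HasCompactSupport (𝔾.leftInvDeriv v f) :=
  HasCompactSupport.intro' hf (isClosed_tsupport f)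
    fun _ hx => 𝔾.leftInvDeriv_eq_zero_of_notMem_tsupport hx

theorem mul_zero_smul (v g : E) : 𝔾.mul g ((0 : ℝ) • v) = g := by simp [mul]

variable [FiniteDimensional ℝ E]

theorem hasDerivAt_mul_smul (v g : E) :
    HasDerivAt (fun s : ℝ => 𝔾.mul g (s • v)) (𝔾.leftInv v g) 0 := by
  rw [← leftInvCLM_apply]
  have hline : HasDerivAt (fun s : ℝ => s • v) v 0 := by
    simpa using (hasDerivAt_id (0 : ℝ)).smul_const v
  exact (𝔾.hasFDerivAt_mul g _).comp_hasDerivAt (0 : ℝ) hline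

theorem lieD_eq_leftInvDeriv (hf : DifferentiableAt ℝ f g) :
    𝔾.lieD v f g = 𝔾.leftInvDeriv v f g := by
  rw [← 𝔾.mul_zero_smul v g] at hf
  have h := hf.hasFDerivAt.comp_hasDerivAt (0 : ℝ) (𝔾.hasDerivAt_mul_smul v g)
  rw [𝔾.mul_zero_smul] at h
  exact h.deriv

theorem lieD_congr (hfh : f =ᶠ[𝓝 g] h) : 𝔾.lieD v f g = 𝔾.lieD v h g := by
  have hc := (𝔾.hasDerivAt_mul_smul v g).continuousAt
  rw [ContinuousAt, 𝔾.mul_zero_smul] at hc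
  exact Filter.EventuallyEq.deriv_eq (hc.eventually hfh)

theorem contDiffAt_leftInvDeriv (hf : ContDiffAt ℝ k f g) (hn : n + 1 ≤ k) :
    ContDiffAt ℝ n (𝔾.leftInvDeriv v f) g :=
  (hf.fderiv_right hn).clm_apply (𝔾.contDiff_leftInv v).contDiffAt

theorem contDiff_leftInvDeriv (hf : ContDiff ℝ k f) (hn : n + 1 ≤ k) :
    ContDiff ℝ n (𝔾.leftInvDeriv v f) :=
  (hf.fderiv_right hn).clm_apply (𝔾.contDiff_leftInv v)

theorem continuous_leftInvDeriv (hf : ContDiff ℝ 1 f) : Continuous (𝔾.leftInvDeriv v f) :=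
  (𝔾.contDiff_leftInvDeriv (n := 0) hf (by norm_num)).continuous

theorem leftInvDeriv_leftInvDeriv (hf : ContDiffAt ℝ 2 f g) :
    𝔾.leftInvDeriv v (𝔾.leftInvDeriv w f) g =
      fderiv ℝ (fderiv ℝ f) g (𝔾.leftInv v g) (𝔾.leftInv w g) +
        (1 / 2 : ℝ) * fderiv ℝ f g (𝔾.bracket v w) := by
  have hd : DifferentiableAt ℝ (fderiv ℝ f) g :=
    (hf.fderiv_right (m := 1) (by norm_num)).differentiableAt (by norm_num)
  have h : fderiv ℝ (𝔾.leftInvDeriv w f) g = _ :=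
    (hd.hasFDerivAt.clm_apply (𝔾.hasFDerivAt_leftInv w g)).fderiv
  have hbr : 𝔾.bracket (𝔾.leftInv v g) w = 𝔾.bracket v w := by
    simp [leftInv_eq, bracket_bracket_left]
  rw [leftInvDeriv, h]
  simp [hbr, add_comm]

theorem leftInvDeriv_comm (hf : ContDiffAt ℝ 2 f g) :
    𝔾.leftInvDeriv v (𝔾.leftInvDeriv w f) g - 𝔾.leftInvDeriv w (𝔾.leftInvDeriv v f) g =
      fderiv ℝ f g (𝔾.bracket v w) := by
  have hsymm := (hf.isSymmSndFDerivAt (by simp)).eq (𝔾.leftInv v g) (𝔾.leftInv w g)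
  rw [𝔾.leftInvDeriv_leftInvDeriv hf, 𝔾.leftInvDeriv_leftInvDeriv hf, hsymm, 𝔾.bracket_swap w v,
    map_neg]
  ring

theorem leftInvDeriv_fderiv_bracket (hf : ContDiffAt ℝ 2 f g) :
    𝔾.leftInvDeriv z (fun p => fderiv ℝ f p (𝔾.bracket v w)) g =
      fderiv ℝ (𝔾.leftInvDeriv z f) g (𝔾.bracket v w) := by
  have h := 𝔾.leftInvDeriv_comm (v := z) (w := 𝔾.bracket v w) hf
  have hvert (φ : E → ℝ) : 𝔾.leftInvDeriv (𝔾.bracket v w) φ =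
      fun p => fderiv ℝ φ p (𝔾.bracket v w) := by
    ext p; rw [leftInvDeriv, leftInv_bracket]
  rw [bracket_bracket, map_zero, sub_eq_zero] at h
  simpa only [hvert] using h

end LeftInvDeriv

end StepTwoCarnot

section Smoothing

variable {E F : Type*} [NormedAddCommGroup E] [InnerProductSpace ℝ E] [FiniteDimensional ℝ E]
  [MeasurableSpace E] [BorelSpace E] [NormedAddCommGroup F] [NormedSpace ℝ F]

theorem integral_fderiv_apply_vectorField {V : E → E} {f : E → ℝ} (hV : ContDiff ℝ 1 V)
    (hf : ContDiff ℝ 1 f) (hfc : HasCompactSupport f) :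
    ∫ x, fderiv ℝ f x (V x) = -∫ x, LinearMap.trace ℝ E (fderiv ℝ V x : E →ₗ[ℝ] E) * f x := by
  let c := stdOrthonormalBasis ℝ E
  have hcoord (k) (x : E) : HasFDerivAt (fun x => inner ℝ (c k) (V x))
      ((innerSL ℝ (c k)).comp (fderiv ℝ V x)) x :=
    (innerSL ℝ (c k)).hasFDerivAt.comp x (hV.differentiable one_ne_zero x).hasFDerivAt
  have hcoord_cont (k) : Continuous fun x => inner ℝ (c k) (V x) :=
    (innerSL ℝ (c k)).continuous.comp hV.continuous
  have hdiag (k) : Continuous fun x => inner ℝ (c k) (fderiv ℝ V x (c k)) :=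
    (innerSL ℝ (c k)).continuous.comp
      ((hV.continuous_fderiv one_ne_zero).clm_apply continuous_const)
  have hdf (k) : Continuous fun x => fderiv ℝ f x (c k) :=
    (hf.continuous_fderiv one_ne_zero).clm_apply continuous_const
  have hdiag_int (k) : Integrable fun x => inner ℝ (c k) (fderiv ℝ V x (c k)) * f x :=
    ((hdiag k).mul hf.continuous).integrable_of_hasCompactSupport hfc.mul_left
  have hdf_int (k) : Integrable fun x => inner ℝ (c k) (V x) * fderiv ℝ f x (c k) :=
    ((hcoord_cont k).mul (hdf k)).integrable_of_hasCompactSupport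
      (hfc.fderiv_apply (𝕜 := ℝ) (c k)).mul_left
  have hparts (k) : ∫ x, inner ℝ (c k) (V x) * fderiv ℝ f x (c k) =
      -∫ x, inner ℝ (c k) (fderiv ℝ V x (c k)) * f x := by
    rw [integral_mul_fderiv_eq_neg_fderiv_mul_of_integrable (f := fun x => inner ℝ (c k) (V x))
      ?_ (hdf_int k) (((hcoord_cont k).mul hf.continuous).integrable_of_hasCompactSupport
        hfc.mul_left) (fun x _ => (hcoord k x).differentiableAt)
      fun x _ => hf.differentiable one_ne_zero x]
    · simp only [(hcoord k _).fderiv, ContinuousLinearMap.comp_apply, innerSL_apply_apply]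
    · simpa only [(hcoord k _).fderiv, ContinuousLinearMap.comp_apply, innerSL_apply_apply]
        using hdiag_int k
  have hexpand (x : E) : fderiv ℝ f x (V x) = ∑ k, inner ℝ (c k) (V x) * fderiv ℝ f x (c k) := by
    conv_lhs => rw [← c.sum_repr' (V x), map_sum]
    simp only [map_smul, smul_eq_mul]
  simp only [hexpand, LinearMap.trace_eq_sum_inner _ c, Finset.sum_mul,
    ContinuousLinearMap.coe_coe]
  rw [integral_finsetSum _ fun k _ => hdf_int k, integral_finsetSum _ fun k _ => hdiag_int k]
  simp only [hparts, Finset.sum_neg_distrib]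

theorem hasFDerivAt_convolution_lsmul {φ : E → ℝ} {f : E → F} (hφ : Continuous φ)
    (hf : ContDiff ℝ 1 f) (hfc : HasCompactSupport f) (x : E) :
    HasFDerivAt (convolution φ f (ContinuousLinearMap.lsmul ℝ ℝ) volume)
      (convolution φ (fderiv ℝ f) (ContinuousLinearMap.lsmul ℝ ℝ) volume x) x :=
  hfc.hasFDerivAt_convolution_right _ hφ.locallyIntegrable hf x

theorem exists_contDiff_tendsto_fderiv [CompleteSpace F] {f : E → F} (hf : ContDiff ℝ 1 f)
    (hfc : HasCompactSupport f) (n : ℕ∞) :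
    ∃ (f' : ℕ → E → F) (C : ℝ), (∀ k, ContDiff ℝ n (f' k)) ∧
      (∀ k x, ‖fderiv ℝ (f' k) x‖ ≤ C) ∧
      ∀ x, Tendsto (fun k => fderiv ℝ (f' k) x) atTop (𝓝 (fderiv ℝ f x)) := by
  let ρ (k : ℕ) : ContDiffBump (0 : E) :=
    ⟨1 / (k + 2), 1 / (k + 1), by positivity, by gcongr; norm_num⟩
  have hρ : Tendsto (fun k => (ρ k).rOut) atTop (𝓝 0) := tendsto_one_div_add_atTop_nhds_zero_nat
  have hdf : Continuous (fderiv ℝ f) := hf.continuous_fderiv one_ne_zero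
  have hfderiv (k : ℕ) (x : E) := (hasFDerivAt_convolution_lsmul
    ((ρ k).continuous_normed (μ := (volume : Measure E))) hf hfc x).fderiv
  obtain ⟨C, hC⟩ := hdf.bounded_above_of_compact_support (hfc.fderiv ℝ)
  refine ⟨fun k => convolution ((ρ k).normed volume) f (ContinuousLinearMap.lsmul ℝ ℝ) volume,
    3 * C, fun k => ?_, fun k x => ?_, fun x => ?_⟩
  · exact (ρ k).hasCompactSupport_normed.contDiff_convolution_left _ (ρ k).contDiff_normed
      hf.continuous.locallyIntegrable
  · have hdist : dist (fderiv ℝ (convolution ((ρ k).normed volume) f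
        (ContinuousLinearMap.lsmul ℝ ℝ) volume) x) (fderiv ℝ f x) ≤ 2 * C := by
      rw [hfderiv]
      refine ContDiffBump.dist_normed_convolution_le hdf.aestronglyMeasurable fun y _ => ?_
      exact (dist_le_norm_add_norm _ _).trans (by linarith [hC x, hC y])
    rw [dist_eq_norm] at hdist
    linarith [norm_le_norm_sub_add (fderiv ℝ (convolution ((ρ k).normed volume) f
      (ContinuousLinearMap.lsmul ℝ ℝ) volume) x) (fderiv ℝ f x), hC x]
  · simp only [hfderiv]
    exact ContDiffBump.convolution_tendsto_right_of_continuous hρ hdf x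

theorem tendsto_integral_clm_apply_mul {A : ℕ → E → E →L[ℝ] ℝ} {A₀ : E → E →L[ℝ] ℝ} {C : ℝ}
    {W : E → E} {χ : E → ℝ} (hA : ∀ n, Continuous (A n)) (hC : ∀ n x, ‖A n x‖ ≤ C)
    (hlim : ∀ x, Tendsto (fun n => A n x) atTop (𝓝 (A₀ x))) (hW : Continuous W)
    (hχ : Continuous χ) (hχc : HasCompactSupport χ) :
    Tendsto (fun n => ∫ x, A n x (W x) * χ x) atTop (𝓝 (∫ x, A₀ x (W x) * χ x)) := by
  refine tendsto_integral_of_dominated_convergence (fun x => C * ‖W x‖ * ‖χ x‖)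
    (fun n => (((hA n).clm_apply hW).mul hχ).aestronglyMeasurable)
    (((continuous_const.mul hW.norm).mul hχ.norm).integrable_of_hasCompactSupport
      hχc.norm.mul_left)
    (fun n => ae_of_all _ fun x => ?_) (ae_of_all _ fun x => ?_)
  · rw [norm_mul]
    exact mul_le_mul_of_nonneg_right ((A n x).le_of_opNorm_le (hC n x) _) (norm_nonneg _)
  · exact (((ContinuousLinearMap.apply ℝ ℝ (W x)).continuous.tendsto _).comp
      (hlim x)).mul_const _

end Smoothing

namespace StepTwoCarnot

section IntegrationByParts

variable {E : Type*} [NormedAddCommGroup E] [InnerProductSpace ℝ E] [FiniteDimensional ℝ E]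
  [MeasurableSpace E] [BorelSpace E] (𝔾 : StepTwoCarnot E) {v w : E} {f ψ : E → ℝ}

theorem integral_leftInvDeriv_eq_zero (hf : ContDiff ℝ 1 f) (hfc : HasCompactSupport f) :
    ∫ g, 𝔾.leftInvDeriv v f g = 0 := by
  simp only [leftInvDeriv, integral_fderiv_apply_vectorField (𝔾.contDiff_leftInv v) hf hfc,
    trace_fderiv_leftInv, zero_mul, integral_zero, neg_zero]

theorem integrable_leftInvDeriv_mul (hf : ContDiff ℝ 1 f) (hψ : Continuous ψ)
    (hψc : HasCompactSupport ψ) : Integrable fun g => 𝔾.leftInvDeriv v f g * ψ g :=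
  ((𝔾.continuous_leftInvDeriv hf).mul hψ).integrable_of_hasCompactSupport hψc.mul_left

theorem integrable_mul_leftInvDeriv (hf : Continuous f) (hψ : ContDiff ℝ 1 ψ)
    (hψc : HasCompactSupport ψ) : Integrable fun g => f g * 𝔾.leftInvDeriv v ψ g :=
  (hf.mul (𝔾.continuous_leftInvDeriv hψ)).integrable_of_hasCompactSupport
    (𝔾.hasCompactSupport_leftInvDeriv hψc).mul_left

theorem integral_leftInvDeriv_mul (hf : ContDiff ℝ 1 f) (hψ : ContDiff ℝ 1 ψ)
    (hψc : HasCompactSupport ψ) :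
    ∫ g, 𝔾.leftInvDeriv v f g * ψ g = -∫ g, f g * 𝔾.leftInvDeriv v ψ g := by
  have h := 𝔾.integral_leftInvDeriv_eq_zero (v := v) (hf.mul hψ) hψc.mul_left
  simp only [𝔾.leftInvDeriv_mul (hf.differentiable one_ne_zero _)
    (hψ.differentiable one_ne_zero _), mul_comm (ψ _)] at h
  rw [integral_add (𝔾.integrable_mul_leftInvDeriv hf.continuous hψ hψc)
    (𝔾.integrable_leftInvDeriv_mul hf hψ.continuous hψc)] at h
  linarith

theorem integral_leftInvDeriv_antisymm_of_contDiff_two (hf : ContDiff ℝ 2 f)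
    (hψ : ContDiff ℝ 1 ψ) (hψc : HasCompactSupport ψ) :
    ∫ g, (𝔾.leftInvDeriv v f g * 𝔾.leftInvDeriv w ψ g -
        𝔾.leftInvDeriv w f g * 𝔾.leftInvDeriv v ψ g) =
      ∫ g, fderiv ℝ f g (𝔾.bracket v w) * ψ g := by
  have hD (v : E) : ContDiff ℝ 1 (𝔾.leftInvDeriv v f) := 𝔾.contDiff_leftInvDeriv hf (by norm_num)
  have hint (v w : E) := 𝔾.integrable_mul_leftInvDeriv (v := w) (hD v).continuous hψ hψc
  have hint₂ (v w : E) := 𝔾.integrable_leftInvDeriv_mul (v := v) (hD w) hψ.continuous hψc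
  simp only [← 𝔾.leftInvDeriv_comm hf.contDiffAt, sub_mul]
  rw [integral_sub (hint v w) (hint w v), integral_sub (hint₂ v w) (hint₂ w v),
    𝔾.integral_leftInvDeriv_mul (hD v) hψ hψc, 𝔾.integral_leftInvDeriv_mul (hD w) hψ hψc]
  ring

-- For `f` of class `C²` this is two integrations by parts; mollifying `f` removes the second
-- derivative.
theorem integral_leftInvDeriv_antisymm (hf : ContDiff ℝ 1 f) (hfc : HasCompactSupport f)
    (hψ : ContDiff ℝ 1 ψ) (hψc : HasCompactSupport ψ) :
    ∫ g, (𝔾.leftInvDeriv v f g * 𝔾.leftInvDeriv w ψ g -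
        𝔾.leftInvDeriv w f g * 𝔾.leftInvDeriv v ψ g) =
      ∫ g, fderiv ℝ f g (𝔾.bracket v w) * ψ g := by
  obtain ⟨F, C, hF, hC, hlim⟩ := exists_contDiff_tendsto_fderiv hf hfc 2
  have hF₁ (n : ℕ) : ContDiff ℝ 1 (F n) := (hF n).of_le (by norm_num)
  have hlim_deriv (v w : E) : Tendsto (fun n => ∫ g, 𝔾.leftInvDeriv v (F n) g *
      𝔾.leftInvDeriv w ψ g) atTop (𝓝 (∫ g, 𝔾.leftInvDeriv v f g * 𝔾.leftInvDeriv w ψ g)) :=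
    tendsto_integral_clm_apply_mul (fun n => (hF₁ n).continuous_fderiv one_ne_zero) hC hlim
      (𝔾.continuous_leftInv v) (𝔾.continuous_leftInvDeriv hψ) (𝔾.hasCompactSupport_leftInvDeriv hψc)
  have hlim_bracket := tendsto_integral_clm_apply_mul (W := fun _ => 𝔾.bracket v w)
    (fun n => (hF₁ n).continuous_fderiv one_ne_zero) hC hlim continuous_const hψ.continuous hψc
  have hint {h : E → ℝ} (hh : ContDiff ℝ 1 h) (v w : E) :
      Integrable fun g => 𝔾.leftInvDeriv v h g * 𝔾.leftInvDeriv w ψ g :=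
    𝔾.integrable_mul_leftInvDeriv (𝔾.continuous_leftInvDeriv hh) hψ hψc
  rw [integral_sub (hint hf v w) (hint hf w v)]
  refine tendsto_nhds_unique ((hlim_deriv v w).sub (hlim_deriv w v))
    (hlim_bracket.congr fun n => ?_)
  rw [← 𝔾.integral_leftInvDeriv_antisymm_of_contDiff_two (hF n) hψ hψc,
    integral_sub (hint (hF₁ n) v w) (hint (hF₁ n) w v)]

end IntegrationByParts

end StepTwoCarnot

/-- The coefficients, in a frame `X₁, …, X_m`, of the flux field
`∑_j (X_i u X_j X_j u + (X_i X_j u - 2 X_j X_i u) X_j u)`, for the gradient `f i = X_i u` and the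
Hessian `a i j = X_i X_j u`. Its divergence is `hessQuad a`. -/
def fluxCoeff {ι : Type*} [Fintype ι] (f : ι → ℝ) (a : ι → ι → ℝ) (i : ι) : ℝ :=
  ∑ j, (f i * a j j + (a i j - 2 * a j i) * f j)

/-- The divergence of the flux field of `fluxCoeff`, a quadratic form in the nonsymmetric Hessian
`a i j = X_i X_j u`. -/
def hessQuad {ι : Type*} [Fintype ι] (a : ι → ι → ℝ) : ℝ :=
  ∑ i, ∑ j, (a i i * a j j - a j i * a i j + (a i j - a j i) * a i j)

theorem sum_flux_product {ι : Type*} [Fintype ι] (a : ι → ι → ℝ) (f d : ι → ℝ) (η : ℝ) :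
    ∑ i, ∑ j, (a i i * (η * a j j + f j * d j) + (a i j - 2 * a j i) * (η * a i j + f j * d i)) =
      η * hessQuad a + ∑ i, fluxCoeff f a i * d i := by
  have hswap : ∑ i, ∑ j, f i * a j j * d i = ∑ i, ∑ j, f j * a i i * d j := Finset.sum_comm
  simp only [hessQuad, fluxCoeff, Finset.mul_sum, Finset.sum_mul, Finset.sum_add_distrib, add_mul,
    mul_add, hswap]
  simp only [← Finset.sum_add_distrib]
  refine Finset.sum_congr rfl fun i _ => Finset.sum_congr rfl fun j _ => ?_
  ring

theorem contDiff_mul_of_tsupport_subset {E : Type*} [NormedAddCommGroup E] [NormedSpace ℝ E]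
    {θ u : E → ℝ} {Ω : Set E} {n : WithTop ℕ∞}
    (hΩ : IsOpen Ω) (hθ : ContDiff ℝ n θ) (hu : ContDiffOn ℝ n u Ω) (hθΩ : tsupport θ ⊆ Ω) :
    ContDiff ℝ n fun g => θ g * u g :=
  contDiff_iff_contDiffAt.2 fun g => by
    by_cases hg : g ∈ Ω
    · exact hθ.contDiffAt.mul (hu.contDiffAt (hΩ.mem_nhds hg))
    · refine (contDiffAt_const (c := (0 : ℝ))).congr_of_eventuallyEq ?_
      filter_upwards [notMem_tsupport_iff_eventuallyEq.1 fun h => hg (hθΩ h)] with p hp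
      simp [hp]

theorem exists_contDiff_eventuallyEq_one {E : Type*} [NormedAddCommGroup E] [NormedSpace ℝ E]
    [FiniteDimensional ℝ E] {K Ω : Set E} (hK : IsCompact K) (hΩ : IsOpen Ω)
    (hKΩ : K ⊆ Ω) (n : ℕ∞) :
    ∃ θ : E → ℝ, ContDiff ℝ n θ ∧ HasCompactSupport θ ∧ tsupport θ ⊆ Ω ∧
      ∀ g ∈ K, θ =ᶠ[𝓝 g] 1 := by
  obtain ⟨M, hM, hKM, hMΩ⟩ := exists_compact_between hK hΩ hKΩ
  obtain ⟨θ, hone, hzero, -⟩ := exists_contMDiffMap_one_nhds_of_subset_interior (n := n)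
    (modelWithCornersSelf ℝ E) hK.isClosed hKM
  have hsub : tsupport θ ⊆ M :=
    closure_minimal (fun g hg => by_contra fun hgM => hg (hzero g hgM)) hM.isClosed
  exact ⟨θ, θ.contMDiff.contDiff, hM.of_isClosed_subset (isClosed_tsupport _) hsub,
    hsub.trans hMΩ, fun g hg => hone.filter_mono (nhds_le_nhdsSet hg)⟩

namespace StepTwoCarnot

section FluxField

variable {E : Type*} [NormedAddCommGroup E] [InnerProductSpace ℝ E] [FiniteDimensional ℝ E]
  [MeasurableSpace E] [BorelSpace E] (𝔾 : StepTwoCarnot E) {u η ψ : E → ℝ}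

theorem integrable_leftInvDeriv_flux {v w : E} (hu : ContDiff ℝ 2 u) (hψ : ContDiff ℝ 1 ψ)
    (hψc : HasCompactSupport ψ) :
    Integrable fun g => 𝔾.leftInvDeriv v (𝔾.leftInvDeriv v u) g * 𝔾.leftInvDeriv w ψ g +
      (𝔾.leftInvDeriv v (𝔾.leftInvDeriv w u) g - 2 * 𝔾.leftInvDeriv w (𝔾.leftInvDeriv v u) g) *
        𝔾.leftInvDeriv v ψ g := by
  have hDD (v w : E) : Continuous (𝔾.leftInvDeriv v (𝔾.leftInvDeriv w u)) :=
    𝔾.continuous_leftInvDeriv (𝔾.contDiff_leftInvDeriv hu (by norm_num))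
  exact (𝔾.integrable_mul_leftInvDeriv (hDD v v) hψ hψc).add
    (𝔾.integrable_mul_leftInvDeriv ((hDD v w).sub ((hDD w v).const_mul 2)) hψ hψc)

-- Apply the antisymmetry identity to `X_v u`; as `[v, w]` is central, its right-hand side is
-- `∫ X_v ([v, w] u) ψ = -∫ [v, w] u X_v ψ`.
theorem integral_leftInvDeriv_flux_eq_zero {v w : E} (hu : ContDiff ℝ 2 u)
    (huc : HasCompactSupport u) (hψ : ContDiff ℝ 1 ψ) (hψc : HasCompactSupport ψ) :
    ∫ g, (𝔾.leftInvDeriv v (𝔾.leftInvDeriv v u) g * 𝔾.leftInvDeriv w ψ g +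
      (𝔾.leftInvDeriv v (𝔾.leftInvDeriv w u) g - 2 * 𝔾.leftInvDeriv w (𝔾.leftInvDeriv v u) g) *
        𝔾.leftInvDeriv v ψ g) = 0 := by
  have hD : ContDiff ℝ 1 (𝔾.leftInvDeriv v u) := 𝔾.contDiff_leftInvDeriv hu (by norm_num)
  have hbracket : ContDiff ℝ 1 fun g => fderiv ℝ u g (𝔾.bracket v w) :=
    (hu.fderiv_right (m := 1) (by norm_num)).clm_apply contDiff_const
  have hantisymm := 𝔾.integral_leftInvDeriv_antisymm (v := v) (w := w) hD
    (𝔾.hasCompactSupport_leftInvDeriv huc) hψ hψc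
  simp only [← 𝔾.leftInvDeriv_fderiv_bracket hu.contDiffAt] at hantisymm
  have hint (w z : E) := 𝔾.integrable_mul_leftInvDeriv (v := z)
    (𝔾.continuous_leftInvDeriv (v := w) hD) hψ hψc
  rw [𝔾.integral_leftInvDeriv_mul hbracket hψ hψc, eq_neg_iff_add_eq_zero, ← integral_add
    (f := fun g => _ - _) ((hint v w).sub (hint w v))
    (𝔾.integrable_mul_leftInvDeriv hbracket.continuous hψ hψc)] at hantisymm
  rw [← hantisymm]
  refine integral_congr_ae (ae_of_all _ fun g => ?_)
  simp only [← 𝔾.leftInvDeriv_comm hu.contDiffAt]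
  ring

theorem integral_hessQuad_of_hasCompactSupport {ι : Type*} [Fintype ι] (e : ι → E)
    (hu : ContDiff ℝ 2 u) (huc : HasCompactSupport u) (hη : ContDiff ℝ 1 η)
    (hηc : HasCompactSupport η) :
    ∫ g, (η g * hessQuad (fun i j => 𝔾.leftInvDeriv (e i) (𝔾.leftInvDeriv (e j) u) g) +
      ∑ i, fluxCoeff (fun i => 𝔾.leftInvDeriv (e i) u g)
        (fun i j => 𝔾.leftInvDeriv (e i) (𝔾.leftInvDeriv (e j) u) g) i *
          𝔾.leftInvDeriv (e i) η g) = 0 := by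
  have hD (j : ι) : ContDiff ℝ 1 (𝔾.leftInvDeriv (e j) u) :=
    𝔾.contDiff_leftInvDeriv hu (by norm_num)
  have hint (i j : ι) := 𝔾.integrable_leftInvDeriv_flux (v := e i) (w := e j) hu
    (hη.mul (hD j)) hηc.mul_right
  have hzero : ∑ i, ∑ j, ∫ g, _ = (0 : ℝ) :=
    Finset.sum_eq_zero fun i _ => Finset.sum_eq_zero fun j _ =>
      𝔾.integral_leftInvDeriv_flux_eq_zero (v := e i) (w := e j) hu huc
        (hη.mul (hD j)) hηc.mul_right
  rw [← hzero]
  simp only [← integral_finsetSum Finset.univ fun j _ => hint _ j]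
  rw [← integral_finsetSum Finset.univ fun i _ => integrable_finsetSum _ fun j _ => hint i j]
  refine integral_congr_ae (ae_of_all _ fun g => ?_)
  simp only [𝔾.leftInvDeriv_mul (hη.differentiable one_ne_zero g)
    ((hD _).differentiable one_ne_zero g)]
  exact (sum_flux_product _ _ _ _).symm

theorem integral_hessQuad {ι : Type*} [Fintype ι] (e : ι → E) {Ω : Set E} (hΩ : IsOpen Ω)
    (hu : ContDiffOn ℝ 2 u Ω) (hη : ContDiff ℝ 1 η) (hηc : HasCompactSupport η)
    (hηΩ : tsupport η ⊆ Ω) :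
    ∫ g, (η g * hessQuad (fun i j => 𝔾.leftInvDeriv (e i) (𝔾.leftInvDeriv (e j) u) g) +
      ∑ i, fluxCoeff (fun i => 𝔾.leftInvDeriv (e i) u g)
        (fun i j => 𝔾.leftInvDeriv (e i) (𝔾.leftInvDeriv (e j) u) g) i *
          𝔾.leftInvDeriv (e i) η g) = 0 := by
  obtain ⟨θ, hθ, hθc, hθΩ, hθ_one⟩ := exists_contDiff_eventuallyEq_one hηc hΩ hηΩ 2
  rw [← 𝔾.integral_hessQuad_of_hasCompactSupport e (contDiff_mul_of_tsupport_subset hΩ hθ hu hθΩ)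
    hθc.mul_right hη hηc]
  refine integral_congr_ae (ae_of_all _ fun g => ?_)
  by_cases hg : g ∈ tsupport η
  · have hloc : u =ᶠ[𝓝 g] fun g => θ g * u g := by
      filter_upwards [hθ_one g hg] with p hp
      simp [hp]
    have hloc₁ (i : ι) := 𝔾.leftInvDeriv_eventuallyEq (v := e i) hloc
    have hloc₂ (i j : ι) := 𝔾.leftInvDeriv_eventuallyEq (v := e i) (hloc₁ j)
    simp only [fun i => (hloc₁ i).eq_of_nhds, fun i j => (hloc₂ i j).eq_of_nhds]
  · simp [image_eq_zero_of_notMem_tsupport hg, fun i =>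
      𝔾.leftInvDeriv_eq_zero_of_notMem_tsupport (v := e i) hg]

end FluxField

end StepTwoCarnot

/-! ### Charts of the boundary -/

section LinearFunctional

variable {E : Type*} [NormedAddCommGroup E] [NormedSpace ℝ E]

theorem exists_apply_pos_of_ne_zero {f : E →L[ℝ] ℝ} (hf : f ≠ 0) : ∃ v, 0 < f v := by
  by_contra! h
  exact hf (ContinuousLinearMap.ext fun v => le_antisymm (h v) (by simpa using h (-v)))

theorem exists_norm_eq_one_apply_pos {f : E →L[ℝ] ℝ} (hf : f ≠ 0) : ∃ v, ‖v‖ = 1 ∧ 0 < f v := by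
  obtain ⟨v, hv⟩ := exists_apply_pos_of_ne_zero hf
  have hv₀ : v ≠ 0 := fun h => by simp [h] at hv
  refine ⟨‖v‖⁻¹ • v, by simp [norm_smul, hv₀], ?_⟩
  rw [map_smul, smul_eq_mul]
  exact mul_pos (inv_pos.2 (norm_pos_iff.2 hv₀)) hv

theorem exists_pos_smul_of_neg_imp_nonpos {f f' : E →L[ℝ] ℝ} (hf : f ≠ 0) (hf' : f' ≠ 0)
    (h : ∀ v, f v < 0 → f' v ≤ 0) : ∃ c : ℝ, 0 < c ∧ f' = c • f := by
  obtain ⟨w, hw⟩ := exists_apply_pos_of_ne_zero hf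
  have hpos (v : E) (hv : 0 < f v) : 0 ≤ f' v := by simpa using h (-v) (by simpa using hv)
  have hker_nonneg (v : E) (hv : f v = 0) : 0 ≤ f' v := by
    have hlim : Tendsto (fun t : ℝ => f' (v + t • w)) (𝓝[>] 0) (𝓝 (f' v)) := by
      have hcont : Continuous fun t : ℝ => f' (v + t • w) := by fun_prop
      simpa using (hcont.tendsto 0).mono_left nhdsWithin_le_nhds
    refine ge_of_tendsto hlim ?_
    filter_upwards [self_mem_nhdsWithin] with t (ht : 0 < t)
    exact hpos _ (by simpa [hv] using mul_pos ht hw)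
  have hker (v : E) (hv : f v = 0) : f' v = 0 :=
    le_antisymm (by simpa using hker_nonneg (-v) (by simp [hv])) (hker_nonneg v hv)
  have heq : f' = (f' w / f w) • f := by
    ext v
    have hv := hker (v - (f v / f w) • w) (by simp [hw.ne'])
    simp only [map_sub, map_smul, smul_eq_mul, sub_eq_zero] at hv
    rw [hv, smul_apply, smul_eq_mul]
    ring
  refine ⟨f' w / f w, lt_of_le_of_ne (div_nonneg (hpos w hw) hw.le) fun h₀ => hf' ?_, heq⟩
  rw [heq, ← h₀, zero_smul]

end LinearFunctional

section Subgraph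

variable {F : Type*} [NormedAddCommGroup F]

theorem strictMonoOn_of_fderiv_snd_pos [NormedSpace ℝ F] {Φ : F × ℝ → ℝ} {x : F} {I : Set ℝ}
    (hI : Convex ℝ I) (hΦ : ∀ s ∈ I, DifferentiableAt ℝ Φ (x, s) ∧ 0 < fderiv ℝ Φ (x, s) (0, 1)) :
    StrictMonoOn (fun s => Φ (x, s)) I := by
  have hderiv (s : ℝ) (hs : s ∈ I) :
      HasDerivAt (fun s => Φ (x, s)) (fderiv ℝ Φ (x, s) (0, 1)) s :=
    (hΦ s hs).1.hasFDerivAt.comp_hasDerivAt s ((hasDerivAt_const s x).prodMk (hasDerivAt_id s))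
  refine strictMonoOn_of_deriv_pos hI (fun s hs => (hderiv s hs).continuousAt.continuousWithinAt)
    fun s hs => ?_
  rw [(hderiv s (interior_subset hs)).deriv]
  exact (hΦ s (interior_subset hs)).2

theorem exists_eventually_neg_iff_lt [NormedSpace ℝ F] [CompleteSpace F] {Φ : F × ℝ → ℝ}
    {u : F × ℝ} {n : ℕ} (hn : 1 ≤ n) (hΦ : ContDiffAt ℝ n Φ u) (hu : Φ u = 0)
    (hpos : 0 < fderiv ℝ Φ u (0, 1)) :
    ∃ h : F → ℝ, ContDiffAt ℝ n h u.1 ∧ ∀ᶠ p in 𝓝 u, (Φ p < 0 ↔ p.2 < h p.1) := by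
  have hn₀ : (n : WithTop ℕ∞) ≠ 0 := by exact_mod_cast (Nat.one_le_iff_ne_zero.1 hn)
  have hinv : (fderiv ℝ Φ u ∘L .inr ℝ F ℝ).IsInvertible := by
    refine ⟨ContinuousLinearEquiv.unitsEquivAut ℝ (Units.mk0 _ hpos.ne'), ?_⟩
    ext
    simp
  let h := hΦ.implicitFunction hn₀ hinv
  have hh : ContDiffAt ℝ n h u.1 := hΦ.contDiffAt_implicitFunction hn₀ hinv
  have hhu : h u.1 = u.2 := hΦ.implicitFunction_apply_self hn₀ hinv
  have hgraph : ∀ᶠ x in 𝓝 u.1, Φ (x, h x) = 0 := by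
    simpa only [hu] using hΦ.eventually_apply_implicitFunction hn₀ hinv
  have hreg : ∀ᶠ p in 𝓝 u, DifferentiableAt ℝ Φ p ∧ 0 < fderiv ℝ Φ p (0, 1) := by
    have hcont : ContinuousAt (fun p => fderiv ℝ Φ p (0, 1)) u :=
      (hΦ.fderiv_right (m := 0) (by exact_mod_cast hn)).continuousAt.clm_apply continuousAt_const
    refine .and ?_ (hcont.eventually (lt_mem_nhds hpos))
    filter_upwards [hΦ.eventually (by simp)] with p hp using hp.differentiableAt hn₀
  obtain ⟨r, hr, hball⟩ := Metric.eventually_nhds_iff_ball.1 hreg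
  have hheight : ∀ᶠ x in 𝓝 u.1, h x ∈ Metric.ball u.2 r :=
    hh.continuousAt.eventually_mem (hhu ▸ Metric.ball_mem_nhds _ hr)
  refine ⟨h, hh, ?_⟩
  filter_upwards [continuousAt_fst.eventually hgraph, continuousAt_fst.eventually hheight,
    Metric.ball_mem_nhds u hr] with ⟨x, t⟩ hzero hhx hxt
  rw [← ball_prod_same, mem_prod] at hxt
  have hmono : StrictMonoOn (fun s => Φ (x, s)) (Metric.ball u.2 r) :=
    strictMonoOn_of_fderiv_snd_pos (convex_ball _ _) fun s hs => hball _ <| by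
      rw [← ball_prod_same]
      exact ⟨hxt.1, hs⟩
  simpa only [hzero] using hmono.lt_iff_lt (a := t) (b := h x) hxt.2 hhx

theorem exists_contDiff_eventuallyEq [InnerProductSpace ℝ F] {h : F → ℝ} {x : F} {n : ℕ}
    (hh : ContDiffAt ℝ n h x) : ∃ h' : F → ℝ, ContDiff ℝ n h' ∧ h' =ᶠ[𝓝 x] h := by
  obtain ⟨r, hr, hball⟩ := Metric.eventually_nhds_iff_ball.1 (hh.eventually (by simp))
  let χ : ContDiffBump x := ⟨r / 4, r / 2, by positivity, by linarith⟩
  refine ⟨fun y => χ y * h y, contDiff_mul_of_tsupport_subset Metric.isOpen_ball χ.contDiff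
    (fun y hy => (hball y hy).contDiffWithinAt) ?_, ?_⟩
  · rw [χ.tsupport_eq]
    exact Metric.closedBall_subset_ball (half_lt_self hr)
  · filter_upwards [χ.eventuallyEq_one] with y hy
    simp [hy]

end Subgraph

section Charts

variable {E : Type*} [NormedAddCommGroup E] [InnerProductSpace ℝ E] [FiniteDimensional ℝ E]

/-- Orthonormal coordinates of `E` in which `Ω` is, inside the open set `dom`, the subgraph of a
function `height` of class `C²`. -/
structure GraphChart (Ω : Set E) where
  isometry : E ≃ₗᵢ[ℝ] WithLp 2 (EuclideanSpace ℝ (Fin (Module.finrank ℝ E - 1)) × ℝ)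
  height : EuclideanSpace ℝ (Fin (Module.finrank ℝ E - 1)) → ℝ
  contDiff_height : ContDiff ℝ 2 height
  dom : Set E
  isOpen_dom : IsOpen dom
  mem_iff : ∀ p ∈ dom, p ∈ Ω ↔ (isometry p).snd < height (isometry p).fst

theorem exists_linearIsometryEquiv_prod {F : Type*} [NormedAddCommGroup F]
    [InnerProductSpace ℝ F] [FiniteDimensional ℝ F]
    (hfin : Module.finrank ℝ E = Module.finrank ℝ F + 1) {N : E} (hN : ‖N‖ = 1) :
    ∃ P : E ≃ₗᵢ[ℝ] WithLp 2 (F × ℝ), P N = WithLp.toLp 2 (0, 1) := by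
  have hfin' : Module.finrank ℝ E = Module.finrank ℝ (WithLp 2 (F × ℝ)) := by
    rw [(WithLp.linearEquiv 2 ℝ (F × ℝ)).finrank_eq, Module.finrank_prod, Module.finrank_self, hfin]
  let P₀ : E ≃ₗᵢ[ℝ] WithLp 2 (F × ℝ) :=
    (stdOrthonormalBasis ℝ E).equiv (stdOrthonormalBasis ℝ (WithLp 2 (F × ℝ))) (finCongr hfin')
  refine ⟨P₀.trans (Submodule.reflection
    (Submodule.span ℝ {P₀ N - WithLp.toLp 2 ((0 : F), (1 : ℝ))})ᗮ), Submodule.reflection_sub ?_⟩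
  rw [LinearIsometryEquiv.norm_map, hN, WithLp.norm_toLp_snd, norm_one]

theorem exists_graphChart {Ω : Set E} {φ : E → ℝ} {g : E} (hφ : IsLocalDefining Ω φ g) :
    ∃ c : GraphChart Ω, g ∈ c.dom := by
  obtain ⟨hC, hzero, hne, hΩ⟩ := hφ
  obtain ⟨N, hN, hpos⟩ := exists_norm_eq_one_apply_pos hne
  have : Nontrivial E := ⟨N, 0, fun h => by simp [h] at hN⟩
  obtain ⟨P₀, hP₀N⟩ := exists_linearIsometryEquiv_prod
    (F := EuclideanSpace ℝ (Fin (Module.finrank ℝ E - 1)))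
    (by rw [finrank_euclideanSpace_fin, Nat.sub_add_cancel Module.finrank_pos]) hN
  let P := P₀.toContinuousLinearEquiv.trans (WithLp.prodContinuousLinearEquiv 2 ℝ _ ℝ)
  have hPN : P.symm (0, 1) = N := by
    rw [ContinuousLinearEquiv.symm_apply_eq]
    exact (congrArg WithLp.ofLp hP₀N).symm
  have hPg : P.symm (P g) = g := P.symm_apply_apply g
  have hderiv : fderiv ℝ (φ ∘ P.symm) (P g) (0, 1) = fderiv ℝ φ g N := by
    rw [P.symm.comp_right_fderiv, ContinuousLinearMap.comp_apply, hPg, ← hPN,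
      ContinuousLinearEquiv.coe_coe]
  obtain ⟨h, hh, hneg⟩ := exists_eventually_neg_iff_lt (Φ := φ ∘ P.symm) (u := P g) one_le_two
    (ContDiffAt.comp _ (by rwa [hPg]) P.symm.contDiff.contDiffAt) (by simpa [hPg] using hzero)
    (by rwa [hderiv])
  obtain ⟨h', hh', heq⟩ := exists_contDiff_eventuallyEq hh
  have hmem : ∀ᶠ p in 𝓝 g, p ∈ Ω ↔ (P p).2 < h' (P p).1 := by
    have hP : ContinuousAt P g := P.continuous.continuousAt
    filter_upwards [hΩ, hP.eventually hneg, (continuousAt_fst.comp hP).eventually heq]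
      with p hpΩ hpneg hpeq
    rw [hpΩ, show h' (P p).1 = h (P p).1 from hpeq, ← hpneg, Function.comp_apply,
      P.symm_apply_apply]
  obtain ⟨B, hB, hBo, hgB⟩ := eventually_nhds_iff.1 hmem
  exact ⟨⟨P₀, h', hh', B, hBo, hB⟩, hgB⟩

end Charts

section LocalDefining

theorem tendsto_add_smul_nhdsGT {E : Type*} [TopologicalSpace E] [AddCommGroup E]
    [IsTopologicalAddGroup E] [Module ℝ E] [ContinuousSMul ℝ E] (g v : E) :
    Tendsto (fun t : ℝ => g + t • v) (𝓝[>] 0) (𝓝 g) := by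
  have hcont : Continuous fun t : ℝ => g + t • v := by fun_prop
  simpa using (hcont.tendsto 0).mono_left nhdsWithin_le_nhds

theorem eventually_apply_add_smul_neg {E : Type*} [NormedAddCommGroup E] [NormedSpace ℝ E]
    {φ : E → ℝ} {g v : E} (hφ : DifferentiableAt ℝ φ g) (hg : φ g = 0)
    (hv : fderiv ℝ φ g v < 0) : ∀ᶠ t in 𝓝[>] (0 : ℝ), φ (g + t • v) < 0 := by
  have hslope := (hφ.hasFDerivAt.hasLineDerivAt v).tendsto_slope_zero_right.eventually
    (gt_mem_nhds hv)
  filter_upwards [hslope, self_mem_nhdsWithin] with t ht (htpos : 0 < t)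
  rw [hg, sub_zero, smul_eq_mul] at ht
  exact neg_of_mul_neg_right ht (inv_nonneg.2 htpos.le)

variable {E : Type*} [NormedAddCommGroup E] [InnerProductSpace ℝ E] {Ω : Set E} {φ φ' : E → ℝ}
  {g v : E}

theorem IsLocalDefining.eventually_mem (h : IsLocalDefining Ω φ g) (hv : fderiv ℝ φ g v < 0) :
    ∀ᶠ t in 𝓝[>] (0 : ℝ), g + t • v ∈ Ω := by
  obtain ⟨hC, hzero, -, hΩ⟩ := h
  filter_upwards [eventually_apply_add_smul_neg (hC.differentiableAt two_ne_zero) hzero hv,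
    (tendsto_add_smul_nhdsGT g v).eventually hΩ] with t hneg hmem using hmem.2 hneg

theorem IsLocalDefining.eventually_notMem (h : IsLocalDefining Ω φ g) (hv : 0 < fderiv ℝ φ g v) :
    ∀ᶠ t in 𝓝[>] (0 : ℝ), g + t • v ∉ Ω := by
  obtain ⟨hC, hzero, -, hΩ⟩ := h
  have hneg := eventually_apply_add_smul_neg (φ := fun p => -φ p)
    (hC.differentiableAt two_ne_zero).neg (by simp [hzero])
    (by simpa [fderiv_fun_neg] using hv)
  filter_upwards [hneg, (tendsto_add_smul_nhdsGT g v).eventually hΩ] with t hpos hmem hΩ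
  linarith [hmem.1 hΩ]

theorem IsLocalDefining.exists_fderiv_eq_smul (h : IsLocalDefining Ω φ g)
    (h' : IsLocalDefining Ω φ' g) : ∃ c : ℝ, 0 < c ∧ fderiv ℝ φ' g = c • fderiv ℝ φ g := by
  refine exists_pos_smul_of_neg_imp_nonpos h.2.2.1 h'.2.2.1 fun v hv => ?_
  by_contra! hv'
  obtain ⟨t, hmem, hnotMem⟩ := ((h.eventually_mem hv).and (h'.eventually_notMem hv')).exists
  exact hnotMem hmem

theorem IsLocalDefining.exists_fderiv_neg (h : IsLocalDefining Ω φ g) :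
    ∃ v, fderiv ℝ φ g v < 0 := by
  obtain ⟨v, hv⟩ := exists_apply_pos_of_ne_zero h.2.2.1
  exact ⟨-v, by simpa using hv⟩

theorem IsLocalDefining.mem_frontier (h : IsLocalDefining Ω φ g) : g ∈ frontier Ω := by
  obtain ⟨v, hv⟩ := h.exists_fderiv_neg
  have hg : g ∉ Ω := fun hg => (h.2.2.2.self_of_nhds.1 hg).ne h.2.1
  exact ⟨mem_closure_of_tendsto (tendsto_add_smul_nhdsGT g v) (h.eventually_mem hv),
    fun hi => hg (interior_subset hi)⟩

theorem IsLocalDefining.uniqueDiffWithinAt (h : IsLocalDefining Ω φ g) :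
    UniqueDiffWithinAt ℝ (closure Ω) g := by
  have hsub : {v | fderiv ℝ φ g v < 0} ⊆ tangentConeAt ℝ (closure Ω) g := fun v hv =>
    mem_tangentConeAt_of_add_smul_mem (tendsto_id'.2 (nhdsGT_le_nhdsNE 0))
      ((h.eventually_mem hv).mono fun _ ht => subset_closure ht)
  have hspan : Submodule.span ℝ (tangentConeAt ℝ (closure Ω) g) = ⊤ := by
    obtain ⟨v, hv⟩ := h.exists_fderiv_neg
    exact Submodule.eq_top_of_nonempty_interior' _ ⟨v, mem_interior.2
      ⟨_, hsub.trans Submodule.subset_span, isOpen_lt (fderiv ℝ φ g).continuous continuous_const,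
        hv⟩⟩
  refine ⟨?_, by simpa using h.mem_frontier.1⟩
  rw [hspan]
  exact dense_univ

theorem IsC2BoundedOpen.uniqueDiffOn (hΩ : IsC2BoundedOpen Ω) : UniqueDiffOn ℝ (closure Ω) := by
  intro g hg
  by_cases h : g ∈ Ω
  · exact (hΩ.1.uniqueDiffWithinAt h).mono subset_closure
  · obtain ⟨φ, hφ⟩ := hΩ.2.2 g ⟨hg, fun hi => h (interior_subset hi)⟩
    exact hφ.uniqueDiffWithinAt

end LocalDefining

namespace GraphChart

variable {E : Type*} [NormedAddCommGroup E] [InnerProductSpace ℝ E] {Ω : Set E}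
  (c : GraphChart Ω)

/-- The coordinates of a chart, as a product without its Euclidean norm. -/
noncomputable def coord : E ≃L[ℝ] EuclideanSpace ℝ (Fin (Module.finrank ℝ E - 1)) × ℝ :=
  c.isometry.toContinuousLinearEquiv.trans (WithLp.prodContinuousLinearEquiv 2 ℝ _ ℝ)

/-- The projection to the base of the chart. -/
noncomputable def base : E →L[ℝ] EuclideanSpace ℝ (Fin (Module.finrank ℝ E - 1)) :=
  (ContinuousLinearMap.fst ℝ _ ℝ).comp c.coord.toContinuousLinearMap

/-- The parametrization of the graph by the base of the chart. -/
noncomputable def param (y : EuclideanSpace ℝ (Fin (Module.finrank ℝ E - 1))) : E :=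
  c.coord.symm (y, c.height y)

/-- The height above the graph, a defining function of `Ω` at the boundary points in the chart. -/
noncomputable def defn (p : E) : ℝ := (c.coord p).2 - c.height (c.coord p).1

theorem mem_iff_defn_neg {p : E} (hp : p ∈ c.dom) : p ∈ Ω ↔ c.defn p < 0 := by
  rw [c.mem_iff p hp, defn, sub_neg]
  rfl

theorem measurePreserving_coord [FiniteDimensional ℝ E] [MeasurableSpace E] [BorelSpace E] :
    MeasurePreserving c.coord :=
  (WithLp.volume_preserving_ofLp _ _).comp c.isometry.measurePreserving

theorem coord_param (y) : c.coord (c.param y) = (y, c.height y) := c.coord.apply_symm_apply _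

theorem defn_param (y) : c.defn (c.param y) = 0 := by
  rw [defn, coord_param, sub_self]

theorem param_coord {p : E} (hp : c.defn p = 0) : c.param (c.coord p).1 = p := by
  rw [param, ContinuousLinearEquiv.symm_apply_eq]
  exact Prod.ext rfl (sub_eq_zero.1 hp).symm

theorem contDiff_defn : ContDiff ℝ 2 c.defn :=
  c.coord.contDiff.snd.sub (c.contDiff_height.comp c.coord.contDiff.fst)

theorem contDiff_param : ContDiff ℝ 2 c.param :=
  c.coord.symm.contDiff.comp (contDiff_id.prodMk c.contDiff_height)

theorem hasFDerivAt_height (y) : HasFDerivAt c.height (fderiv ℝ c.height y) y :=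
  (c.contDiff_height.differentiable two_ne_zero y).hasFDerivAt

theorem fderiv_defn (p v : E) :
    fderiv ℝ c.defn p v = (c.coord v).2 - fderiv ℝ c.height (c.coord p).1 (c.coord v).1 := by
  have hcoord : HasFDerivAt c.coord (c.coord : E →L[ℝ] _) p := c.coord.hasFDerivAt
  have hdefn : HasFDerivAt c.defn _ p :=
    hcoord.snd.sub ((c.hasFDerivAt_height (c.coord p).1).comp p hcoord.fst)
  rw [hdefn.fderiv]
  rfl

theorem fderiv_param (y v) :
    fderiv ℝ c.param y v = c.coord.symm (v, fderiv ℝ c.height y v) := by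
  have hparam : HasFDerivAt c.param _ y :=
    c.coord.symm.hasFDerivAt.comp y ((hasFDerivAt_id y).prodMk (c.hasFDerivAt_height y))
  rw [hparam.fderiv]
  rfl

theorem coord_fderiv_param (y v) :
    c.coord (fderiv ℝ c.param y v) = (v, fderiv ℝ c.height y v) := by
  rw [fderiv_param, ContinuousLinearEquiv.apply_symm_apply]

theorem fderiv_defn_fderiv_param (y v) :
    fderiv ℝ c.defn (c.param y) (fderiv ℝ c.param y v) = 0 := by
  rw [fderiv_defn, coord_param, coord_fderiv_param, sub_self]

theorem fderiv_param_coord {p v : E} (hv : fderiv ℝ c.defn p v = 0) :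
    fderiv ℝ c.param (c.coord p).1 (c.coord v).1 = v := by
  rw [fderiv_param, ContinuousLinearEquiv.symm_apply_eq]
  rw [fderiv_defn, sub_eq_zero] at hv
  exact Prod.ext rfl hv.symm

theorem isLocalDefining {p : E} (hp : p ∈ c.dom) (h0 : c.defn p = 0) :
    IsLocalDefining Ω c.defn p := by
  refine ⟨c.contDiff_defn.contDiffAt, h0, fun h => ?_, ?_⟩
  · have hvert := c.fderiv_defn p (c.coord.symm (0, 1))
    simp [h] at hvert
  · filter_upwards [c.isOpen_dom.mem_nhds hp] with q hq using c.mem_iff_defn_neg hq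

theorem mem_frontier_iff {p : E} (hp : p ∈ c.dom) : p ∈ frontier Ω ↔ c.defn p = 0 := by
  refine ⟨fun h => ?_, fun h => (c.isLocalDefining hp h).mem_frontier⟩
  have hcont : ContinuousAt c.defn p := c.contDiff_defn.continuous.continuousAt
  have hdom : ∀ᶠ q in 𝓝 p, q ∈ c.dom := c.isOpen_dom.mem_nhds hp
  refine le_antisymm ?_ ?_
  · by_contra! hpos
    refine mem_closure_iff_frequently.1 (frontier_subset_closure h) ?_
    filter_upwards [hdom, hcont.eventually_const_lt hpos] with q hq hq'
    exact fun hmem => hq'.not_gt ((c.mem_iff_defn_neg hq).1 hmem)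
  · by_contra! hneg
    refine h.2 (mem_interior_iff_mem_nhds.2 ?_)
    filter_upwards [hdom, hcont.eventually_lt_const hneg] with q hq hq'
    exact (c.mem_iff_defn_neg hq).2 hq'

theorem param_mem_frontier {y} (hy : c.param y ∈ c.dom) : c.param y ∈ frontier Ω :=
  (c.mem_frontier_iff hy).2 (c.defn_param y)

theorem isLocalParam : StepTwoCarnot.IsLocalParam (frontier Ω) (c.param ⁻¹' c.dom) c.param := by
  refine ⟨c.isOpen_dom.preimage c.contDiff_param.continuous,
    (c.contDiff_param.of_le one_le_two).contDiffOn, fun y _ y' _ h => ?_, fun y _ v v' h => ?_,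
    fun y hy => c.param_mem_frontier hy⟩
  · have hcoord := congrArg c.coord h
    rw [coord_param, coord_param] at hcoord
    exact (Prod.mk.inj hcoord).1
  · have hcoord := congrArg c.coord h
    rw [coord_fderiv_param, coord_fderiv_param] at hcoord
    exact (Prod.mk.inj hcoord).1

/-- The orthonormal basis of `E` along the coordinate axes of the chart. -/
noncomputable def basis : OrthonormalBasis (Fin (Module.finrank ℝ E - 1) ⊕ Unit) ℝ E :=
  ((EuclideanSpace.basisFun _ ℝ).prod (OrthonormalBasis.singleton Unit ℝ)).map c.isometry.symm

theorem basis_repr_inl (p : E) (i) : c.basis.repr p (Sum.inl i) = (c.coord p).1 i := by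
  rw [OrthonormalBasis.repr_apply_apply, ← c.isometry.inner_map_map]
  simp [basis, coord, WithLp.prod_inner_apply, EuclideanSpace.inner_single_left]

theorem basis_repr_inr (p : E) (i) : c.basis.repr p (Sum.inr i) = (c.coord p).2 := by
  rw [OrthonormalBasis.repr_apply_apply, ← c.isometry.inner_map_map]
  simp [basis, coord, WithLp.prod_inner_apply]

theorem det_toMatrix_basis (y) (w : E) :
    (c.basis.toBasis.toMatrix
      (Sum.elim (fun i => fderiv ℝ c.param y (EuclideanSpace.single i 1)) fun _ : Unit => w)).det =
      fderiv ℝ c.defn (c.param y) w := by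
  have hmat : c.basis.toBasis.toMatrix
      (Sum.elim (fun i => fderiv ℝ c.param y (EuclideanSpace.single i 1)) fun _ : Unit => w) =
      Matrix.fromBlocks 1 (Matrix.of fun i _ => (c.coord w).1 i)
        (Matrix.of fun _ i => fderiv ℝ c.height y (EuclideanSpace.single i 1))
        (Matrix.of fun _ _ => (c.coord w).2) := by
    ext i j
    rw [Module.Basis.toMatrix_apply, OrthonormalBasis.coe_toBasis_repr_apply]
    rcases i with i | i <;> rcases j with j | j <;>
      simp [basis_repr_inl, basis_repr_inr, coord_fderiv_param, Matrix.one_apply]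
  have hheight : fderiv ℝ c.height y (c.coord w).1 =
      ∑ i, fderiv ℝ c.height y (EuclideanSpace.single i 1) * (c.coord w).1 i := by
    conv_lhs => rw [← (EuclideanSpace.basisFun _ ℝ).sum_repr (c.coord w).1]
    simp only [map_sum, map_smul, EuclideanSpace.basisFun_repr, EuclideanSpace.basisFun_apply,
      smul_eq_mul, mul_comm]
  rw [hmat, Matrix.det_fromBlocks_one₁₁, Matrix.det_unique, fderiv_defn, coord_param, hheight]
  rfl

end GraphChart

section GramDeterminant

variable {E : Type*} [NormedAddCommGroup E] [InnerProductSpace ℝ E] {ι : Type*} [Fintype ι]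
  [DecidableEq ι]

theorem det_gram_comp_linearMap (β : OrthonormalBasis ι ℝ E)
    (A : E →ₗ[ℝ] E) (x : ι → E) :
    (Matrix.gram ℝ (A ∘ x)).det = LinearMap.det A ^ 2 * (β.toBasis.toMatrix x).det ^ 2 := by
  have hdet := Module.Basis.det_comp β.toBasis A x
  rw [Module.Basis.det_apply, Module.Basis.det_apply] at hdet
  have hgram : Matrix.gram ℝ (A ∘ x) =
      (β.toBasis.toMatrix (A ∘ x)).conjTranspose * β.toBasis.toMatrix (A ∘ x) :=
    Matrix.gram_eq_conjTranspose_mul β _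
  rw [hgram, Matrix.det_mul, Matrix.det_conjTranspose, hdet, star_trivial]
  ring

theorem det_gram_sumElim_of_norm_eq_one {x : ι → E} {n : E} (hn : ‖n‖ = 1)
    (hx : ∀ i, inner ℝ n (x i) = 0) :
    (Matrix.gram ℝ (Sum.elim x fun _ : Unit => n)).det = (Matrix.gram ℝ x).det := by
  have hblock : Matrix.gram ℝ (Sum.elim x fun _ : Unit => n) =
      Matrix.fromBlocks (Matrix.gram ℝ x) 0 0 1 := by
    ext i j
    rcases i with i | i <;> rcases j with j | j <;>
      simp [Matrix.gram_apply, hx, hn, real_inner_comm n]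
  rw [hblock, Matrix.det_fromBlocks_zero₂₁, Matrix.det_one, mul_one]

end GramDeterminant

namespace StepTwoCarnot

section Normal

variable {E : Type*} [NormedAddCommGroup E] [InnerProductSpace ℝ E] (𝔾 : StepTwoCarnot E)
  {Ω : Set E} {φ : E → ℝ} {g : E}

theorem outerNormal_eq_zero (hg : g ∉ frontier Ω) : 𝔾.outerNormal Ω g = 0 := by
  rw [outerNormal, dif_neg]
  rintro ⟨ν, -, φ, hφ, -⟩
  exact hg hφ.mem_frontier

variable [FiniteDimensional ℝ E]

/-- The Riemannian gradient of `φ` at `g`, translated to the identity. -/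
noncomputable def leftInvGradient (φ : E → ℝ) (g : E) : E :=
  (InnerProductSpace.toDual ℝ E).symm ((fderiv ℝ φ g).comp (𝔾.leftInvCLM g))

theorem inner_leftInvGradient (φ : E → ℝ) (g v : E) :
    inner ℝ (𝔾.leftInvGradient φ g) v = fderiv ℝ φ g (𝔾.leftInv v g) := by
  rw [leftInvGradient, InnerProductSpace.toDual_symm_apply, ← leftInvCLM_apply]
  rfl

theorem inner_leftInvGradient_leftInv_neg (φ : E → ℝ) (g v : E) :
    inner ℝ (𝔾.leftInvGradient φ g) (𝔾.leftInv v (-g)) = fderiv ℝ φ g v := by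
  rw [inner_leftInvGradient, leftInv_leftInv_neg]

theorem leftInvGradient_ne_zero (h : fderiv ℝ φ g ≠ 0) : 𝔾.leftInvGradient φ g ≠ 0 := by
  contrapose! h
  ext v
  rw [← inner_leftInvGradient_leftInv_neg 𝔾, h, inner_zero_left, zero_apply]

/-- The unit normal of the level set of `φ` at `g`, translated to the identity. -/
noncomputable def unitGradient (φ : E → ℝ) (g : E) : E :=
  ‖𝔾.leftInvGradient φ g‖⁻¹ • 𝔾.leftInvGradient φ g

theorem norm_unitGradient (h : fderiv ℝ φ g ≠ 0) : ‖𝔾.unitGradient φ g‖ = 1 :=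
  norm_smul_inv_norm (𝕜 := ℝ) (𝔾.leftInvGradient_ne_zero h)

theorem fderiv_eq_norm_mul_metric (h : fderiv ℝ φ g ≠ 0) (v : E) :
    fderiv ℝ φ g v = ‖𝔾.leftInvGradient φ g‖ *
      𝔾.metric g (𝔾.leftInv (𝔾.unitGradient φ g) g) v := by
  rw [metric_eq_inner, leftInv_neg_leftInv, unitGradient, real_inner_smul_left,
    inner_leftInvGradient_leftInv_neg,
    mul_inv_cancel_left₀ (norm_ne_zero_iff.2 (𝔾.leftInvGradient_ne_zero h))]

theorem isOuterNormal_leftInv_unitGradient (h : IsLocalDefining Ω φ g) :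
    𝔾.IsOuterNormal Ω g (𝔾.leftInv (𝔾.unitGradient φ g) g) := by
  refine ⟨?_, φ, h, ‖𝔾.leftInvGradient φ g‖, norm_pos_iff.2 (𝔾.leftInvGradient_ne_zero h.2.2.1),
    𝔾.fderiv_eq_norm_mul_metric h.2.2.1⟩
  rw [metric_leftInv, real_inner_self_eq_norm_sq, 𝔾.norm_unitGradient h.2.2.1, one_pow]

theorem IsOuterNormal.eq_leftInv_unitGradient {ν : E} (hν : 𝔾.IsOuterNormal Ω g ν)
    (h : IsLocalDefining Ω φ g) : ν = 𝔾.leftInv (𝔾.unitGradient φ g) g := by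
  obtain ⟨hunit, φ', hφ', c', hc', hφ'ν⟩ := hν
  obtain ⟨c, hc, hφφ'⟩ := hφ'.exists_fderiv_eq_smul h
  have hgrad : 𝔾.leftInvGradient φ g = (c * c') • 𝔾.leftInv ν (-g) := by
    refine ext_inner_right ℝ fun v => ?_
    rw [inner_leftInvGradient, hφφ', smul_apply, hφ'ν, metric_eq_inner,
      leftInv_neg_leftInv, real_inner_smul_left, smul_eq_mul, mul_assoc]
  have hnorm : ‖𝔾.leftInv ν (-g)‖ = 1 := by
    rw [metric_eq_inner, real_inner_self_eq_norm_sq] at hunit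
    exact (pow_eq_one_iff_of_nonneg (norm_nonneg _) two_ne_zero).1 hunit
  have hcc' : 0 < c * c' := mul_pos hc hc'
  rw [unitGradient, hgrad, norm_smul, hnorm, mul_one, Real.norm_of_nonneg hcc'.le,
    inv_smul_smul₀ hcc'.ne', leftInv_leftInv_neg]

theorem outerNormal_eq (h : IsLocalDefining Ω φ g) :
    𝔾.outerNormal Ω g = 𝔾.leftInv (𝔾.unitGradient φ g) g := by
  have hex : ∃ ν, 𝔾.IsOuterNormal Ω g ν := ⟨_, 𝔾.isOuterNormal_leftInv_unitGradient h⟩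
  rw [outerNormal, dif_pos hex]
  exact IsOuterNormal.eq_leftInv_unitGradient 𝔾 hex.choose_spec h

theorem norm_mul_metric_outerNormal (h : IsLocalDefining Ω φ g) (v : E) :
    ‖𝔾.leftInvGradient φ g‖ * 𝔾.metric g (𝔾.outerNormal Ω g) v = fderiv ℝ φ g v := by
  rw [𝔾.outerNormal_eq h, ← 𝔾.fderiv_eq_norm_mul_metric h.2.2.1]

end Normal

section Area

variable {E : Type*} [NormedAddCommGroup E] [InnerProductSpace ℝ E] [FiniteDimensional ℝ E]
  (𝔾 : StepTwoCarnot E) {Ω : Set E}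

theorem areaElement_eq_sqrt_det_gram {d : ℕ} (ψ : EuclideanSpace ℝ (Fin d) → E)
    (y : EuclideanSpace ℝ (Fin d)) :
    𝔾.areaElement ψ y = √(Matrix.gram ℝ fun i =>
      𝔾.leftInv (fderiv ℝ ψ y (EuclideanSpace.single i 1)) (-ψ y)).det := by
  unfold areaElement
  simp only [metric_eq_inner]
  rfl

theorem areaElement_param (c : GraphChart Ω) {y} (hy : c.param y ∈ c.dom) :
    𝔾.areaElement c.param y = ‖𝔾.leftInvGradient c.defn (c.param y)‖ := by
  set g := c.param y
  have hdef : fderiv ℝ c.defn g ≠ 0 := (c.isLocalDefining hy (c.defn_param y)).2.2.1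
  set n := 𝔾.unitGradient c.defn g with hn
  let D (i) : E := fderiv ℝ c.param y (EuclideanSpace.single i 1)
  have htangent (i) : inner ℝ n (𝔾.leftInv (D i) (-g)) = 0 := by
    rw [hn, unitGradient, real_inner_smul_left, inner_leftInvGradient_leftInv_neg,
      c.fderiv_defn_fderiv_param, mul_zero]
  have hflux : fderiv ℝ c.defn g (𝔾.leftInv n g) = ‖𝔾.leftInvGradient c.defn g‖ := by
    rw [𝔾.fderiv_eq_norm_mul_metric hdef, metric_leftInv, real_inner_self_eq_norm_sq,
      𝔾.norm_unitGradient hdef, one_pow, mul_one]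
  have htranslate : ⇑(𝔾.leftInvCLM (-g) : E →ₗ[ℝ] E) ∘
      Sum.elim D (fun _ : Unit => 𝔾.leftInv n g) =
        Sum.elim (fun i => 𝔾.leftInv (D i) (-g)) fun _ => n := by
    funext i
    rcases i with i | i <;> simp [leftInvCLM_apply, leftInv_neg_leftInv]
  -- Completing the tangent vectors by the unit normal does not change the Gram determinant.
  have hgram : (Matrix.gram ℝ fun i => 𝔾.leftInv (D i) (-g)).det =
      ‖𝔾.leftInvGradient c.defn g‖ ^ 2 := by
    rw [← det_gram_sumElim_of_norm_eq_one (𝔾.norm_unitGradient hdef) htangent, ← htranslate,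
      det_gram_comp_linearMap c.basis, det_leftInvCLM, one_pow, one_mul, c.det_toMatrix_basis,
      hflux]
  rw [areaElement_eq_sqrt_det_gram, hgram, Real.sqrt_sq (norm_nonneg _)]

theorem areaElement_mul_metric (c : GraphChart Ω) {y} (hy : c.param y ∈ c.dom) (v : E) :
    𝔾.areaElement c.param y * 𝔾.metric (c.param y) (𝔾.outerNormal Ω (c.param y)) v =
      fderiv ℝ c.defn (c.param y) v := by
  rw [𝔾.areaElement_param c hy,
    𝔾.norm_mul_metric_outerNormal (c.isLocalDefining hy (c.defn_param y))]

end Area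

end StepTwoCarnot

/-! ### The surface measure -/

theorem det_gram_comp_toMatrix {E : Type*} [NormedAddCommGroup E] [InnerProductSpace ℝ E] {d : ℕ}
    (K : EuclideanSpace ℝ (Fin d) →ₗ[ℝ] E)
    (T : EuclideanSpace ℝ (Fin d) →ₗ[ℝ] EuclideanSpace ℝ (Fin d)) :
    (Matrix.gram ℝ fun i => K (T (EuclideanSpace.single i 1))).det =
      LinearMap.det T ^ 2 * (Matrix.gram ℝ fun i => K (EuclideanSpace.single i 1)).det := by
  let β := (EuclideanSpace.basisFun (Fin d) ℝ).toBasis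
  let M := LinearMap.toMatrix β β T
  have hexpand (j : Fin d) : K (T (EuclideanSpace.single j 1)) =
      ∑ k, M k j • K (EuclideanSpace.single k 1) := by
    conv_lhs => rw [← (EuclideanSpace.basisFun (Fin d) ℝ).sum_repr (T (EuclideanSpace.single j 1))]
    simp [M, β, LinearMap.toMatrix_apply]
  have hgram : (Matrix.gram ℝ fun i => K (T (EuclideanSpace.single i 1))) =
      M.transpose * (Matrix.gram ℝ fun i => K (EuclideanSpace.single i 1)) * M := by
    ext i j
    simp only [Matrix.gram_apply, hexpand, Matrix.mul_apply, Matrix.transpose_apply, sum_inner,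
      inner_sum, real_inner_smul_left, real_inner_smul_right, Finset.sum_mul]
    exact Finset.sum_congr rfl fun k _ => Finset.sum_congr rfl fun l _ => by ring
  rw [hgram, Matrix.det_mul, Matrix.det_mul, Matrix.det_transpose, LinearMap.det_toMatrix]
  ring

namespace StepTwoCarnot

section ParamMeasure

variable {E : Type*} [NormedAddCommGroup E] [InnerProductSpace ℝ E] (𝔾 : StepTwoCarnot E)

theorem areaElement_eq_abs_det_mul [FiniteDimensional ℝ E] {d : ℕ}
    {ψ ψ' : EuclideanSpace ℝ (Fin d) → E} {y y' : EuclideanSpace ℝ (Fin d)}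
    {T : EuclideanSpace ℝ (Fin d) →L[ℝ] EuclideanSpace ℝ (Fin d)} (h₀ : ψ' y' = ψ y)
    (h : fderiv ℝ ψ y = (fderiv ℝ ψ' y').comp T) :
    𝔾.areaElement ψ y = |T.det| * 𝔾.areaElement ψ' y' := by
  have hdet := det_gram_comp_toMatrix
    ((𝔾.leftInvCLM (-ψ y)).comp (fderiv ℝ ψ' y')).toLinearMap T.toLinearMap
  simp only [ContinuousLinearMap.coe_coe, ContinuousLinearMap.comp_apply, leftInvCLM_apply]
    at hdet
  simp only [areaElement_eq_sqrt_det_gram, h, h₀, ContinuousLinearMap.comp_apply]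
  rw [hdet, Real.sqrt_mul (sq_nonneg _), Real.sqrt_sq_eq_abs]

variable [MeasurableSpace E] {d : ℕ}

/-- The Riemannian surface measure carried by a parametrization `ψ` of the set `U`. -/
noncomputable def paramMeasure (U : Set (EuclideanSpace ℝ (Fin d)))
    (ψ : EuclideanSpace ℝ (Fin d) → E) : Measure E :=
  ((volume.restrict U).withDensity fun y => ENNReal.ofReal (𝔾.areaElement ψ y)).map ψ

variable [BorelSpace E] {U : Set (EuclideanSpace ℝ (Fin d))} {ψ : EuclideanSpace ℝ (Fin d) → E}
  {S B : Set E}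

theorem IsLocalParam.measurableSet_inter_preimage (h : IsLocalParam S U ψ)
    (hB : MeasurableSet B) : MeasurableSet (U ∩ ψ ⁻¹' B) := by
  classical
  have hmeas := (h.2.1.continuousOn.measurable_piecewise (continuousOn_const (c := (0 : E)))
    h.1.measurableSet hB).inter h.1.measurableSet
  convert hmeas using 1
  ext y
  by_cases hy : y ∈ U <;> simp [hy]

theorem paramMeasure_apply (h : IsLocalParam S U ψ) (hB : MeasurableSet B) :
    𝔾.paramMeasure U ψ B = ∫⁻ y in U ∩ ψ ⁻¹' B, ENNReal.ofReal (𝔾.areaElement ψ y) := by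
  have hU : MeasurableSet U := h.1.measurableSet
  have hψ : AEMeasurable ψ (volume.restrict U) := h.2.1.continuousOn.aemeasurable hU
  rw [paramMeasure, Measure.map_apply_of_aemeasurable
    (hψ.mono_ac (withDensity_absolutelyContinuous _ _)) hB, withDensity_apply',
    Measure.restrict_restrict' hU, inter_comm]

end ParamMeasure

section ChartMeasure

variable {E : Type*} [NormedAddCommGroup E] [InnerProductSpace ℝ E] (𝔾 : StepTwoCarnot E)
  {Ω : Set E} {U : Set (EuclideanSpace ℝ (Fin (Module.finrank ℝ E - 1)))}
  {ψ : EuclideanSpace ℝ (Fin (Module.finrank ℝ E - 1)) → E}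

theorem IsLocalParam.hasFDerivAt {d : ℕ} {S : Set E} {U : Set (EuclideanSpace ℝ (Fin d))}
    {ψ : EuclideanSpace ℝ (Fin d) → E} {y} (h : IsLocalParam S U ψ) (hy : y ∈ U) :
    HasFDerivAt ψ (fderiv ℝ ψ y) y :=
  ((h.2.1.contDiffAt (h.1.mem_nhds hy)).differentiableAt one_ne_zero).hasFDerivAt

theorem IsLocalParam.param_base (h : IsLocalParam (frontier Ω) U ψ) (c : GraphChart Ω) {y}
    (hy : y ∈ U) (hyd : ψ y ∈ c.dom) : c.param (c.base (ψ y)) = ψ y :=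
  c.param_coord ((c.mem_frontier_iff hyd).1 (h.2.2.2.2 hy))

theorem IsLocalParam.areaElement_eq [FiniteDimensional ℝ E] (h : IsLocalParam (frontier Ω) U ψ)
    (c : GraphChart Ω) {y} (hy : y ∈ U) (hyd : ψ y ∈ c.dom) :
    𝔾.areaElement ψ y =
      |(c.base.comp (fderiv ℝ ψ y)).det| * 𝔾.areaElement c.param (c.base (ψ y)) := by
  refine 𝔾.areaElement_eq_abs_det_mul (h.param_base c hy hyd) ?_
  have hev : ψ =ᶠ[𝓝 y] c.param ∘ c.base ∘ ψ := by
    filter_upwards [h.1.mem_nhds hy,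
      (h.hasFDerivAt hy).continuousAt.eventually_mem (c.isOpen_dom.mem_nhds hyd)] with z hz hzd
    exact (h.param_base c hz hzd).symm
  have hparam : HasFDerivAt c.param (fderiv ℝ c.param (c.base (ψ y))) (c.base (ψ y)) :=
    (c.contDiff_param.differentiable two_ne_zero _).hasFDerivAt
  exact hev.fderiv_eq.trans
    (hparam.comp y (c.base.hasFDerivAt.comp y (h.hasFDerivAt hy))).fderiv

variable [MeasurableSpace E] [BorelSpace E]

theorem paramMeasure_le_surfaceMeasure (h : IsLocalParam (frontier Ω) U ψ) :
    𝔾.paramMeasure U ψ ≤ 𝔾.surfaceMeasure Ω :=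
  le_sSup ⟨U, ψ, h, rfl⟩

/-- The surface measure carried by the graph of a chart. -/
noncomputable def chartMeasure (c : GraphChart Ω) : Measure E :=
  𝔾.paramMeasure (c.param ⁻¹' c.dom) c.param

theorem chartMeasure_apply (c : GraphChart Ω) {B : Set E} (hB : MeasurableSet B) :
    𝔾.chartMeasure c B =
      ∫⁻ y in c.param ⁻¹' (c.dom ∩ B), ENNReal.ofReal (𝔾.areaElement c.param y) :=
  𝔾.paramMeasure_apply c.isLocalParam hB

theorem chartMeasure_restrict_dom (c : GraphChart Ω) :
    (𝔾.chartMeasure c).restrict c.dom = 𝔾.chartMeasure c := by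
  ext B hB
  rw [Measure.restrict_apply hB, 𝔾.chartMeasure_apply c (hB.inter c.isOpen_dom.measurableSet),
    𝔾.chartMeasure_apply c hB, inter_left_comm, inter_self, inter_comm]

theorem surfaceMeasure_compl_frontier : 𝔾.surfaceMeasure Ω (frontier Ω)ᶜ = 0 := by
  have hm : MeasurableSet (frontier Ω) := isClosed_frontier.measurableSet
  have hle : 𝔾.surfaceMeasure Ω ≤ (𝔾.surfaceMeasure Ω).restrict (frontier Ω) := by
    refine sSup_le ?_
    rintro _ ⟨U, ψ, h, rfl⟩
    refine Measure.le_iff.2 fun B hB => ?_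
    rw [Measure.restrict_apply hB]
    refine le_trans ?_ (Measure.le_iff'.1 (𝔾.paramMeasure_le_surfaceMeasure h) _)
    change 𝔾.paramMeasure U ψ B ≤ _
    rw [𝔾.paramMeasure_apply h hB, 𝔾.paramMeasure_apply h (hB.inter hm)]
    exact lintegral_mono_set fun y hy => ⟨hy.1, hy.2, h.2.2.2.2 hy.1⟩
  have hcompl := Measure.le_iff'.1 hle (frontier Ω)ᶜ
  rwa [Measure.restrict_apply hm.compl, compl_inter_self, measure_empty, nonpos_iff_eq_zero]
    at hcompl

variable [FiniteDimensional ℝ E]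

theorem paramMeasure_le_chartMeasure (c : GraphChart Ω) (h : IsLocalParam (frontier Ω) U ψ)
    {B : Set E} (hB : MeasurableSet B) (hBc : B ⊆ c.dom) :
    𝔾.paramMeasure U ψ B ≤ 𝔾.chartMeasure c B := by
  set s := U ∩ ψ ⁻¹' B
  have hs : MeasurableSet s := h.measurableSet_inter_preimage hB
  have hparam (y) (hy : y ∈ s) : c.param (c.base (ψ y)) = ψ y := h.param_base c hy.1 (hBc hy.2)
  have hderiv (y) (hy : y ∈ s) :
      HasFDerivWithinAt (c.base ∘ ψ) (c.base.comp (fderiv ℝ ψ y)) s y :=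
    (c.base.hasFDerivAt.comp y (h.hasFDerivAt hy.1)).hasFDerivWithinAt
  have hinj : InjOn (c.base ∘ ψ) s := fun y hy y' hy' heq => by
    refine h.2.2.1 hy.1 hy'.1 ?_
    rw [← hparam y hy, ← hparam y' hy']
    exact congrArg c.param heq
  calc 𝔾.paramMeasure U ψ B
      = ∫⁻ y in s, ENNReal.ofReal (𝔾.areaElement ψ y) := 𝔾.paramMeasure_apply h hB
    _ = ∫⁻ y in s, ENNReal.ofReal |(c.base.comp (fderiv ℝ ψ y)).det| *
          ENNReal.ofReal (𝔾.areaElement c.param (c.base (ψ y))) := by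
        refine setLIntegral_congr_fun hs fun y hy => ?_
        simp only [h.areaElement_eq 𝔾 c hy.1 (hBc hy.2), ENNReal.ofReal_mul (abs_nonneg _)]
    _ = ∫⁻ y in c.base ∘ ψ '' s, ENNReal.ofReal (𝔾.areaElement c.param y) :=
        (lintegral_image_eq_lintegral_abs_det_fderiv_mul volume hs hderiv hinj fun y =>
          ENNReal.ofReal (𝔾.areaElement c.param y)).symm
    _ ≤ ∫⁻ y in c.param ⁻¹' (c.dom ∩ B), ENNReal.ofReal (𝔾.areaElement c.param y) := by
        refine lintegral_mono_set (image_subset_iff.2 fun y hy => ?_)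
        rw [mem_preimage, mem_preimage, Function.comp_apply, hparam y hy]
        exact ⟨hBc hy.2, hy.2⟩
    _ = 𝔾.chartMeasure c B := (𝔾.chartMeasure_apply c hB).symm

theorem surfaceMeasure_restrict_dom (c : GraphChart Ω) :
    (𝔾.surfaceMeasure Ω).restrict c.dom = 𝔾.chartMeasure c := by
  have hdom := c.isOpen_dom.measurableSet
  refine le_antisymm ?_ ?_
  · have hle : 𝔾.surfaceMeasure Ω ≤
        (𝔾.surfaceMeasure Ω).restrict c.domᶜ + 𝔾.chartMeasure c := by
      refine sSup_le ?_
      rintro _ ⟨U, ψ, h, rfl⟩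
      refine Measure.le_iff.2 fun B hB => ?_
      rw [← measure_inter_add_sdiff B hdom, add_comm, Measure.add_apply]
      refine add_le_add ?_ ?_
      · rw [Measure.restrict_apply hB, ← sdiff_eq]
        exact Measure.le_iff'.1 (𝔾.paramMeasure_le_surfaceMeasure h) _
      · exact (𝔾.paramMeasure_le_chartMeasure c h (hB.inter hdom) inter_subset_right).trans
          (measure_mono inter_subset_left)
    refine (Measure.restrict_mono_measure hle c.dom).trans ?_
    rw [Measure.restrict_add, Measure.restrict_restrict hdom, inter_compl_self,
      Measure.restrict_empty, zero_add, 𝔾.chartMeasure_restrict_dom]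
  · rw [← 𝔾.chartMeasure_restrict_dom c]
    exact Measure.restrict_mono_measure (𝔾.paramMeasure_le_surfaceMeasure c.isLocalParam) c.dom

end ChartMeasure

section SurfaceMeasure

variable {E : Type*} [NormedAddCommGroup E] [InnerProductSpace ℝ E] [FiniteDimensional ℝ E]
  (𝔾 : StepTwoCarnot E) {Ω : Set E}

theorem continuous_leftInvGradient {φ : E → ℝ} (hφ : ContDiff ℝ 1 φ) :
    Continuous (𝔾.leftInvGradient φ) :=
  (InnerProductSpace.toDual ℝ E).symm.continuous.comp
    ((hφ.continuous_fderiv one_ne_zero).clm_comp (𝔾.contDiff_leftInvCLM (n := 0)).continuous)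

theorem continuous_norm_leftInvGradient_param (c : GraphChart Ω) :
    Continuous fun y => ‖𝔾.leftInvGradient c.defn (c.param y)‖ :=
  ((𝔾.continuous_leftInvGradient (c.contDiff_defn.of_le one_le_two)).comp
    c.contDiff_param.continuous).norm

variable [MeasurableSpace E] [BorelSpace E]

theorem chartMeasure_lt_top_of_isCompact (c : GraphChart Ω) {K : Set E} (hK : IsCompact K)
    (hKc : K ⊆ c.dom) : 𝔾.chartMeasure c K < ⊤ := by
  have hcompact : IsCompact (c.param ⁻¹' K) := by
    refine (hK.image c.base.continuous).of_isClosed_subset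
      (hK.isClosed.preimage c.contDiff_param.continuous) fun y hy => ⟨c.param y, hy, ?_⟩
    exact congrArg Prod.fst (c.coord_param y)
  obtain ⟨C, hC⟩ := hcompact.exists_bound_of_continuousOn
    (𝔾.continuous_norm_leftInvGradient_param c).continuousOn
  rw [𝔾.chartMeasure_apply c hK.isClosed.measurableSet, inter_eq_right.2 hKc]
  calc ∫⁻ y in c.param ⁻¹' K, ENNReal.ofReal (𝔾.areaElement c.param y)
      ≤ ∫⁻ _ in c.param ⁻¹' K, ENNReal.ofReal C := by
        refine setLIntegral_mono' hcompact.isClosed.measurableSet fun y hy =>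
          ENNReal.ofReal_le_ofReal ?_
        rw [𝔾.areaElement_param c (hKc hy)]
        exact (norm_norm _).symm.trans_le (hC y hy)
    _ < ⊤ := by
        rw [setLIntegral_const]
        exact ENNReal.mul_lt_top ENNReal.ofReal_lt_top hcompact.measure_lt_top

theorem isFiniteMeasure_surfaceMeasure (hΩ : IsC2BoundedOpen Ω) :
    IsFiniteMeasure (𝔾.surfaceMeasure Ω) := by
  have hcompact : IsCompact (frontier Ω) :=
    hΩ.2.1.isCompact_closure.of_isClosed_subset isClosed_frontier frontier_subset_closure
  have hfrontier : 𝔾.surfaceMeasure Ω (frontier Ω) < ⊤ := by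
    refine hcompact.measure_lt_top_of_nhdsWithin fun g hg => ?_
    obtain ⟨φ, hφ⟩ := hΩ.2.2 g hg
    obtain ⟨c, hc⟩ := exists_graphChart hφ
    obtain ⟨K, hK, hgK, hKc⟩ := exists_compact_subset c.isOpen_dom hc
    refine ⟨K, mem_nhdsWithin_of_mem_nhds (mem_interior_iff_mem_nhds.1 hgK), ?_⟩
    have hlt := 𝔾.chartMeasure_lt_top_of_isCompact c hK hKc
    rwa [← 𝔾.surfaceMeasure_restrict_dom c, Measure.restrict_eq_self _ hKc] at hlt
  refine ⟨?_⟩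
  rw [← measure_add_measure_compl isClosed_frontier.measurableSet,
    𝔾.surfaceMeasure_compl_frontier, add_zero]
  exact hfrontier

theorem setIntegral_dom_surfaceMeasure (c : GraphChart Ω) {f : E → ℝ}
    (hf : AEStronglyMeasurable f (𝔾.surfaceMeasure Ω)) :
    ∫ p in c.dom, f p ∂(𝔾.surfaceMeasure Ω) =
      ∫ y in c.param ⁻¹' c.dom, 𝔾.areaElement c.param y * f (c.param y) := by
  have hdom : MeasurableSet (c.param ⁻¹' c.dom) :=
    (c.isOpen_dom.preimage c.contDiff_param.continuous).measurableSet
  have hf' : AEStronglyMeasurable f (𝔾.chartMeasure c) :=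
    𝔾.surfaceMeasure_restrict_dom c ▸ hf.restrict
  have harea : AEMeasurable (fun y => ENNReal.ofReal (𝔾.areaElement c.param y))
      (volume.restrict (c.param ⁻¹' c.dom)) := by
    refine ⟨_, (𝔾.continuous_norm_leftInvGradient_param c).measurable.ennreal_ofReal, ?_⟩
    filter_upwards [ae_restrict_mem hdom] with y hy using by rw [𝔾.areaElement_param c hy]
  rw [𝔾.surfaceMeasure_restrict_dom c]
  unfold chartMeasure paramMeasure at hf' ⊢
  rw [integral_map c.contDiff_param.continuous.measurable.aemeasurable hf',
    integral_withDensity_eq_integral_toReal_smul₀ harea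
      (ae_of_all _ fun _ => ENNReal.ofReal_lt_top)]
  simp only [ENNReal.toReal_ofReal (Real.sqrt_nonneg _), areaElement, smul_eq_mul]

end SurfaceMeasure

end StepTwoCarnot

/-! ### The divergence theorem -/

section Layer

/-- A smooth step function, equal to `0` on `(-∞, 1]` and to `1` on `[2, ∞)`. -/
noncomputable def stepFn (s : ℝ) : ℝ := Real.smoothTransition (s - 1)

theorem contDiff_stepFn : ContDiff ℝ 1 stepFn :=
  Real.smoothTransition.contDiff.comp (contDiff_id.sub contDiff_const)

theorem stepFn_of_le {s : ℝ} (hs : s ≤ 1) : stepFn s = 0 :=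
  Real.smoothTransition.zero_of_nonpos (sub_nonpos.2 hs)

theorem stepFn_of_ge {s : ℝ} (hs : 2 ≤ s) : stepFn s = 1 :=
  Real.smoothTransition.one_of_one_le (by linarith)

theorem norm_stepFn_le (s : ℝ) : ‖stepFn s‖ ≤ 1 :=
  (Real.norm_of_nonneg (Real.smoothTransition.nonneg _)).trans_le
    (Real.smoothTransition.le_one _)

theorem hasDerivAt_stepFn (s : ℝ) : HasDerivAt stepFn (deriv stepFn s) s :=
  (contDiff_stepFn.differentiable one_ne_zero s).hasDerivAt

theorem continuous_deriv_stepFn : Continuous (deriv stepFn) :=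
  contDiff_stepFn.continuous_deriv le_rfl

theorem deriv_stepFn_of_notMem {s : ℝ} (hs : s ∉ Icc (1 : ℝ) 2) : deriv stepFn s = 0 := by
  rw [mem_Icc, not_and_or, not_le, not_le] at hs
  rcases hs with hs | hs
  · have hzero : stepFn =ᶠ[𝓝 s] fun _ => 0 := by
      filter_upwards [gt_mem_nhds hs] with t ht using stepFn_of_le ht.le
    rw [hzero.deriv_eq, deriv_const]
  · have hone : stepFn =ᶠ[𝓝 s] fun _ => 1 := by
      filter_upwards [lt_mem_nhds hs] with t ht using stepFn_of_ge ht.le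
    rw [hone.deriv_eq, deriv_const]

theorem hasCompactSupport_deriv_stepFn : HasCompactSupport (deriv stepFn) :=
  HasCompactSupport.intro isCompact_Icc fun _ hs => deriv_stepFn_of_notMem hs

theorem integral_deriv_stepFn : ∫ s, deriv stepFn s = 1 := by
  have h := integral_of_hasDerivAt_of_tendsto (m := 0) (n := 1) hasDerivAt_stepFn
    (continuous_deriv_stepFn.integrable_of_hasCompactSupport hasCompactSupport_deriv_stepFn)
    (tendsto_const_nhds.congr' ?_) (tendsto_const_nhds.congr' ?_)
  · rw [h, sub_zero]
  · filter_upwards [eventually_le_atBot (1 : ℝ)] with t ht using (stepFn_of_le ht).symm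
  · filter_upwards [eventually_ge_atTop (2 : ℝ)] with t ht using (stepFn_of_ge ht).symm

theorem integral_mul_comp_mul_sub (f ρ : ℝ → ℝ) (a : ℝ) {r : ℝ} (hr : 0 < r) :
    ∫ t, f t * (ρ (r * (a - t)) * r) = ∫ s, f (a - r⁻¹ * s) * ρ s := by
  have hscale := Measure.integral_comp_mul_left
    (fun x => f (a - x) * (ρ (r * (a - (a - x))) * r)) r⁻¹
  rw [integral_sub_left_eq_self (fun t => f t * (ρ (r * (a - t)) * r)), inv_inv,
    abs_of_pos hr, smul_eq_mul] at hscale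
  refine mul_left_cancel₀ hr.ne' (hscale.symm.trans ?_)
  rw [← integral_const_mul]
  refine integral_congr_ae (ae_of_all _ fun s => ?_)
  simp only [sub_sub_cancel, mul_inv_cancel_left₀ hr.ne']
  ring

variable {F : Type*} [TopologicalSpace F] {k : F × ℝ → ℝ} {h : F → ℝ} {ρ : ℝ → ℝ}

theorem eq_zero_of_notMem_image_fst_tsupport {y : F} (hy : y ∉ Prod.fst '' tsupport k) (t : ℝ) :
    k (y, t) = 0 :=
  image_eq_zero_of_notMem_tsupport fun hmem => hy ⟨_, hmem, rfl⟩

variable [T2Space F] [MeasurableSpace F] [BorelSpace F] {μ : Measure F} [SFinite μ]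
  [IsFiniteMeasureOnCompacts μ]

theorem integral_layer_eq (hk : Continuous k) (hkc : HasCompactSupport k) (hh : Continuous h)
    (hρ : Continuous ρ) (hρc : HasCompactSupport ρ) {r : ℝ} (hr : 0 < r) :
    ∫ q : F × ℝ, k q * (ρ (r * (h q.1 - q.2)) * r) ∂(μ.prod volume) =
      ∫ q : F × ℝ, k (q.1, h q.1 - r⁻¹ * q.2) * ρ q.2 ∂(μ.prod volume) := by
  have hleft : Integrable (fun q : F × ℝ => k q * (ρ (r * (h q.1 - q.2)) * r))
      (μ.prod volume) :=
    Continuous.integrable_of_hasCompactSupport (by fun_prop) hkc.mul_right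
  have hright : Integrable (fun q : F × ℝ => k (q.1, h q.1 - r⁻¹ * q.2) * ρ q.2)
      (μ.prod volume) := by
    refine Continuous.integrable_of_hasCompactSupport (by fun_prop) (.intro
      ((hkc.isCompact.image continuous_fst).prod hρc.isCompact) fun q hq => ?_)
    rw [mem_prod, not_and_or] at hq
    rcases hq with hq | hq
    · rw [eq_zero_of_notMem_image_fst_tsupport hq, zero_mul]
    · rw [image_eq_zero_of_notMem_tsupport hq, mul_zero]
  rw [integral_prod _ hleft, integral_prod _ hright]
  exact integral_congr_ae (ae_of_all _ fun y =>
    integral_mul_comp_mul_sub (fun t => k (y, t)) ρ (h y) hr)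

theorem tendsto_integral_layer (hk : Continuous k) (hkc : HasCompactSupport k)
    (hh : Continuous h) (hρ : Continuous ρ) (hρc : HasCompactSupport ρ) (hρ1 : ∫ s, ρ s = 1) :
    Tendsto (fun r : ℝ => ∫ q : F × ℝ, k q * (ρ (r * (h q.1 - q.2)) * r) ∂(μ.prod volume))
      atTop (𝓝 (∫ y, k (y, h y) ∂μ)) := by
  have hlim : ∫ y, k (y, h y) ∂μ = ∫ q : F × ℝ, k (q.1, h q.1) * ρ q.2 ∂(μ.prod volume) := by
    rw [integral_prod_mul (fun y => k (y, h y)) ρ, hρ1, mul_one]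
  have hrescale : ∀ᶠ r : ℝ in atTop,
      ∫ q : F × ℝ, k (q.1, h q.1 - r⁻¹ * q.2) * ρ q.2 ∂(μ.prod volume) =
        ∫ q : F × ℝ, k q * (ρ (r * (h q.1 - q.2)) * r) ∂(μ.prod volume) := by
    filter_upwards [eventually_gt_atTop 0] with r hr
    exact (integral_layer_eq hk hkc hh hρ hρc hr).symm
  rw [hlim]
  refine Tendsto.congr' hrescale ?_
  obtain ⟨C, hC⟩ := hkc.exists_bound_of_continuous hk
  have hK : IsCompact (Prod.fst '' tsupport k) := hkc.isCompact.image continuous_fst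
  refine tendsto_integral_filter_of_dominated_convergence
    (fun q => (Prod.fst '' tsupport k).indicator (fun _ => C) q.1 * ‖ρ q.2‖)
    (Eventually.of_forall fun r => Continuous.aestronglyMeasurable (by fun_prop))
    (Eventually.of_forall fun r => ae_of_all _ fun q => ?_) ?_ (ae_of_all _ fun q => ?_)
  · rw [norm_mul]
    refine mul_le_mul_of_nonneg_right ?_ (norm_nonneg _)
    by_cases hq : q.1 ∈ Prod.fst '' tsupport k
    · rw [indicator_of_mem hq]
      exact hC _
    · rw [indicator_of_notMem hq, eq_zero_of_notMem_image_fst_tsupport hq, norm_zero]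
  · exact ((integrable_indicator_iff hK.measurableSet).2
      (integrableOn_const hK.measure_lt_top.ne)).mul_prod
      (hρ.integrable_of_hasCompactSupport hρc).norm
  · have hcont : Continuous fun x : ℝ => k (q.1, h q.1 - x * q.2) := by fun_prop
    have hlimit := (hcont.tendsto 0).comp tendsto_inv_atTop_zero
    rw [zero_mul, sub_zero] at hlimit
    exact hlimit.mul_const _

end Layer

section WeakDivergence

variable {E : Type*} [NormedAddCommGroup E] [InnerProductSpace ℝ E] {Ω : Set E}

namespace GraphChart

/-- A function which vanishes near the complement of `Ω` in the chart, and which tends to the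
indicator of `Ω` in the chart as `r → ∞`. -/
noncomputable def cutoff (c : GraphChart Ω) (r : ℝ) (p : E) : ℝ := stepFn (r * -c.defn p)

variable (c : GraphChart Ω) {r : ℝ}

theorem contDiff_cutoff (r : ℝ) : ContDiff ℝ 1 (c.cutoff r) :=
  contDiff_stepFn.comp (contDiff_const.mul (c.contDiff_defn.of_le one_le_two).neg)

theorem fderiv_cutoff (r : ℝ) (p v : E) :
    fderiv ℝ (c.cutoff r) p v = -(deriv stepFn (r * -c.defn p) * r * fderiv ℝ c.defn p v) := by
  have hdefn : HasFDerivAt (fun p => r * -c.defn p) (r • -fderiv ℝ c.defn p) p :=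
    (c.contDiff_defn.differentiable two_ne_zero p).hasFDerivAt.neg.const_mul r
  have hcutoff : HasFDerivAt (c.cutoff r) _ p := (hasDerivAt_stepFn _).comp_hasFDerivAt p hdefn
  rw [hcutoff.fderiv]
  simp only [smul_apply, neg_apply, smul_eq_mul]
  ring

theorem tsupport_cutoff_mul_subset (hr : 0 < r) {ζ : E → ℝ} (hζ : tsupport ζ ⊆ c.dom) :
    tsupport (fun p => c.cutoff r p * ζ p) ⊆ Ω := by
  have hclosed : IsClosed {p | 1 ≤ r * -c.defn p} :=
    isClosed_le continuous_const (continuous_const.mul c.contDiff_defn.continuous.neg)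
  have hsub : tsupport (fun p => c.cutoff r p * ζ p) ⊆ {p | 1 ≤ r * -c.defn p} := by
    refine closure_minimal (fun p hp => ?_) hclosed
    contrapose! hp
    rw [Function.notMem_support, cutoff, stepFn_of_le (not_le.1 hp).le, zero_mul]
  intro p hp
  rw [c.mem_iff_defn_neg (hζ (tsupport_mul_subset_right hp)), ← neg_pos]
  exact pos_of_mul_pos_right (zero_lt_one.trans_le (hsub hp)) hr.le

theorem eventually_cutoff_eq_one {p : E} (hp : p ∈ c.dom) (hpΩ : p ∈ Ω) :
    ∀ᶠ r in atTop, c.cutoff r p = 1 := by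
  have hneg : 0 < -c.defn p := neg_pos.2 ((c.mem_iff_defn_neg hp).1 hpΩ)
  filter_upwards [(tendsto_id.atTop_mul_const hneg).eventually_ge_atTop 2] with r hr
  exact stepFn_of_ge hr

theorem deriv_stepFn_eq_zero (hr : 0 < r) {p : E} (hp : p ∈ c.dom) (hpΩ : p ∉ Ω) :
    deriv stepFn (r * -c.defn p) = 0 := by
  refine deriv_stepFn_of_notMem fun hmem => hpΩ ?_
  rw [c.mem_iff_defn_neg hp, ← neg_pos]
  exact pos_of_mul_pos_right (zero_lt_one.trans_le hmem.1) hr.le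

variable [FiniteDimensional ℝ E] [MeasurableSpace E] [BorelSpace E]

theorem integral_comp_coord_symm (f : E → ℝ) :
    ∫ q, f (c.coord.symm q) = ∫ p, f p := by
  rw [← c.measurePreserving_coord.integral_comp c.coord.toHomeomorph.measurableEmbedding]
  simp only [ContinuousLinearEquiv.symm_apply_apply]

theorem tendsto_setIntegral_cutoff_mul (hΩ : MeasurableSet Ω) {f : E → ℝ}
    (hf : IntegrableOn f Ω) (hfd : ∀ p ∉ c.dom, f p = 0) :
    Tendsto (fun r => ∫ p in Ω, c.cutoff r p * f p) atTop (𝓝 (∫ p in Ω, f p)) := by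
  refine tendsto_integral_filter_of_dominated_convergence (fun p => ‖f p‖)
    (Eventually.of_forall fun r =>
      (c.contDiff_cutoff r).continuous.aestronglyMeasurable.mul hf.aestronglyMeasurable)
    (Eventually.of_forall fun r => ae_of_all _ fun p => ?_) hf.norm ?_
  · rw [norm_mul]
    exact mul_le_of_le_one_left (norm_nonneg _) (norm_stepFn_le _)
  · filter_upwards [ae_restrict_mem hΩ] with p hp
    by_cases hpd : p ∈ c.dom
    · refine tendsto_const_nhds.congr' ?_
      filter_upwards [c.eventually_cutoff_eq_one hpd hp] with r hr
      rw [hr, one_mul]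
    · simp only [hfd p hpd, mul_zero, tendsto_const_nhds]

end GraphChart

variable [FiniteDimensional ℝ E] [MeasurableSpace E] [BorelSpace E]

/-- `Q` is the divergence of `V` in `Ω` in the sense of distributions. -/
def IsWeakDiv (Ω : Set E) (V : E → E) (Q : E → ℝ) : Prop :=
  ∀ η : E → ℝ, ContDiff ℝ 1 η → HasCompactSupport η → tsupport η ⊆ Ω →
    ∫ g in Ω, (η g * Q g + fderiv ℝ η g (V g)) = 0

variable {V : E → E} {Q ζ : E → ℝ}

theorem integrableOn_mul_add_fderiv (hV : Continuous V) (hQ : IntegrableOn Q Ω)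
    (hζ : ContDiff ℝ 1 ζ) (hζc : HasCompactSupport ζ) :
    IntegrableOn (fun g => ζ g * Q g + fderiv ℝ ζ g (V g)) Ω := by
  obtain ⟨C, hC⟩ := hζ.continuous.bounded_above_of_compact_support hζc
  refine Integrable.add (hQ.bdd_mul hζ.continuous.aestronglyMeasurable (ae_of_all _ hC)) ?_
  have hcont : Continuous fun g => fderiv ℝ ζ g (V g) :=
    (hζ.continuous_fderiv one_ne_zero).clm_apply hV
  refine (hcont.integrable_of_hasCompactSupport (HasCompactSupport.intro' hζc
    (isClosed_tsupport ζ) fun x hx => ?_)).integrableOn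
  rw [fderiv_of_notMem_tsupport ℝ hx, zero_apply]

theorem IsWeakDiv.setIntegral_cutoff_mul (h : IsWeakDiv Ω V Q) (hV : Continuous V)
    (hQ : IntegrableOn Q Ω) (c : GraphChart Ω) (hζ : ContDiff ℝ 1 ζ)
    (hζc : HasCompactSupport ζ) (hζd : tsupport ζ ⊆ c.dom) {r : ℝ} (hr : 0 < r) :
    ∫ p in Ω, c.cutoff r p * (ζ p * Q p + fderiv ℝ ζ p (V p)) =
      ∫ p, ζ p * fderiv ℝ c.defn p (V p) * (deriv stepFn (r * -c.defn p) * r) := by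
  have hproduct (p : E) :
      c.cutoff r p * ζ p * Q p + fderiv ℝ (fun p => c.cutoff r p * ζ p) p (V p) =
        c.cutoff r p * (ζ p * Q p + fderiv ℝ ζ p (V p)) -
          ζ p * fderiv ℝ c.defn p (V p) * (deriv stepFn (r * -c.defn p) * r) := by
    rw [fderiv_fun_mul ((c.contDiff_cutoff r).differentiable one_ne_zero p)
      (hζ.differentiable one_ne_zero p)]
    simp only [add_apply, smul_apply, smul_eq_mul, c.fderiv_cutoff]
    ring
  have hzero := h _ ((c.contDiff_cutoff r).mul hζ) hζc.mul_left
    (c.tsupport_cutoff_mul_subset hr hζd)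
  have hleft : IntegrableOn
      (fun p => c.cutoff r p * (ζ p * Q p + fderiv ℝ ζ p (V p))) Ω :=
    (integrableOn_mul_add_fderiv hV hQ hζ hζc).bdd_mul
      (c.contDiff_cutoff r).continuous.aestronglyMeasurable
      (ae_of_all _ fun p => norm_stepFn_le _)
  have hcont : Continuous fun p =>
      ζ p * fderiv ℝ c.defn p (V p) * (deriv stepFn (r * -c.defn p) * r) :=
    (hζ.continuous.mul ((c.contDiff_defn.continuous_fderiv two_ne_zero).clm_apply hV)).mul
      ((continuous_deriv_stepFn.comp
        (continuous_const.mul c.contDiff_defn.continuous.neg)).mul continuous_const)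
  have hright : Integrable fun p =>
      ζ p * fderiv ℝ c.defn p (V p) * (deriv stepFn (r * -c.defn p) * r) :=
    hcont.integrable_of_hasCompactSupport hζc.mul_right.mul_right
  simp only [hproduct] at hzero
  rw [integral_sub hleft hright.integrableOn, sub_eq_zero] at hzero
  refine hzero.trans (setIntegral_eq_integral_of_forall_compl_eq_zero fun p hp => ?_)
  by_cases hpd : p ∈ tsupport ζ
  · rw [c.deriv_stepFn_eq_zero hr (hζd hpd) hp, zero_mul, mul_zero]
  · rw [image_eq_zero_of_notMem_tsupport hpd, zero_mul, zero_mul]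

theorem IsWeakDiv.setIntegral_chart (h : IsWeakDiv Ω V Q) (hV : Continuous V)
    (hΩ : MeasurableSet Ω) (hQ : IntegrableOn Q Ω) (c : GraphChart Ω) (hζ : ContDiff ℝ 1 ζ)
    (hζc : HasCompactSupport ζ) (hζd : tsupport ζ ⊆ c.dom) :
    ∫ g in Ω, (ζ g * Q g + fderiv ℝ ζ g (V g)) =
      ∫ y, ζ (c.param y) * fderiv ℝ c.defn (c.param y) (V (c.param y)) := by
  have hinterior : Tendsto (fun r => ∫ p in Ω, c.cutoff r p * (ζ p * Q p + fderiv ℝ ζ p (V p)))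
      atTop (𝓝 (∫ p in Ω, (ζ p * Q p + fderiv ℝ ζ p (V p)))) := by
    refine c.tendsto_setIntegral_cutoff_mul hΩ (integrableOn_mul_add_fderiv hV hQ hζ hζc)
      fun p hp => ?_
    have hpζ : p ∉ tsupport ζ := fun hmem => hp (hζd hmem)
    rw [image_eq_zero_of_notMem_tsupport hpζ, fderiv_of_notMem_tsupport ℝ hpζ, zero_mul,
      zero_apply, add_zero]
  have hcont : Continuous fun p => ζ p * fderiv ℝ c.defn p (V p) :=
    hζ.continuous.mul ((c.contDiff_defn.continuous_fderiv two_ne_zero).clm_apply hV)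
  have hboundary := tendsto_integral_layer (μ := volume) (hcont.comp c.coord.symm.continuous)
    (hζc.mul_right.comp_homeomorph c.coord.symm.toHomeomorph) c.contDiff_height.continuous
    continuous_deriv_stepFn hasCompactSupport_deriv_stepFn integral_deriv_stepFn
  refine tendsto_nhds_unique hinterior (hboundary.congr' ?_)
  filter_upwards [eventually_gt_atTop 0] with r hr
  rw [h.setIntegral_cutoff_mul hV hQ c hζ hζc hζd hr, ← c.integral_comp_coord_symm,
    ← Measure.volume_eq_prod]
  refine integral_congr_ae (ae_of_all _ fun q => ?_)
  simp [GraphChart.defn]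

end WeakDivergence

theorem exists_finite_smooth_partition {E : Type*} [NormedAddCommGroup E] [NormedSpace ℝ E]
    [FiniteDimensional ℝ E] {K : Set E} (hK : IsCompact K) (U : E → Set E)
    (hU : ∀ g, IsOpen (U g)) (hKU : ∀ g ∈ K, g ∈ U g) :
    ∃ (T : Finset E) (ζ : E → E → ℝ), (∀ i, ContDiff ℝ 1 (ζ i)) ∧
      (∀ i, HasCompactSupport (ζ i)) ∧ (∀ i, tsupport (ζ i) ⊆ U i) ∧
      ∀ g ∈ K, ∑ i ∈ T, ζ i g = 1 := by
  obtain ⟨R, hR⟩ := hK.isBounded.subset_ball 0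
  obtain ⟨f, hf⟩ := SmoothPartitionOfUnity.exists_isSubordinate (modelWithCornersSelf ℝ E)
    hK.isClosed (fun g => U g ∩ Metric.ball 0 R) (fun g => (hU g).inter Metric.isOpen_ball)
    (fun g hg => mem_iUnion.2 ⟨g, hKU g hg, hR hg⟩)
  have hfin := f.locallyFinite.finite_nonempty_inter_compact hK
  refine ⟨hfin.toFinset, fun i => f i, fun i => ?_, fun i => ?_, fun i => ?_, fun g hg => ?_⟩
  · exact (f i).contMDiff.contDiff.of_le (by norm_cast)
  · exact Metric.isCompact_of_isClosed_isBounded (isClosed_tsupport _)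
      (Metric.isBounded_ball.subset ((hf i).trans inter_subset_right))
  · exact (hf i).trans inter_subset_left
  · rw [← f.sum_eq_one hg]
    refine (finsum_eq_sum_of_support_subset _ fun i hi => ?_).symm
    simp only [Set.Finite.coe_toFinset, mem_ofPred_eq]
    exact ⟨g, hi, hg⟩

theorem IsC2BoundedOpen.exists_mem_dom {E : Type*} [NormedAddCommGroup E] [InnerProductSpace ℝ E]
    [FiniteDimensional ℝ E] {Ω : Set E} (hΩ : IsC2BoundedOpen Ω) {g : E} (hg : g ∈ frontier Ω) :
    ∃ c : GraphChart Ω, g ∈ c.dom := by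
  obtain ⟨φ, hφ⟩ := hΩ.2.2 g hg
  exact exists_graphChart hφ

theorem IsC2BoundedOpen.isCompact_frontier {E : Type*} [NormedAddCommGroup E]
    [InnerProductSpace ℝ E] [FiniteDimensional ℝ E] {Ω : Set E} (hΩ : IsC2BoundedOpen Ω) :
    IsCompact (frontier Ω) :=
  hΩ.2.1.isCompact_closure.of_isClosed_subset isClosed_frontier frontier_subset_closure

theorem IsC2BoundedOpen.exists_partition {E : Type*} [NormedAddCommGroup E]
    [InnerProductSpace ℝ E] [FiniteDimensional ℝ E] {Ω : Set E} (hΩ : IsC2BoundedOpen Ω) :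
    ∃ (T : Finset E) (ζ : E → E → ℝ), (∀ i, ContDiff ℝ 1 (ζ i)) ∧
      (∀ i, HasCompactSupport (ζ i)) ∧
      (∀ i, (∃ c : GraphChart Ω, tsupport (ζ i) ⊆ c.dom) ∨ tsupport (ζ i) ⊆ Ω) ∧
      ∀ g ∈ closure Ω, ∑ i ∈ T, ζ i g = 1 := by
  have hcover (g : E) : ∃ U : Set E, IsOpen U ∧ (g ∈ closure Ω → g ∈ U) ∧
      ((∃ c : GraphChart Ω, U = c.dom) ∨ U = Ω) := by
    by_cases hg : g ∈ frontier Ω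
    · obtain ⟨c, hc⟩ := hΩ.exists_mem_dom hg
      exact ⟨c.dom, c.isOpen_dom, fun _ => hc, .inl ⟨c, rfl⟩⟩
    · refine ⟨Ω, hΩ.1, fun hgc => ?_, .inr rfl⟩
      rw [hΩ.1.frontier_eq] at hg
      exact by_contra fun hgΩ => hg ⟨hgc, hgΩ⟩
  choose U hU hmem hcases using hcover
  obtain ⟨T, ζ, hζ, hζc, hζU, hsum⟩ :=
    exists_finite_smooth_partition hΩ.2.1.isCompact_closure U hU hmem
  refine ⟨T, ζ, hζ, hζc, fun i => ?_, hsum⟩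
  rcases hcases i with ⟨c, hc⟩ | hi
  · exact .inl ⟨c, hc ▸ hζU i⟩
  · exact .inr (hi ▸ hζU i)

theorem setIntegral_eq_sum_partition {E : Type*} [NormedAddCommGroup E] [InnerProductSpace ℝ E]
    [FiniteDimensional ℝ E] [MeasurableSpace E] [BorelSpace E] {Ω : Set E} (hΩ : IsOpen Ω)
    {V : E → E} {Q : E → ℝ} (hV : Continuous V) (hQ : IntegrableOn Q Ω) {ι : Type*} {T : Finset ι}
    {ζ : ι → E → ℝ} (hζ : ∀ i, ContDiff ℝ 1 (ζ i)) (hζc : ∀ i, HasCompactSupport (ζ i))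
    (hsum : ∀ g ∈ Ω, ∑ i ∈ T, ζ i g = 1) :
    ∫ g in Ω, Q g = ∑ i ∈ T, ∫ g in Ω, (ζ i g * Q g + fderiv ℝ (ζ i) g (V g)) := by
  rw [← integral_finsetSum T fun i _ => integrableOn_mul_add_fderiv hV hQ (hζ i) (hζc i)]
  refine setIntegral_congr_fun hΩ.measurableSet fun g hg => ?_
  have hconst : (fun p => ∑ i ∈ T, ζ i p) =ᶠ[𝓝 g] fun _ => 1 := by
    filter_upwards [hΩ.mem_nhds hg] with p hp using hsum p hp
  have hderiv : ∑ i ∈ T, fderiv ℝ (ζ i) g (V g) = 0 := by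
    rw [← sum_apply, ← fderiv_fun_sum fun i _ => (hζ i).differentiable one_ne_zero g,
      hconst.fderiv_eq, fderiv_fun_const, Pi.zero_apply, zero_apply]
  rw [Finset.sum_add_distrib, hderiv, add_zero, ← Finset.sum_mul, hsum g hg, one_mul]

namespace StepTwoCarnot

section SurfaceMeasure

variable {E : Type*} [NormedAddCommGroup E] [InnerProductSpace ℝ E] [MeasurableSpace E]
  [BorelSpace E] (𝔾 : StepTwoCarnot E) {Ω : Set E} {f : E → ℝ}

theorem ae_mem_frontier : ∀ᵐ p ∂(𝔾.surfaceMeasure Ω), p ∈ frontier Ω :=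
  ae_iff.2 𝔾.surfaceMeasure_compl_frontier

theorem integral_surfaceMeasure_eq_zero (hΩ : IsOpen Ω) (hf : tsupport f ⊆ Ω) :
    ∫ p, f p ∂(𝔾.surfaceMeasure Ω) = 0 := by
  refine integral_eq_zero_of_ae ?_
  filter_upwards [𝔾.ae_mem_frontier] with p hp
  rw [hΩ.frontier_eq] at hp
  exact image_eq_zero_of_notMem_tsupport fun hmem => hp.2 (hf hmem)

end SurfaceMeasure

section DivergenceTheorem

variable {E : Type*} [NormedAddCommGroup E] [InnerProductSpace ℝ E] [FiniteDimensional ℝ E]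
  (𝔾 : StepTwoCarnot E) {Ω : Set E} {V : E → E}

theorem continuousOn_metric_outerNormal (hΩ : IsC2BoundedOpen Ω) (hV : Continuous V) :
    ContinuousOn (fun p => 𝔾.metric p (𝔾.outerNormal Ω p) (V p)) (frontier Ω) := by
  intro g hg
  obtain ⟨c, hc⟩ := hΩ.exists_mem_dom hg
  have hdefn : ContDiff ℝ 1 c.defn := c.contDiff_defn.of_le one_le_two
  have hlocal (p : E) (hp : p ∈ c.dom) (hpf : p ∈ frontier Ω) :
      IsLocalDefining Ω c.defn p :=
    c.isLocalDefining hp ((c.mem_frontier_iff hp).1 hpf)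
  have hnorm (p : E) (hp : p ∈ c.dom) (hpf : p ∈ frontier Ω) :
      ‖𝔾.leftInvGradient c.defn p‖ ≠ 0 :=
    norm_ne_zero_iff.2 (𝔾.leftInvGradient_ne_zero (hlocal p hp hpf).2.2.1)
  have heq (p : E) (hp : p ∈ c.dom) (hpf : p ∈ frontier Ω) :
      𝔾.metric p (𝔾.outerNormal Ω p) (V p) =
        ‖𝔾.leftInvGradient c.defn p‖⁻¹ * fderiv ℝ c.defn p (V p) :=
    (eq_inv_mul_iff_mul_eq₀ (hnorm p hp hpf)).2
      (𝔾.norm_mul_metric_outerNormal (hlocal p hp hpf) _)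
  have hcont : ContinuousAt
      (fun p => ‖𝔾.leftInvGradient c.defn p‖⁻¹ * fderiv ℝ c.defn p (V p)) g :=
    ((𝔾.continuous_leftInvGradient hdefn).norm.continuousAt.inv₀ (hnorm g hc hg)).mul
      ((hdefn.continuous_fderiv one_ne_zero).clm_apply hV).continuousAt
  refine hcont.continuousWithinAt.congr_of_eventuallyEq ?_ (heq g hc hg)
  filter_upwards [mem_nhdsWithin_of_mem_nhds (c.isOpen_dom.mem_nhds hc), self_mem_nhdsWithin]
    with p hp hpf using heq p hp hpf

variable [MeasurableSpace E] [BorelSpace E] {Q ζ f : E → ℝ}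

theorem integrable_of_continuousOn_frontier (hΩ : IsC2BoundedOpen Ω)
    (hf : ContinuousOn f (frontier Ω)) : Integrable f (𝔾.surfaceMeasure Ω) := by
  have := 𝔾.isFiniteMeasure_surfaceMeasure hΩ
  have h := hf.integrableOn_compact (μ := 𝔾.surfaceMeasure Ω) hΩ.isCompact_frontier
  rwa [IntegrableOn, Measure.restrict_eq_self_of_ae_mem 𝔾.ae_mem_frontier] at h

theorem integral_surfaceMeasure_of_tsupport_subset (c : GraphChart Ω)
    (hf : AEStronglyMeasurable f (𝔾.surfaceMeasure Ω)) (hfd : tsupport f ⊆ c.dom) :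
    ∫ p, f p ∂(𝔾.surfaceMeasure Ω) = ∫ y, 𝔾.areaElement c.param y * f (c.param y) := by
  have hzero (p : E) (hp : p ∉ c.dom) : f p = 0 :=
    image_eq_zero_of_notMem_tsupport fun hmem => hp (hfd hmem)
  rw [← setIntegral_eq_integral_of_forall_compl_eq_zero hzero,
    𝔾.setIntegral_dom_surfaceMeasure c hf]
  refine setIntegral_eq_integral_of_forall_compl_eq_zero fun y hy => ?_
  rw [hzero _ hy, mul_zero]

theorem setIntegral_eq_of_tsupport_subset_dom (hΩ : IsC2BoundedOpen Ω) (hV : Continuous V)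
    (hQ : IntegrableOn Q Ω) (h : IsWeakDiv Ω V Q) (c : GraphChart Ω) (hζ : ContDiff ℝ 1 ζ)
    (hζc : HasCompactSupport ζ) (hζd : tsupport ζ ⊆ c.dom) :
    ∫ g in Ω, (ζ g * Q g + fderiv ℝ ζ g (V g)) =
      ∫ p, ζ p * 𝔾.metric p (𝔾.outerNormal Ω p) (V p) ∂(𝔾.surfaceMeasure Ω) := by
  have hmeas : AEStronglyMeasurable
      (fun p => ζ p * 𝔾.metric p (𝔾.outerNormal Ω p) (V p)) (𝔾.surfaceMeasure Ω) :=
    (𝔾.integrable_of_continuousOn_frontier hΩ (hζ.continuous.continuousOn.mul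
      (𝔾.continuousOn_metric_outerNormal hΩ hV))).aestronglyMeasurable
  rw [h.setIntegral_chart hV hΩ.1.measurableSet hQ c hζ hζc hζd,
    𝔾.integral_surfaceMeasure_of_tsupport_subset c hmeas (tsupport_mul_subset_left.trans hζd)]
  refine integral_congr_ae (ae_of_all _ fun y => ?_)
  by_cases hy : c.param y ∈ c.dom
  · simp only [← 𝔾.areaElement_mul_metric c hy]
    ring
  · have hzero : ζ (c.param y) = 0 :=
      image_eq_zero_of_notMem_tsupport fun hmem => hy (hζd hmem)
    simp only [hzero, zero_mul, mul_zero]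

theorem setIntegral_eq_of_isWeakDiv (hΩ : IsC2BoundedOpen Ω) (hV : Continuous V)
    (hQ : IntegrableOn Q Ω) (h : IsWeakDiv Ω V Q) :
    ∫ g in Ω, Q g = ∫ p, 𝔾.metric p (𝔾.outerNormal Ω p) (V p) ∂(𝔾.surfaceMeasure Ω) := by
  obtain ⟨T, ζ, hζ, hζc, hζU, hsum⟩ := hΩ.exists_partition
  have hlocal (i : E) : ∫ g in Ω, (ζ i g * Q g + fderiv ℝ (ζ i) g (V g)) =
      ∫ p, ζ i p * 𝔾.metric p (𝔾.outerNormal Ω p) (V p) ∂(𝔾.surfaceMeasure Ω) := by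
    rcases hζU i with ⟨c, hc⟩ | hi
    · exact 𝔾.setIntegral_eq_of_tsupport_subset_dom hΩ hV hQ h c (hζ i) (hζc i) hc
    · rw [h _ (hζ i) (hζc i) hi,
        𝔾.integral_surfaceMeasure_eq_zero hΩ.1 (tsupport_mul_subset_left.trans hi)]
  have hint (i : E) : Integrable (fun p => ζ i p * 𝔾.metric p (𝔾.outerNormal Ω p) (V p))
      (𝔾.surfaceMeasure Ω) :=
    𝔾.integrable_of_continuousOn_frontier hΩ
      ((hζ i).continuous.continuousOn.mul (𝔾.continuousOn_metric_outerNormal hΩ hV))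
  rw [setIntegral_eq_sum_partition hΩ.1 hV hQ hζ hζc fun g hg => hsum g (subset_closure hg),
    Finset.sum_congr rfl fun i _ => hlocal i, ← integral_finsetSum T fun i _ => hint i]
  refine integral_congr_ae ?_
  filter_upwards [𝔾.ae_mem_frontier] with p hp
  rw [← Finset.sum_mul, hsum p (frontier_subset_closure hp), one_mul]

end DivergenceTheorem

end StepTwoCarnot

namespace GraphChart

variable {E : Type*} [NormedAddCommGroup E] [InnerProductSpace ℝ E] {Ω : Set E}
  (c : GraphChart Ω) {g v : E}

theorem exists_hasDerivAt_frontier (hg : g ∈ c.dom) (h0 : c.defn g = 0)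
    (hv : fderiv ℝ c.defn g v = 0) :
    ∃ γ : ℝ → E, γ 0 = g ∧ HasDerivAt γ v 0 ∧ ∀ᶠ s in 𝓝 0, γ s ∈ frontier Ω := by
  have hγ0 : c.param ((c.coord g).1 + (0 : ℝ) • (c.coord v).1) = g := by
    rw [zero_smul, add_zero, c.param_coord h0]
  have hγ : HasDerivAt (fun s : ℝ => c.param ((c.coord g).1 + s • (c.coord v).1)) v 0 := by
    have hline : HasDerivAt (fun s : ℝ => (c.coord g).1 + s • (c.coord v).1)
        (c.coord v).1 0 := by
      simpa only [one_smul, id_eq] using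
        ((hasDerivAt_id (0 : ℝ)).smul_const (c.coord v).1).const_add (c.coord g).1
    have hparam : HasFDerivAt c.param (fderiv ℝ c.param (c.coord g).1)
        ((c.coord g).1 + (0 : ℝ) • (c.coord v).1) := by
      rw [zero_smul, add_zero]
      exact (c.contDiff_param.differentiable two_ne_zero _).hasFDerivAt
    have hcomp := HasFDerivAt.comp_hasDerivAt (l := c.param) (0 : ℝ) hparam hline
    rwa [c.fderiv_param_coord hv] at hcomp
  refine ⟨_, hγ0, hγ, ?_⟩
  have hdom := hγ.continuousAt.eventually_mem (c.isOpen_dom.mem_nhds (hγ0.symm ▸ hg))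
  filter_upwards [hdom] with s hs using c.param_mem_frontier hs

theorem fderivWithin_eq_zero (hg : g ∈ c.dom) (h0 : c.defn g = 0) {F : E → ℝ}
    (hF : DifferentiableWithinAt ℝ F (closure Ω) g) (hz : ∀ᶠ p in 𝓝[frontier Ω] g, F p = 0)
    (hv : fderiv ℝ c.defn g v = 0) : fderivWithin ℝ F (closure Ω) g v = 0 := by
  obtain ⟨γ, rfl, hγ, hmem⟩ := c.exists_hasDerivAt_frontier hg h0 hv
  have hcomp : HasDerivAt (F ∘ γ) (fderivWithin ℝ F (closure Ω) (γ 0) v) 0 :=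
    (hF.hasFDerivWithinAt.comp_hasDerivWithinAt (s := {s | γ s ∈ frontier Ω}) (0 : ℝ)
      hγ.hasDerivWithinAt fun s hs => frontier_subset_closure hs).hasDerivAt hmem
  have hzero : F ∘ γ =ᶠ[𝓝 0] fun _ => 0 :=
    (tendsto_nhdsWithin_iff.2 ⟨hγ.continuousAt.tendsto, hmem⟩).eventually hz
  rw [← hcomp.deriv, hzero.deriv_eq, deriv_const]

end GraphChart

section LinearAlgebra

theorem inner_toEuclideanLin {ι : Type*} [Fintype ι] [DecidableEq ι]
    (a : Matrix ι ι ℝ) (x : EuclideanSpace ℝ ι) :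
    inner ℝ x (Matrix.toEuclideanLin a x) = ∑ i, ∑ j, x i * x j * a i j := by
  simp only [PiLp.inner_apply, Matrix.toLpLin_apply, Matrix.mulVec, dotProduct,
    RCLike.inner_apply, conj_trivial, Finset.sum_mul]
  exact Finset.sum_congr rfl fun i _ => Finset.sum_congr rfl fun j _ => by ring

theorem orthonormal_sumElim {V ι : Type*} [NormedAddCommGroup V] [InnerProductSpace ℝ V]
    {e : ι → V} (he : Orthonormal ℝ e) {ν : V} (hν : ‖ν‖ = 1)
    (heν : ∀ i, inner ℝ (e i) ν = (0 : ℝ)) :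
    Orthonormal ℝ (Sum.elim e fun _ : Unit => ν) := by
  classical
  rw [orthonormal_iff_ite] at he ⊢
  rintro (i | i) (j | j)
  · simpa only [Sum.elim_inl, Sum.inl.injEq] using he i j
  · simp [heν]
  · simp [real_inner_comm (e j) ν, heν]
  · simp [hν]

theorem sum_orthonormal_add {m : ℕ} (a : Fin m → Fin m → ℝ)
    {e : Fin (m - 1) → EuclideanSpace ℝ (Fin m)} (he : Orthonormal ℝ e)
    {ν : EuclideanSpace ℝ (Fin m)} (hν : ‖ν‖ = 1) (heν : ∀ i, inner ℝ (e i) ν = (0 : ℝ)) :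
    ∑ k, ∑ i, ∑ j, e k i * e k j * a i j + ∑ i, ∑ j, ν i * ν j * a i j = ∑ i, a i i := by
  have hm : 0 < m := by
    rcases Nat.eq_zero_or_pos m with rfl | h
    · rw [Subsingleton.elim ν 0, norm_zero] at hν
      exact absurd hν zero_ne_one
    · exact h
  have hv := orthonormal_sumElim he hν heν
  have hcard : Fintype.card (Fin (m - 1) ⊕ Unit) =
      Module.finrank ℝ (EuclideanSpace ℝ (Fin m)) := by
    rw [finrank_euclideanSpace_fin, Fintype.card_sum, Fintype.card_fin, Fintype.card_unit]
    omega
  let β : OrthonormalBasis (Fin (m - 1) ⊕ Unit) ℝ (EuclideanSpace ℝ (Fin m)) :=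
    (basisOfOrthonormalOfCardEqFinrank hv hcard).toOrthonormalBasis (by simpa using hv)
  have hβ : ⇑β = Sum.elim e fun _ => ν := by simp [β]
  have htrace := (LinearMap.trace_eq_sum_inner (Matrix.toEuclideanLin (Matrix.of a)) β).symm.trans
    (LinearMap.trace_eq_sum_inner _ (EuclideanSpace.basisFun (Fin m) ℝ))
  simp only [inner_toEuclideanLin, hβ, Fintype.sum_sum_type] at htrace
  simpa [Pi.single_apply] using htrace

theorem exists_orthonormal_inner_eq_zero {m : ℕ} {ν : EuclideanSpace ℝ (Fin m)} (hν : ν ≠ 0) :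
    ∃ f : Fin (m - 1) → EuclideanSpace ℝ (Fin m),
      Orthonormal ℝ f ∧ ∀ i, inner ℝ (f i) ν = (0 : ℝ) := by
  have hfin : Module.finrank ℝ (Submodule.span ℝ {ν})ᗮ = m - 1 := by
    have h := (Submodule.span ℝ {ν}).finrank_add_finrank_orthogonal
    rw [finrank_span_singleton hν, finrank_euclideanSpace_fin] at h
    omega
  let o := (stdOrthonormalBasis ℝ (Submodule.span ℝ {ν})ᗮ).reindex (finCongr hfin)
  refine ⟨fun i => o i, o.orthonormal.comp_linearIsometry (Submodule.subtypeₗᵢ _), fun i => ?_⟩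
  rw [real_inner_comm]
  exact Submodule.mem_orthogonal_singleton_iff_inner_right.1 (o i).2

section Rotation

variable {V : Type*} [NormedAddCommGroup V] [InnerProductSpace ℝ V]

/-- The image of a vector `f` orthogonal to the unit vector `ν₀` under the rotation which takes
`ν₀` to the unit vector `ν` and fixes their orthogonal complement. -/
noncomputable def rotateTo (ν₀ f ν : V) : V :=
  f - (inner ℝ f ν / (1 + inner ℝ ν₀ ν) : ℝ) • (ν₀ + ν)

variable {ν₀ ν f f' : V}

theorem inner_rotateTo (hν₀ : ‖ν₀‖ = 1) (hν : ‖ν‖ = 1) (hf : inner ℝ f ν₀ = (0 : ℝ))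
    (hf' : inner ℝ f' ν₀ = (0 : ℝ)) (hD : (1 : ℝ) + inner ℝ ν₀ ν ≠ 0) :
    inner ℝ (rotateTo ν₀ f ν) (rotateTo ν₀ f' ν) = (inner ℝ f f' : ℝ) := by
  simp only [rotateTo, inner_sub_left, inner_sub_right, inner_smul_left, inner_smul_right,
    inner_add_left, inner_add_right, conj_trivial, real_inner_self_eq_norm_sq, hν₀, hν, hf,
    real_inner_comm f' ν₀, hf', real_inner_comm f' ν, real_inner_comm ν₀ ν]
  field_simp
  ring

theorem inner_rotateTo_right (hν : ‖ν‖ = 1) (hD : (1 : ℝ) + inner ℝ ν₀ ν ≠ 0) :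
    inner ℝ (rotateTo ν₀ f ν) ν = (0 : ℝ) := by
  simp only [rotateTo, inner_sub_left, inner_smul_left, inner_add_left, conj_trivial,
    real_inner_self_eq_norm_sq, hν]
  field_simp
  ring

end Rotation

end LinearAlgebra

/-! ### The flux through the boundary -/

theorem fluxCoeff_sum_mul_of_eq_mul {ι : Type*} [Fintype ι] {f N : ι → ℝ} {a : ι → ι → ℝ}
    {μ : ℝ} (hf : ∀ i, f i = μ * N i) :
    ∑ i, fluxCoeff f a i * N i =
      μ * ((∑ i, N i ^ 2) * ∑ i, a i i - ∑ i, ∑ j, N i * N j * a i j) := by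
  have hswap : ∑ i, ∑ j, N i * N j * a j i = ∑ i, ∑ j, N i * N j * a i j := by
    rw [Finset.sum_comm]
    exact Finset.sum_congr rfl fun i _ => Finset.sum_congr rfl fun j _ => by ring
  have hterm : ∑ i, fluxCoeff f a i * N i = ∑ i, ∑ j, (μ * (N i ^ 2 * a j j) +
      (μ * (N i * N j * a i j) - 2 * μ * (N i * N j * a j i))) := by
    refine Finset.sum_congr rfl fun i _ => ?_
    rw [fluxCoeff, Finset.sum_mul]
    refine Finset.sum_congr rfl fun j _ => ?_
    rw [hf i, hf j]
    ring
  rw [hterm]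
  simp only [Finset.sum_add_distrib, Finset.sum_sub_distrib, ← Finset.mul_sum, hswap,
    ← Finset.sum_mul]
  ring

namespace StepTwoCarnot

section LeftInvDerivWithin

variable {E : Type*} [NormedAddCommGroup E] [InnerProductSpace ℝ E] (𝔾 : StepTwoCarnot E)
  {S : Set E} {v w g : E} {f : E → ℝ}

/-- The derivative of `f` along the left-invariant field generated by `v`, relative to `S`. -/
noncomputable def leftInvDerivWithin (S : Set E) (v : E) (f : E → ℝ) (g : E) : ℝ :=
  fderivWithin ℝ f S g (𝔾.leftInv v g)

theorem leftInvDerivWithin_eq (hg : S ∈ 𝓝 g) :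
    𝔾.leftInvDerivWithin S v f g = 𝔾.leftInvDeriv v f g := by
  rw [leftInvDerivWithin, fderivWithin_of_mem_nhds hg, leftInvDeriv]

theorem leftInvDerivWithin_leftInvDerivWithin_eq (hg : S ∈ 𝓝 g) :
    𝔾.leftInvDerivWithin S v (𝔾.leftInvDerivWithin S w f) g =
      𝔾.leftInvDeriv v (𝔾.leftInvDeriv w f) g := by
  rw [leftInvDerivWithin_eq 𝔾 hg]
  refine (𝔾.leftInvDeriv_eventuallyEq ?_).eq_of_nhds
  filter_upwards [eventually_mem_nhds_iff.2 hg] with p hp using 𝔾.leftInvDerivWithin_eq hp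

variable [FiniteDimensional ℝ E]

theorem contDiffOn_leftInvDerivWithin (hS : UniqueDiffOn ℝ S) (hf : ContDiffOn ℝ 2 f S) :
    ContDiffOn ℝ 1 (𝔾.leftInvDerivWithin S v f) S :=
  (hf.fderivWithin hS one_add_one_eq_two.le).clm_apply (𝔾.contDiff_leftInv v).contDiffOn

theorem continuousOn_leftInvDerivWithin (hS : UniqueDiffOn ℝ S) (hf : ContDiffOn ℝ 1 f S) :
    ContinuousOn (𝔾.leftInvDerivWithin S v f) S :=
  (hf.continuousOn_fderivWithin hS le_rfl).clm_apply (𝔾.continuous_leftInv v).continuousOn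

end LeftInvDerivWithin

section HorizontalGradient

variable {E : Type*} [NormedAddCommGroup E] [InnerProductSpace ℝ E] (𝔾 : StepTwoCarnot E)
  {m : ℕ} (b : OrthonormalBasis (Fin m) ℝ 𝔾.V₁) {Ω : Set E} {φ u : E → ℝ} {g : E}

/-- The horizontal gradient of `φ`, by its components in the frame `X₁, …, X_m`. -/
noncomputable def horizontalGradient (φ : E → ℝ) (p : E) : EuclideanSpace ℝ (Fin m) :=
  WithLp.toLp 2 fun j => fderiv ℝ φ p (𝔾.leftInv (b j : E) p)

theorem hGradSq_eq_of_eq_mul {μ : ℝ}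
    (hμ : ∀ i, 𝔾.leftInvDerivWithin (closure Ω) (b i : E) u g = μ * 𝔾.hNormal b Ω g i) :
    𝔾.hGradSq b Ω u g = μ ^ 2 * 𝔾.angle b Ω g ^ 2 := by
  rw [angle, EuclideanSpace.real_norm_sq_eq, Finset.mul_sum]
  exact Finset.sum_congr rfl fun i _ => by rw [← mul_pow, ← hμ i, leftInvDerivWithin]

theorem angle_smul_hGauss : 𝔾.angle b Ω g • 𝔾.hGauss b Ω g = 𝔾.hNormal b Ω g := by
  rcases eq_or_ne (𝔾.hNormal b Ω g) 0 with h | h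
  · rw [hGauss, h, smul_zero, smul_zero]
  · exact smul_inv_smul₀ (norm_ne_zero_iff.2 h) _

theorem norm_hGauss (h : 𝔾.hNormal b Ω g ≠ 0) : ‖𝔾.hGauss b Ω g‖ = 1 :=
  norm_smul_inv_norm h

theorem isHMeanCurvature_hMeanCurvature (hN : 𝔾.hNormal b Ω g ≠ 0)
    (h : ∃ x, 𝔾.IsHMeanCurvature b Ω g x) :
    𝔾.IsHMeanCurvature b Ω g (𝔾.hMeanCurvature b Ω g) := by
  rw [hMeanCurvature, if_neg fun hg => norm_ne_zero_iff.2 hN hg.2, hMeanCurvatureAux, dif_pos h]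
  exact h.choose_spec

variable [FiniteDimensional ℝ E]

theorem contDiff_horizontalGradient (hφ : ContDiff ℝ 2 φ) :
    ContDiff ℝ 1 (𝔾.horizontalGradient b φ) :=
  contDiff_euclidean.2 fun _ =>
    (hφ.fderiv_right one_add_one_eq_two.le).clm_apply (𝔾.contDiff_leftInv _)

theorem norm_smul_hNormal (h : IsLocalDefining Ω φ g) :
    ‖𝔾.leftInvGradient φ g‖ • 𝔾.hNormal b Ω g = 𝔾.horizontalGradient b φ g := by
  ext j
  exact 𝔾.norm_mul_metric_outerNormal h _

theorem inner_hNormal_eq_zero_iff (h : IsLocalDefining Ω φ g) {x : EuclideanSpace ℝ (Fin m)} :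
    inner ℝ x (𝔾.hNormal b Ω g) = (0 : ℝ) ↔ inner ℝ x (𝔾.horizontalGradient b φ g) = (0 : ℝ) := by
  rw [← 𝔾.norm_smul_hNormal b h, inner_smul_right, mul_eq_zero,
    or_iff_right (norm_ne_zero_iff.2 (𝔾.leftInvGradient_ne_zero h.2.2.1))]

theorem exists_isHMeanCurvature (c : GraphChart Ω) (hg : g ∈ c.dom) (h0 : c.defn g = 0)
    (hN : 𝔾.hNormal b Ω g ≠ 0) : ∃ x, 𝔾.IsHMeanCurvature b Ω g x := by
  let n := 𝔾.horizontalGradient b c.defn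
  have hn : ContDiff ℝ 1 n := 𝔾.contDiff_horizontalGradient b c.contDiff_defn
  have hng : n g ≠ 0 := fun h => hN <| inner_self_eq_zero.1 <|
    (𝔾.inner_hNormal_eq_zero_iff b (c.isLocalDefining hg h0)).2 <|
      (congrArg (inner ℝ _) h).trans (inner_zero_right _)
  let ν (p : E) : EuclideanSpace ℝ (Fin m) := ‖n p‖⁻¹ • n p
  have hν : ContDiffAt ℝ 1 ν g :=
    ((hn.contDiffAt.norm ℝ hng).inv (norm_ne_zero_iff.2 hng)).smul hn.contDiffAt
  have hνn {p : E} (hp : n p ≠ 0) : ‖ν p‖ = 1 := norm_smul_inv_norm hp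
  obtain ⟨f, hf, hfν⟩ := exists_orthonormal_inner_eq_zero
    (norm_ne_zero_iff.1 ((hνn hng).trans_ne one_ne_zero))
  have hD : ContDiffAt ℝ 1 (fun p => (1 : ℝ) + inner ℝ (ν g) (ν p)) g :=
    contDiffAt_const.add (contDiffAt_const.inner ℝ hν)
  have hDg : (1 : ℝ) + inner ℝ (ν g) (ν g) ≠ 0 := by
    rw [real_inner_self_eq_norm_sq, hνn hng]
    norm_num
  refine ⟨_, fun i p => rotateTo (ν g) (f i) (ν p), fun i => ?_, ?_, rfl⟩
  · exact contDiffAt_const.sub (((contDiffAt_const.inner ℝ hν).div hD hDg).smul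
      (contDiffAt_const.add hν))
  · filter_upwards [mem_nhdsWithin_of_mem_nhds (hn.continuous.continuousAt.eventually_ne hng),
      mem_nhdsWithin_of_mem_nhds (hD.continuousAt.eventually_ne hDg),
      mem_nhdsWithin_of_mem_nhds (c.isOpen_dom.mem_nhds hg), self_mem_nhdsWithin]
      with p hnp hDp hpd hpf
    refine ⟨orthonormal_iff_ite.2 fun i j => ?_, fun i => ?_⟩
    · rw [inner_rotateTo (hνn hng) (hνn hnp) (hfν i) (hfν j) hDp]
      exact orthonormal_iff_ite.1 hf i j
    · have hloc := c.isLocalDefining hpd ((c.mem_frontier_iff hpd).1 hpf)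
      have hperp : inner ℝ (rotateTo (ν g) (f i) (ν p)) (ν p) = (0 : ℝ) :=
        inner_rotateTo_right (hνn hnp) hDp
      rw [inner_smul_right, mul_eq_zero] at hperp
      exact (𝔾.inner_hNormal_eq_zero_iff b hloc).2
        (hperp.resolve_left (inv_ne_zero (norm_ne_zero_iff.2 hnp)))

end HorizontalGradient

section BoundaryIdentity

variable {E : Type*} [NormedAddCommGroup E] [InnerProductSpace ℝ E] [FiniteDimensional ℝ E]
  (𝔾 : StepTwoCarnot E) {m : ℕ} (b : OrthonormalBasis (Fin m) ℝ 𝔾.V₁) {Ω : Set E} {u : E → ℝ}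
  {g : E}

theorem exists_leftInvDerivWithin_eq_mul_hNormal (c : GraphChart Ω) (hg : g ∈ c.dom)
    (h0 : c.defn g = 0) (hd : DifferentiableWithinAt ℝ u (closure Ω) g)
    (hu : ∀ p ∈ frontier Ω, u p = 0) :
    ∃ μ : ℝ, ∀ i, 𝔾.leftInvDerivWithin (closure Ω) (b i : E) u g = μ * 𝔾.hNormal b Ω g i := by
  have hdef := c.isLocalDefining hg h0
  obtain ⟨v, hv⟩ := exists_apply_pos_of_ne_zero hdef.2.2.1
  have hker (w : E) (hw : fderiv ℝ c.defn g w = 0) : fderivWithin ℝ u (closure Ω) g w = 0 :=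
    c.fderivWithin_eq_zero hg h0 hd (eventually_nhdsWithin_of_forall hu) hw
  have hprop (w : E) : fderivWithin ℝ u (closure Ω) g w =
      fderivWithin ℝ u (closure Ω) g v / fderiv ℝ c.defn g v * fderiv ℝ c.defn g w := by
    have h := hker (w - (fderiv ℝ c.defn g w / fderiv ℝ c.defn g v) • v) <| by
      rw [map_sub, map_smul, smul_eq_mul, div_mul_cancel₀ _ hv.ne', sub_self]
    rw [map_sub, map_smul, smul_eq_mul, sub_eq_zero] at h
    rw [h]
    ring
  refine ⟨fderivWithin ℝ u (closure Ω) g v / fderiv ℝ c.defn g v *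
    ‖𝔾.leftInvGradient c.defn g‖, fun i => ?_⟩
  rw [leftInvDerivWithin, hprop, mul_assoc]
  exact congrArg _ (𝔾.norm_mul_metric_outerNormal hdef _).symm

theorem eventually_sum_mul_leftInvDerivWithin_eq_zero (c : GraphChart Ω) (hg : g ∈ c.dom)
    (hd : DifferentiableOn ℝ u (closure Ω)) (hu : ∀ p ∈ frontier Ω, u p = 0)
    {e : E → EuclideanSpace ℝ (Fin m)}
    (hperp : ∀ᶠ p in 𝓝[frontier Ω] g, inner ℝ (e p) (𝔾.hNormal b Ω p) = 0) :
    ∀ᶠ p in 𝓝[frontier Ω] g,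
      ∑ j, e p j * 𝔾.leftInvDerivWithin (closure Ω) (b j : E) u p = 0 := by
  filter_upwards [hperp, mem_nhdsWithin_of_mem_nhds (c.isOpen_dom.mem_nhds hg),
    self_mem_nhdsWithin] with p hp hpd hpf
  obtain ⟨μ, hμ⟩ := 𝔾.exists_leftInvDerivWithin_eq_mul_hNormal b c hpd
    ((c.mem_frontier_iff hpd).1 hpf) (hd p (frontier_subset_closure hpf)) hu
  calc ∑ j, e p j * 𝔾.leftInvDerivWithin (closure Ω) (b j : E) u p
      = μ * inner ℝ (e p) (𝔾.hNormal b Ω p) := by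
        simp only [hμ, PiLp.inner_apply, RCLike.inner_apply, conj_trivial, Finset.mul_sum]
        exact Finset.sum_congr rfl fun j _ => by ring
    _ = 0 := by rw [hp, mul_zero]

theorem fderiv_sum_smul_leftInv_eq_zero {φ : E → ℝ} (h : IsLocalDefining Ω φ g)
    {x : EuclideanSpace ℝ (Fin m)} (hx : inner ℝ x (𝔾.hNormal b Ω g) = (0 : ℝ)) :
    fderiv ℝ φ g (∑ k, x k • 𝔾.leftInv (b k : E) g) = 0 := by
  rw [𝔾.inner_hNormal_eq_zero_iff b h, PiLp.inner_apply] at hx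
  simp only [map_sum, map_smul, smul_eq_mul]
  exact (Finset.sum_congr rfl fun j _ => mul_comm _ _).trans hx

theorem sum_mul_leftInvDerivWithin_frame (hΩ : IsC2BoundedOpen Ω) (c : GraphChart Ω)
    (hg : g ∈ c.dom) (h0 : c.defn g = 0) (hC : ContDiffOn ℝ 2 u (closure Ω))
    (hu : ∀ p ∈ frontier Ω, u p = 0) {e : E → EuclideanSpace ℝ (Fin m)}
    (he : DifferentiableAt ℝ e g)
    (hperp : ∀ᶠ p in 𝓝[frontier Ω] g, inner ℝ (e p) (𝔾.hNormal b Ω p) = 0) :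
    ∑ i, ∑ j, e g i * e g j * 𝔾.leftInvDerivWithin (closure Ω) (b i : E)
        (𝔾.leftInvDerivWithin (closure Ω) (b j : E) u) g =
      -∑ j, 𝔾.hConn b (e g) e g j * 𝔾.leftInvDerivWithin (closure Ω) (b j : E) u g := by
  have hU := hΩ.uniqueDiffOn
  have hgf : g ∈ frontier Ω := (c.mem_frontier_iff hg).2 h0
  have hgc : g ∈ closure Ω := frontier_subset_closure hgf
  let F (j : Fin m) : E → ℝ := 𝔾.leftInvDerivWithin (closure Ω) (b j : E) u
  let w : E := ∑ k, e g k • 𝔾.leftInv (b k : E) g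
  have hF (j : Fin m) : DifferentiableWithinAt ℝ (F j) (closure Ω) g :=
    (𝔾.contDiffOn_leftInvDerivWithin hU hC).differentiableOn one_ne_zero g hgc
  have hej (j : Fin m) : HasFDerivWithinAt (fun p => e p j)
      ((EuclideanSpace.proj j : EuclideanSpace ℝ (Fin m) →L[ℝ] ℝ).comp (fderiv ℝ e g))
      (closure Ω) g :=
    ((EuclideanSpace.proj j : EuclideanSpace ℝ (Fin m) →L[ℝ] ℝ).hasFDerivAt.comp g
      he.hasFDerivAt).hasFDerivWithinAt
  have hsum : HasFDerivWithinAt (fun p => ∑ j, e p j * F j p) _ (closure Ω) g :=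
    HasFDerivWithinAt.fun_sum fun j _ => (hej j).mul (hF j).hasFDerivWithinAt
  have htangent := c.fderivWithin_eq_zero hg h0 hsum.differentiableWithinAt
    (𝔾.eventually_sum_mul_leftInvDerivWithin_eq_zero b c hg (hC.differentiableOn two_ne_zero) hu
      hperp)
    (𝔾.fderiv_sum_smul_leftInv_eq_zero b (c.isLocalDefining hg h0)
      (hperp.self_of_nhdsWithin hgf))
  rw [hsum.fderivWithin (hU g hgc)] at htangent
  simp only [sum_apply, add_apply, smul_apply, smul_eq_mul, Finset.sum_add_distrib] at htangent
  have hhess : ∑ i, ∑ j, e g i * e g j * 𝔾.leftInvDerivWithin (closure Ω) (b i : E) (F j) g =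
      ∑ j, e g j * fderivWithin ℝ (F j) (closure Ω) g w := by
    rw [Finset.sum_comm]
    simp only [w, map_sum, map_smul, smul_eq_mul, Finset.mul_sum, leftInvDerivWithin]
    exact Finset.sum_congr rfl fun j _ => Finset.sum_congr rfl fun i _ => by ring
  rw [hhess, eq_neg_iff_add_eq_zero, ← htangent]
  exact congrArg _ (Finset.sum_congr rfl fun j _ => mul_comm _ _)

theorem sum_mul_leftInvDerivWithin_frame_eq_inner_hGauss (hΩ : IsC2BoundedOpen Ω)
    (c : GraphChart Ω) (hg : g ∈ c.dom) (h0 : c.defn g = 0) (hC : ContDiffOn ℝ 2 u (closure Ω))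
    (hu : ∀ p ∈ frontier Ω, u p = 0) {μ : ℝ}
    (hμ : ∀ i, 𝔾.leftInvDerivWithin (closure Ω) (b i : E) u g = μ * 𝔾.hNormal b Ω g i)
    {e : E → EuclideanSpace ℝ (Fin m)} (he : DifferentiableAt ℝ e g)
    (hperp : ∀ᶠ p in 𝓝[frontier Ω] g, inner ℝ (e p) (𝔾.hNormal b Ω p) = 0) :
    ∑ i, ∑ j, e g i * e g j * 𝔾.leftInvDerivWithin (closure Ω) (b i : E)
        (𝔾.leftInvDerivWithin (closure Ω) (b j : E) u) g =
      -(μ * 𝔾.angle b Ω g * inner ℝ (𝔾.hConn b (e g) e g) (𝔾.hGauss b Ω g)) := by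
  rw [𝔾.sum_mul_leftInvDerivWithin_frame b hΩ c hg h0 hC hu he hperp, mul_assoc,
    ← inner_smul_right, angle_smul_hGauss, PiLp.inner_apply, Finset.mul_sum]
  refine congrArg _ (Finset.sum_congr rfl fun j _ => ?_)
  rw [hμ j, RCLike.inner_apply, conj_trivial]
  ring

theorem sum_fluxCoeff_mul_hNormal (hΩ : IsC2BoundedOpen Ω) (hC : ContDiffOn ℝ 2 u (closure Ω))
    (hu : ∀ p ∈ frontier Ω, u p = 0) (hgf : g ∈ frontier Ω) :
    ∑ i, fluxCoeff (fun i => 𝔾.leftInvDerivWithin (closure Ω) (b i : E) u g)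
        (fun i j => 𝔾.leftInvDerivWithin (closure Ω) (b i : E)
          (𝔾.leftInvDerivWithin (closure Ω) (b j : E) u) g) i * 𝔾.hNormal b Ω g i =
      𝔾.hMeanCurvature b Ω g * 𝔾.hGradSq b Ω u g * 𝔾.angle b Ω g := by
  obtain ⟨c, hg⟩ := hΩ.exists_mem_dom hgf
  have h0 := (c.mem_frontier_iff hg).1 hgf
  rcases eq_or_ne (𝔾.hNormal b Ω g) 0 with hN | hN
  · simp [hN, angle]
  obtain ⟨e, he, hframe, hH⟩ := 𝔾.isHMeanCurvature_hMeanCurvature b hN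
    (𝔾.exists_isHMeanCurvature b c hg h0 hN)
  obtain ⟨μ, hμ⟩ := 𝔾.exists_leftInvDerivWithin_eq_mul_hNormal b c hg h0
    (hC.differentiableOn two_ne_zero g (frontier_subset_closure hgf)) hu
  obtain ⟨horth, hperp⟩ := hframe.self_of_nhdsWithin hgf
  set W := 𝔾.angle b Ω g
  set a : Fin m → Fin m → ℝ := fun i j => 𝔾.leftInvDerivWithin (closure Ω) (b i : E)
    (𝔾.leftInvDerivWithin (closure Ω) (b j : E) u) g
  have htangential : ∑ k, ∑ i, ∑ j, e k g i * e k g j * a i j =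
      μ * W * 𝔾.hMeanCurvature b Ω g := by
    rw [hH, mul_neg, Finset.mul_sum, ← Finset.sum_neg_distrib]
    exact Finset.sum_congr rfl fun k _ => 𝔾.sum_mul_leftInvDerivWithin_frame_eq_inner_hGauss b hΩ
      c hg h0 hC hu hμ ((he k).differentiableAt one_ne_zero) (hframe.mono fun p hp => hp.2 k)
  have htrace := sum_orthonormal_add a horth (𝔾.norm_hGauss b hN) fun k => by
    rw [hGauss, inner_smul_right, hperp k, mul_zero]
  have hnormal : ∑ i, ∑ j, 𝔾.hNormal b Ω g i * 𝔾.hNormal b Ω g j * a i j =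
      W ^ 2 * ∑ i, ∑ j, 𝔾.hGauss b Ω g i * 𝔾.hGauss b Ω g j * a i j := by
    simp only [← 𝔾.angle_smul_hGauss b, PiLp.smul_apply, smul_eq_mul, Finset.mul_sum]
    exact Finset.sum_congr rfl fun i _ => Finset.sum_congr rfl fun j _ => by ring
  rw [fluxCoeff_sum_mul_of_eq_mul hμ, ← EuclideanSpace.real_norm_sq_eq,
    𝔾.hGradSq_eq_of_eq_mul b hμ, hnormal, ← htrace, htangential]
  change μ * (W ^ 2 * _ - _) = _
  ring

end BoundaryIdentity

end StepTwoCarnot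

/-! ### The integral identity -/

section SymmetricFunctions

variable {ι : Type*} [Fintype ι]

theorem two_mul_sum_powersetCard_two (x : ι → ℝ) :
    2 * ∑ t ∈ Finset.powersetCard 2 Finset.univ, ∏ i ∈ t, x i = (∑ i, x i) ^ 2 - ∑ i, x i ^ 2 := by
  classical
  have hnewton := congrArg (MvPolynomial.aeval x) (MvPolynomial.mul_esymm_eq_sum ι ℝ 2)
  have hindex : (Finset.HasAntidiagonal.antidiagonal 2 : Finset (ℕ × ℕ)).filter
      (fun a => a.1 < 2) = {(0, 2), (1, 1)} := by
    decide
  rw [hindex, Finset.sum_pair (by decide)] at hnewton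
  simp only [MvPolynomial.esymm, MvPolynomial.psum, map_mul, map_sum, map_prod, map_add, map_pow,
    MvPolynomial.aeval_X, map_neg, map_one, Finset.powersetCard_zero, Finset.sum_singleton,
    Finset.prod_empty, Finset.powersetCard_one, Finset.sum_map, map_natCast,
    Function.Embedding.coeFn_mk, Finset.prod_singleton, pow_zero, pow_one] at hnewton
  push_cast at hnewton
  rw [hnewton]
  ring

theorem sum_sq_eigenvalues_of_isHermitian [DecidableEq ι] {A : Matrix ι ι ℝ}
    (hA : A.IsHermitian) : ∑ i, hA.eigenvalues i ^ 2 = ∑ i, ∑ j, A i j ^ 2 := by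
  have htrace : (A * A).trace = ∑ i, hA.eigenvalues i ^ 2 := by
    conv_lhs => rw [hA.spectral_theorem]
    rw [← map_mul, Unitary.conjStarAlgAut_apply, Matrix.trace_mul_cycle, Unitary.coe_star_mul_self,
      one_mul, Matrix.diagonal_mul_diagonal, Matrix.trace_diagonal]
    exact Finset.sum_congr rfl fun i _ => (pow_two _).symm
  rw [← htrace]
  simp only [Matrix.trace, Matrix.diag_apply, Matrix.mul_apply]
  refine Finset.sum_congr rfl fun i _ => Finset.sum_congr rfl fun j _ => ?_
  have hsymm : A j i = A i j := hA.apply i j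
  rw [hsymm, pow_two]

theorem hessQuad_eq (a : ι → ι → ℝ) :
    hessQuad a = ((∑ i, a i i) ^ 2 - ∑ i, ∑ j, ((a i j + a j i) / 2) ^ 2) +
      3 / 4 * ∑ i, ∑ j, (a i j - a j i) ^ 2 := by
  have hswap : ∑ i, ∑ j, a j i ^ 2 = ∑ i, ∑ j, a i j ^ 2 := Finset.sum_comm
  have hquad : hessQuad a = (∑ i, a i i) ^ 2 + ∑ i, ∑ j, a i j ^ 2 -
      2 * ∑ i, ∑ j, a i j * a j i := by
    rw [pow_two, Finset.sum_mul_sum, hessQuad]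
    simp only [Finset.mul_sum, ← Finset.sum_add_distrib, ← Finset.sum_sub_distrib]
    exact Finset.sum_congr rfl fun i _ => Finset.sum_congr rfl fun j _ => by ring
  have hsymm : ∑ i, ∑ j, ((a i j + a j i) / 2) ^ 2 =
      1 / 4 * ∑ i, ∑ j, a i j ^ 2 + 1 / 4 * ∑ i, ∑ j, a j i ^ 2 +
        1 / 2 * ∑ i, ∑ j, a i j * a j i := by
    simp only [Finset.mul_sum, ← Finset.sum_add_distrib]
    exact Finset.sum_congr rfl fun i _ => Finset.sum_congr rfl fun j _ => by ring
  have hantisymm : ∑ i, ∑ j, (a i j - a j i) ^ 2 =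
      ∑ i, ∑ j, a i j ^ 2 + ∑ i, ∑ j, a j i ^ 2 - 2 * ∑ i, ∑ j, a i j * a j i := by
    simp only [Finset.mul_sum, ← Finset.sum_add_distrib, ← Finset.sum_sub_distrib]
    exact Finset.sum_congr rfl fun i _ => Finset.sum_congr rfl fun j _ => by ring
  rw [hquad, hsymm, hantisymm, hswap]
  ring

end SymmetricFunctions

theorem exists_continuous_eqOn {X : Type*} [TopologicalSpace X] [NormalSpace X] {S : Set X}
    {f : X → ℝ} (hS : IsClosed S) (hf : ContinuousOn f S) :
    ∃ F : X → ℝ, Continuous F ∧ EqOn F f S := by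
  obtain ⟨F, hF⟩ := ContinuousMap.exists_restrict_eq hS ⟨_, hf.domRestrict⟩
  exact ⟨F, F.continuous, fun p hp => DFunLike.congr_fun hF ⟨p, hp⟩⟩

theorem integrableOn_of_continuousOn_closure {E : Type*} [NormedAddCommGroup E]
    [InnerProductSpace ℝ E] [FiniteDimensional ℝ E] [MeasurableSpace E] [BorelSpace E]
    {Ω : Set E} (hΩ : IsOpen Ω) (hb : Bornology.IsBounded Ω) {f F : E → ℝ}
    (hF : ContinuousOn F (closure Ω)) (hf : EqOn F f Ω) : IntegrableOn f Ω :=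
  ((hF.integrableOn_compact hb.isCompact_closure).mono_set subset_closure).congr_fun hf
    hΩ.measurableSet

namespace StepTwoCarnot

section Pointwise

variable {E : Type*} [NormedAddCommGroup E] [InnerProductSpace ℝ E] (𝔾 : StepTwoCarnot E)
  {m : ℕ} (b : OrthonormalBasis (Fin m) ℝ 𝔾.V₁) {Ω : Set E} {u : E → ℝ} {g : E}

theorem hessQuad_X (u : E → ℝ) (g : E) : hessQuad (fun i j => 𝔾.X b i (𝔾.X b j u) g) =
    2 * 𝔾.symF b 2 u g + 3 / 4 * ∑ i, ∑ j, (𝔾.comm b i j u g) ^ 2 := by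
  have hA := 𝔾.symHess_isHermitian b u g
  have htrace : ∑ i, hA.eigenvalues i = ∑ i, 𝔾.X b i (𝔾.X b i u) g :=
    hA.trace_eq_sum_eigenvalues.symm.trans (Finset.sum_congr rfl fun i _ => add_self_div_two _)
  rw [hessQuad_eq, symF, two_mul_sum_powersetCard_two, htrace,
    sum_sq_eigenvalues_of_isHermitian hA]
  rfl

theorem metric_outerNormal_sum_smul (V : Fin m → ℝ) (g : E) :
    𝔾.metric g (𝔾.outerNormal Ω g) (∑ i, V i • 𝔾.leftInv (b i : E) g) =
      ∑ i, V i * 𝔾.hNormal b Ω g i := by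
  simp only [hNormal, metric, map_sum, map_smul, inner_sum, inner_smul_right]

variable [FiniteDimensional ℝ E]

theorem X_X_eq_leftInvDeriv (hu : ContDiffAt ℝ 2 u g) (i j : Fin m) :
    𝔾.X b i (𝔾.X b j u) g = 𝔾.leftInvDeriv (b i : E) (𝔾.leftInvDeriv (b j : E) u) g := by
  have hinner : 𝔾.X b j u =ᶠ[𝓝 g] 𝔾.leftInvDeriv (b j : E) u := by
    filter_upwards [hu.eventually (by simp)] with p hp
    exact 𝔾.lieD_eq_leftInvDeriv (hp.differentiableAt two_ne_zero)
  rw [X, 𝔾.lieD_congr hinner]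
  exact 𝔾.lieD_eq_leftInvDeriv ((𝔾.contDiffAt_leftInvDeriv hu
    one_add_one_eq_two.le).differentiableAt one_ne_zero)

theorem X_X_eq_leftInvDerivWithin (hΩ : IsOpen Ω) (hu : ContDiffOn ℝ 2 u (closure Ω)) (hg : g ∈ Ω)
    (i j : Fin m) : 𝔾.X b i (𝔾.X b j u) g = 𝔾.leftInvDerivWithin (closure Ω) (b i : E)
      (𝔾.leftInvDerivWithin (closure Ω) (b j : E) u) g := by
  have hnhds : closure Ω ∈ 𝓝 g := mem_of_superset (hΩ.mem_nhds hg) subset_closure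
  rw [𝔾.X_X_eq_leftInvDeriv b (hu.contDiffAt hnhds),
    𝔾.leftInvDerivWithin_leftInvDerivWithin_eq hnhds]

end Pointwise

section IntegralIdentity

variable {E : Type*} [NormedAddCommGroup E] [InnerProductSpace ℝ E] [FiniteDimensional ℝ E]
  (𝔾 : StepTwoCarnot E) {m : ℕ} (b : OrthonormalBasis (Fin m) ℝ 𝔾.V₁) {Ω : Set E} {u : E → ℝ}

/-- The components of the vector field whose divergence is the Hessian quadratic expression of
`u`, with derivatives relative to the closure of `Ω`, so that it is defined on the boundary. -/
noncomputable def hessFlux (Ω : Set E) (u : E → ℝ) (i : Fin m) (g : E) : ℝ :=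
  fluxCoeff (fun i => 𝔾.leftInvDerivWithin (closure Ω) (b i : E) u g)
    (fun i j => 𝔾.leftInvDerivWithin (closure Ω) (b i : E)
      (𝔾.leftInvDerivWithin (closure Ω) (b j : E) u) g) i

theorem continuousOn_hess (hΩ : IsC2BoundedOpen Ω) (hu : ContDiffOn ℝ 2 u (closure Ω))
    (i j : Fin m) : ContinuousOn (𝔾.leftInvDerivWithin (closure Ω) (b i : E)
      (𝔾.leftInvDerivWithin (closure Ω) (b j : E) u)) (closure Ω) :=
  𝔾.continuousOn_leftInvDerivWithin hΩ.uniqueDiffOn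
    (𝔾.contDiffOn_leftInvDerivWithin hΩ.uniqueDiffOn hu)

theorem continuousOn_hessFlux (hΩ : IsC2BoundedOpen Ω) (hu : ContDiffOn ℝ 2 u (closure Ω))
    (i : Fin m) : ContinuousOn (𝔾.hessFlux b Ω u i) (closure Ω) := by
  unfold hessFlux fluxCoeff
  have hgrad (i : Fin m) := 𝔾.continuousOn_leftInvDerivWithin (v := (b i : E)) hΩ.uniqueDiffOn
    (hu.of_le one_le_two)
  have hhess := 𝔾.continuousOn_hess b hΩ hu
  fun_prop

variable [MeasurableSpace E] [BorelSpace E]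

theorem measurable_angle (hΩ : IsC2BoundedOpen Ω) : Measurable (𝔾.angle b Ω) := by
  classical
  have hcont : ContinuousOn (𝔾.angle b Ω) (frontier Ω) :=
    ((PiLp.continuous_toLp 2 _).comp_continuousOn (continuousOn_pi.2 fun j =>
      𝔾.continuousOn_metric_outerNormal hΩ (𝔾.continuous_leftInv (b j : E)))).norm
  have heq : (frontier Ω).piecewise (𝔾.angle b Ω) (fun _ => 0) = 𝔾.angle b Ω := by
    ext g
    by_cases hg : g ∈ frontier Ω
    · rw [piecewise_eq_of_mem _ _ _ hg]
    · rw [piecewise_eq_of_notMem _ _ _ hg, angle, eq_comm, norm_eq_zero]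
      ext j
      simp only [hNormal, 𝔾.outerNormal_eq_zero hg, metric, map_zero, inner_zero_left,
        PiLp.zero_apply]
  rw [← heq]
  exact hcont.measurable_piecewise continuousOn_const isClosed_frontier.measurableSet

theorem isWeakDiv_hessFlux (hΩ : IsOpen Ω) (hu : ContDiffOn ℝ 2 u (closure Ω))
    {V : Fin m → E → ℝ} (hV : ∀ i, EqOn (V i) (𝔾.hessFlux b Ω u i) Ω) :
    IsWeakDiv Ω (fun g => ∑ i, V i g • 𝔾.leftInv (b i : E) g)
      (fun g => hessQuad fun i j => 𝔾.X b i (𝔾.X b j u) g) := by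
  intro η hη hηc hηΩ
  have h := 𝔾.integral_hessQuad (fun i => (b i : E)) hΩ (hu.mono subset_closure) hη hηc hηΩ
  rw [← setIntegral_eq_integral_of_forall_compl_eq_zero (s := Ω)] at h
  · rw [← h]
    refine setIntegral_congr_fun hΩ.measurableSet fun g hg => ?_
    have hnhds : closure Ω ∈ 𝓝 g := mem_of_superset (hΩ.mem_nhds hg) subset_closure
    simp only [𝔾.X_X_eq_leftInvDeriv b (hu.contDiffAt hnhds), map_sum, map_smul, smul_eq_mul,
      fun i => hV i hg, hessFlux, 𝔾.leftInvDerivWithin_leftInvDerivWithin_eq hnhds,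
      𝔾.leftInvDerivWithin_eq hnhds]
    rfl
  · intro g hg
    have hsupp : g ∉ tsupport η := fun h => hg (hηΩ h)
    simp [image_eq_zero_of_notMem_tsupport hsupp,
      fun i => 𝔾.leftInvDeriv_eq_zero_of_notMem_tsupport (v := (b i : E)) hsupp]

theorem integrableOn_comm_sq (hΩ : IsC2BoundedOpen Ω) (hu : ContDiffOn ℝ 2 u (closure Ω))
    (i j : Fin m) : IntegrableOn (fun g => (𝔾.comm b i j u g) ^ 2) Ω := by
  refine integrableOn_of_continuousOn_closure hΩ.1 hΩ.2.1
    (((𝔾.continuousOn_hess b hΩ hu i j).sub (𝔾.continuousOn_hess b hΩ hu j i)).pow 2)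
    fun g hg => ?_
  simp only [comm, 𝔾.X_X_eq_leftInvDerivWithin b hΩ.1 hu hg]
  rfl

theorem integrableOn_hessQuad (hΩ : IsC2BoundedOpen Ω) (hu : ContDiffOn ℝ 2 u (closure Ω)) :
    IntegrableOn (fun g => hessQuad fun i j => 𝔾.X b i (𝔾.X b j u) g) Ω := by
  have hcont : ContinuousOn (fun g => hessQuad fun i j =>
      𝔾.leftInvDerivWithin (closure Ω) (b i : E)
        (𝔾.leftInvDerivWithin (closure Ω) (b j : E) u) g) (closure Ω) := by
    unfold hessQuad
    have hhess := 𝔾.continuousOn_hess b hΩ hu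
    fun_prop
  refine integrableOn_of_continuousOn_closure hΩ.1 hΩ.2.1 hcont fun g hg => ?_
  simp only [𝔾.X_X_eq_leftInvDerivWithin b hΩ.1 hu hg]

theorem setIntegral_hessQuad (hΩ : IsC2BoundedOpen Ω) (hu : ContDiffOn ℝ 2 u (closure Ω)) :
    Integrable (fun g => ∑ i, 𝔾.hessFlux b Ω u i g * 𝔾.hNormal b Ω g i) (𝔾.surfaceMeasure Ω) ∧
    ∫ g in Ω, hessQuad (fun i j => 𝔾.X b i (𝔾.X b j u) g) =
      ∫ g, ∑ i, 𝔾.hessFlux b Ω u i g * 𝔾.hNormal b Ω g i ∂(𝔾.surfaceMeasure Ω) := by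
  choose V hVc hV using fun i =>
    exists_continuous_eqOn isClosed_closure (𝔾.continuousOn_hessFlux b hΩ hu i)
  have hcont : Continuous fun g => ∑ i, V i g • 𝔾.leftInv (b i : E) g :=
    continuous_finsetSum _ fun i _ => (hVc i).smul (𝔾.continuous_leftInv _)
  have hboundary : (fun g => 𝔾.metric g (𝔾.outerNormal Ω g) (∑ i, V i g • 𝔾.leftInv (b i : E) g))
      =ᵐ[𝔾.surfaceMeasure Ω] fun g => ∑ i, 𝔾.hessFlux b Ω u i g * 𝔾.hNormal b Ω g i := by
    filter_upwards [𝔾.ae_mem_frontier] with g hg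
    simp only [metric_outerNormal_sum_smul, fun i => hV i (frontier_subset_closure hg)]
  refine ⟨(𝔾.integrable_of_continuousOn_frontier hΩ
    (𝔾.continuousOn_metric_outerNormal hΩ hcont)).congr hboundary, ?_⟩
  rw [𝔾.setIntegral_eq_of_isWeakDiv hΩ hcont (𝔾.integrableOn_hessQuad b hΩ hu)
    (𝔾.isWeakDiv_hessFlux b hΩ.1 hu fun i => (hV i).mono subset_closure),
    integral_congr_ae hboundary]

theorem ae_sum_hessFlux_mul_hNormal (hΩ : IsC2BoundedOpen Ω) (hu : ContDiffOn ℝ 2 u (closure Ω))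
    (h0 : ∀ g ∈ frontier Ω, u g = 0) :
    (fun g => ∑ i, 𝔾.hessFlux b Ω u i g * 𝔾.hNormal b Ω g i) =ᵐ[𝔾.surfaceMeasure Ω]
      fun g => (ENNReal.ofReal (𝔾.angle b Ω g)).toReal •
        (𝔾.hMeanCurvature b Ω g * 𝔾.hGradSq b Ω u g) := by
  filter_upwards [𝔾.ae_mem_frontier] with g hg
  have hangle : 0 ≤ 𝔾.angle b Ω g := norm_nonneg _
  rw [ENNReal.toReal_ofReal hangle, smul_eq_mul, mul_comm]
  exact 𝔾.sum_fluxCoeff_mul_hNormal b hΩ hu h0 hg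

theorem integrable_hMeanCurvature_mul_hGradSq (hΩ : IsC2BoundedOpen Ω)
    (hu : ContDiffOn ℝ 2 u (closure Ω)) (h0 : ∀ g ∈ frontier Ω, u g = 0) :
    Integrable (fun g => 𝔾.hMeanCurvature b Ω g * 𝔾.hGradSq b Ω u g)
      (𝔾.perimeterMeasure b Ω) := by
  rw [perimeterMeasure, integrable_withDensity_iff_integrable_smul'
    (𝔾.measurable_angle b hΩ).ennreal_ofReal (ae_of_all _ fun _ => ENNReal.ofReal_lt_top)]
  exact (𝔾.setIntegral_hessQuad b hΩ hu).1.congr (𝔾.ae_sum_hessFlux_mul_hNormal b hΩ hu h0)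

theorem setIntegral_symF_add_comm_sq (hΩ : IsC2BoundedOpen Ω) (hu : ContDiffOn ℝ 2 u (closure Ω))
    (h0 : ∀ g ∈ frontier Ω, u g = 0) :
    2 * (∫ g in Ω, 𝔾.symF b 2 u g) + 3 / 4 * ∑ i, ∑ j, ∫ g in Ω, (𝔾.comm b i j u g) ^ 2 =
      ∫ g, 𝔾.hMeanCurvature b Ω g * 𝔾.hGradSq b Ω u g ∂(𝔾.perimeterMeasure b Ω) := by
  have hcomm : IntegrableOn (fun g => ∑ i, ∑ j, (𝔾.comm b i j u g) ^ 2) Ω :=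
    integrable_finsetSum _ fun i _ => integrable_finsetSum _ fun j _ =>
      𝔾.integrableOn_comm_sq b hΩ hu i j
  have hsymF : IntegrableOn (fun g => 2 * 𝔾.symF b 2 u g) Ω := by
    refine ((𝔾.integrableOn_hessQuad b hΩ hu).sub (hcomm.const_mul (3 / 4))).congr
      (ae_of_all _ fun g => ?_)
    simp only [Pi.sub_apply, hessQuad_X, add_sub_cancel_right]
  calc 2 * (∫ g in Ω, 𝔾.symF b 2 u g) + 3 / 4 * ∑ i, ∑ j, ∫ g in Ω, (𝔾.comm b i j u g) ^ 2
    _ = ∫ g in Ω, hessQuad fun i j => 𝔾.X b i (𝔾.X b j u) g := by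
        simp only [hessQuad_X]
        rw [integral_add hsymF (hcomm.const_mul _), integral_const_mul, integral_const_mul,
          integral_finsetSum _ fun i _ => integrable_finsetSum _ fun j _ =>
            𝔾.integrableOn_comm_sq b hΩ hu i j]
        simp only [integral_finsetSum _ fun j _ => 𝔾.integrableOn_comm_sq b hΩ hu _ j]
    _ = ∫ g, ∑ i, 𝔾.hessFlux b Ω u i g * 𝔾.hNormal b Ω g i ∂(𝔾.surfaceMeasure Ω) :=
        (𝔾.setIntegral_hessQuad b hΩ hu).2
    _ = _ := by
        rw [perimeterMeasure, integral_withDensity_eq_integral_toReal_smul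
          (𝔾.measurable_angle b hΩ).ennreal_ofReal (ae_of_all _ fun _ => ENNReal.ofReal_lt_top)]
        exact integral_congr_ae (𝔾.ae_sum_hessFlux_mul_hNormal b hΩ hu h0)

theorem sum_integral_comm_sq_le (hΩ : IsC2BoundedOpen Ω) (hu : ContDiffOn ℝ 2 u (closure Ω))
    (hconv : ∀ g ∈ Ω, 0 ≤ 𝔾.symF b 2 u g) (h0 : ∀ g ∈ frontier Ω, u g = 0) :
    ∑ i, ∑ j, ∫ g in Ω, (𝔾.comm b i j u g) ^ 2 ≤
      4 / 3 * ∫ g, 𝔾.hMeanCurvature b Ω g * 𝔾.hGradSq b Ω u g ∂(𝔾.perimeterMeasure b Ω) := by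
  linarith [𝔾.setIntegral_symF_add_comm_sq b hΩ hu h0,
    setIntegral_nonneg (μ := volume) hΩ.1.measurableSet hconv]

end IntegralIdentity

end StepTwoCarnot

/-! ### The Heisenberg estimate -/

section Heisenberg

variable {n : ℕ}

/-- The rotation `(x, y, t) ↦ (-y, x, 0)`, which represents `heisForm` by the inner product. -/
def heisRot (p : HeisSpace n) : HeisSpace n :=
  WithLp.toLp 2 (Sum.elim (fun j => -p (Sum.inr (Sum.inl j)))
    (Sum.elim (fun j => p (Sum.inl j)) fun _ => 0))

theorem inner_heisRot (p q : HeisSpace n) : inner ℝ (heisRot p) q = heisForm n p q := by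
  rw [heisForm_apply, PiLp.inner_apply]
  simp only [heisRot, Fintype.sum_sum_type, Sum.elim_inl, Sum.elim_inr, RCLike.inner_apply,
    conj_trivial, mul_zero, Finset.sum_const_zero, add_zero, ← Finset.sum_add_distrib]
  exact Finset.sum_congr rfl fun j _ => by ring

theorem mem_orthogonal_heisT {p : HeisSpace n} :
    p ∈ (ℝ ∙ heisT n)ᗮ ↔ p (Sum.inr (Sum.inr ())) = 0 := by
  simp [Submodule.mem_orthogonal_singleton_iff_inner_right, heisT,
    EuclideanSpace.inner_single_left]

theorem heisRot_mem_orthogonal (p : HeisSpace n) : heisRot p ∈ (ℝ ∙ heisT n)ᗮ :=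
  mem_orthogonal_heisT.2 rfl

theorem norm_sq_heisRot {p : HeisSpace n} (hp : p ∈ (ℝ ∙ heisT n)ᗮ) :
    ‖heisRot p‖ ^ 2 = ‖p‖ ^ 2 := by
  rw [EuclideanSpace.norm_sq_eq, EuclideanSpace.norm_sq_eq]
  simp [heisRot, Fintype.sum_sum_type, mem_orthogonal_heisT.1 hp, add_comm]

theorem finrank_orthogonal_heisT (n : ℕ) :
    Module.finrank ℝ (ℝ ∙ heisT n : Submodule ℝ (HeisSpace n))ᗮ = 2 * n := by
  have hsum := (ℝ ∙ heisT n : Submodule ℝ (HeisSpace n)).finrank_add_finrank_orthogonal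
  have hT : heisT n ≠ 0 := by simp [heisT]
  rw [finrank_span_singleton hT, finrank_euclideanSpace] at hsum
  simp only [Fintype.card_sum, Fintype.card_fin, Fintype.card_unit] at hsum
  omega

theorem sum_heisForm_sq {ι : Type*} [Fintype ι]
    (b : OrthonormalBasis ι ℝ (ℝ ∙ heisT n : Submodule ℝ (HeisSpace n))ᗮ) :
    ∑ i, ∑ j, heisForm n (b i) (b j) ^ 2 = 2 * (n : ℝ) := by
  have hrow (i : ι) : ∑ j, heisForm n (b i) (b j) ^ 2 = 1 := by
    have hparseval := b.sum_sq_norm_inner_left ⟨heisRot (b i), heisRot_mem_orthogonal _⟩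
    rw [Submodule.coe_norm, norm_sq_heisRot (b i).2, ← Submodule.coe_norm, b.norm_eq_one,
      one_pow] at hparseval
    simpa only [Submodule.coe_inner, inner_heisRot, Real.norm_eq_abs, sq_abs] using hparseval
  have hcard : Fintype.card ι = 2 * n := by
    rw [← Module.finrank_eq_card_basis b.toBasis, finrank_orthogonal_heisT]
  simp only [hrow, Finset.sum_const, Finset.card_univ, hcard, nsmul_eq_mul, mul_one]
  push_cast
  rfl

variable (hn : 1 ≤ n)

theorem heisenberg_leftInv_heisT (g : HeisSpace n) :
    (heisenberg n hn).leftInv (heisT n) g = heisT n := by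
  rw [StepTwoCarnot.leftInv_eq]
  change heisT n + (1 / 2 : ℝ) • heisBracket n g (heisT n) = heisT n
  rw [heisBracket_apply, heisForm_heisT, zero_smul, smul_zero, add_zero]

variable {m : ℕ} (b : OrthonormalBasis (Fin m) ℝ (heisenberg n hn).V₁) {Ω : Set (HeisSpace n)}
  {u : HeisSpace n → ℝ} {g : HeisSpace n}

theorem heisenberg_comm_eq (hu : ContDiffAt ℝ 2 u g) (i j : Fin m) :
    (heisenberg n hn).comm b i j u g =
      heisForm n (b i : HeisSpace n) (b j) * (heisenberg n hn).lieD (heisT n) u g := by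
  rw [StepTwoCarnot.comm, StepTwoCarnot.X_X_eq_leftInvDeriv _ b hu,
    StepTwoCarnot.X_X_eq_leftInvDeriv _ b hu, StepTwoCarnot.leftInvDeriv_comm _ hu,
    StepTwoCarnot.lieD_eq_leftInvDeriv _ (hu.differentiableAt two_ne_zero),
    StepTwoCarnot.leftInvDeriv, heisenberg_leftInv_heisT]
  change fderiv ℝ u g (heisBracket n _ _) = _
  rw [heisBracket_apply, map_smul, smul_eq_mul]

theorem heisenberg_integrableOn_lieD_sq (hΩ : IsC2BoundedOpen Ω)
    (hu : ContDiffOn ℝ 1 u (closure Ω)) :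
    IntegrableOn (fun g => ((heisenberg n hn).lieD (heisT n) u g) ^ 2) Ω := by
  refine integrableOn_of_continuousOn_closure hΩ.1 hΩ.2.1
    (((heisenberg n hn).continuousOn_leftInvDerivWithin (v := heisT n) hΩ.uniqueDiffOn hu).pow 2)
    fun g hg => ?_
  have hnhds : closure Ω ∈ 𝓝 g := mem_of_superset (hΩ.1.mem_nhds hg) subset_closure
  simp only [Pi.pow_apply, StepTwoCarnot.leftInvDerivWithin_eq _ hnhds,
    StepTwoCarnot.lieD_eq_leftInvDeriv _ ((hu.contDiffAt hnhds).differentiableAt one_ne_zero)]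

theorem heisenberg_sum_integral_comm_sq (hΩ : IsOpen Ω) (hu : ContDiffOn ℝ 2 u Ω) :
    ∑ i, ∑ j, ∫ g in Ω, ((heisenberg n hn).comm b i j u g) ^ 2 =
      2 * (n : ℝ) * ∫ g in Ω, ((heisenberg n hn).lieD (heisT n) u g) ^ 2 := by
  have hcomm (i j : Fin m) : ∫ g in Ω, ((heisenberg n hn).comm b i j u g) ^ 2 =
      heisForm n (b i : HeisSpace n) (b j) ^ 2 *
        ∫ g in Ω, ((heisenberg n hn).lieD (heisT n) u g) ^ 2 := by
    rw [← integral_const_mul]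
    refine setIntegral_congr_fun hΩ.measurableSet fun g hg => ?_
    simp only [heisenberg_comm_eq hn b (hu.contDiffAt (hΩ.mem_nhds hg)), mul_pow]
  simp only [hcomm, ← Finset.sum_mul]
  exact congrArg (· * _) (sum_heisForm_sq b)

theorem heisenberg_integral_lieD_sq_le (hΩ : IsC2BoundedOpen Ω)
    (hu : ContDiffOn ℝ 2 u (closure Ω)) (hconv : ∀ g ∈ Ω, 0 ≤ (heisenberg n hn).symF b 2 u g)
    (h0 : ∀ g ∈ frontier Ω, u g = 0) :
    ∫ g in Ω, ((heisenberg n hn).lieD (heisT n) u g) ^ 2 ≤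
      2 / (3 * (n : ℝ)) * ∫ g, (heisenberg n hn).hMeanCurvature b Ω g *
        (heisenberg n hn).hGradSq b Ω u g ∂((heisenberg n hn).perimeterMeasure b Ω) := by
  have hle := (heisenberg n hn).sum_integral_comm_sq_le b hΩ hu hconv h0
  rw [heisenberg_sum_integral_comm_sq hn b hΩ.1 (hu.mono subset_closure)] at hle
  have hn0 : (0 : ℝ) < 3 * n := by positivity
  rw [div_mul_eq_mul_div, le_div_iff₀ hn0]
  linarith

end Heisenberg

theorem theoremT_general :
    (∀ (E : Type*) [NormedAddCommGroup E] [InnerProductSpace ℝ E] [FiniteDimensional ℝ E]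
        [MeasurableSpace E] [BorelSpace E] (𝔾 : StepTwoCarnot E) (m : ℕ)
        (b : OrthonormalBasis (Fin m) ℝ 𝔾.V₁) (Ω : Set E) (u : E → ℝ),
        IsC2BoundedOpen Ω → ContDiffOn ℝ 2 u (closure Ω) →
        (∀ g ∈ Ω, 0 ≤ 𝔾.symF b 2 u g) → (∀ g ∈ frontier Ω, u g = 0) →
        (∀ i j, IntegrableOn (fun g => (𝔾.comm b i j u g) ^ 2) Ω volume) ∧
        Integrable (fun g => 𝔾.hMeanCurvature b Ω g * 𝔾.hGradSq b Ω u g)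
          (𝔾.perimeterMeasure b Ω) ∧
        ∑ i, ∑ j, ∫ g in Ω, (𝔾.comm b i j u g) ^ 2 ≤
          4 / 3 * ∫ g, 𝔾.hMeanCurvature b Ω g * 𝔾.hGradSq b Ω u g ∂(𝔾.perimeterMeasure b Ω)) ∧
    (∀ (n : ℕ) (hn : 1 ≤ n) (m : ℕ) (b : OrthonormalBasis (Fin m) ℝ (heisenberg n hn).V₁)
        (Ω : Set (HeisSpace n)) (u : HeisSpace n → ℝ),
        IsC2BoundedOpen Ω → ContDiffOn ℝ 2 u (closure Ω) →
        (∀ g ∈ Ω, 0 ≤ (heisenberg n hn).symF b 2 u g) → (∀ g ∈ frontier Ω, u g = 0) →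
        IntegrableOn (fun g => ((heisenberg n hn).lieD (heisT n) u g) ^ 2) Ω volume ∧
        Integrable (fun g => (heisenberg n hn).hMeanCurvature b Ω g *
          (heisenberg n hn).hGradSq b Ω u g) ((heisenberg n hn).perimeterMeasure b Ω) ∧
        ∫ g in Ω, ((heisenberg n hn).lieD (heisT n) u g) ^ 2 ≤
          2 / (3 * (n : ℝ)) * ∫ g, (heisenberg n hn).hMeanCurvature b Ω g *
            (heisenberg n hn).hGradSq b Ω u g ∂((heisenberg n hn).perimeterMeasure b Ω)) :=
  ⟨fun _ _ _ _ _ _ 𝔾 _ b _ _ hΩ hu hconv h0 =>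
      ⟨𝔾.integrableOn_comm_sq b hΩ hu, 𝔾.integrable_hMeanCurvature_mul_hGradSq b hΩ hu h0,
        𝔾.sum_integral_comm_sq_le b hΩ hu hconv h0⟩,
    fun n hn _ b _ _ hΩ hu hconv h0 =>
      ⟨heisenberg_integrableOn_lieD_sq hn hΩ (hu.of_le one_le_two),
        (heisenberg n hn).integrable_hMeanCurvature_mul_hGradSq b hΩ hu h0,
        heisenberg_integral_lieD_sq_le hn b hΩ hu hconv h0⟩⟩

theorem theoremT :
    (∀ (E : Type*) [NormedAddCommGroup E] [InnerProductSpace ℝ E] [FiniteDimensional ℝ E]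
        [MeasurableSpace E] [BorelSpace E] (𝔾 : StepTwoCarnot E) (m : ℕ)
        (b : OrthonormalBasis (Fin m) ℝ 𝔾.V₁) (Ω : Set E) (u : E → ℝ),
        IsC2BoundedOpen Ω → 𝔾.GammaClosure b Ω 3 u → ContDiffOn ℝ 2 u (closure Ω) →
        𝔾.HConvexOn b 2 Ω u → (∀ g ∈ frontier Ω, u g = 0) →
        (∀ i j, IntegrableOn (fun g => (𝔾.comm b i j u g) ^ 2) Ω volume) ∧
        Integrable (fun g => 𝔾.hMeanCurvature b Ω g * 𝔾.hGradSq b Ω u g)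
          (𝔾.perimeterMeasure b Ω) ∧
        ∑ i, ∑ j, ∫ g in Ω, (𝔾.comm b i j u g) ^ 2 ≤
          4 / 3 * ∫ g, 𝔾.hMeanCurvature b Ω g * 𝔾.hGradSq b Ω u g ∂(𝔾.perimeterMeasure b Ω)) ∧
    (∀ (n : ℕ) (hn : 1 ≤ n) (m : ℕ) (b : OrthonormalBasis (Fin m) ℝ (heisenberg n hn).V₁)
        (Ω : Set (HeisSpace n)) (u : HeisSpace n → ℝ),
        IsC2BoundedOpen Ω → (heisenberg n hn).GammaClosure b Ω 3 u →
        ContDiffOn ℝ 2 u (closure Ω) →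
        (heisenberg n hn).HConvexOn b 2 Ω u → (∀ g ∈ frontier Ω, u g = 0) →
        IntegrableOn (fun g => ((heisenberg n hn).lieD (heisT n) u g) ^ 2) Ω volume ∧
        Integrable (fun g => (heisenberg n hn).hMeanCurvature b Ω g *
          (heisenberg n hn).hGradSq b Ω u g) ((heisenberg n hn).perimeterMeasure b Ω) ∧
        ∫ g in Ω, ((heisenberg n hn).lieD (heisT n) u g) ^ 2 ≤
          2 / (3 * (n : ℝ)) * ∫ g, (heisenberg n hn).hMeanCurvature b Ω g *
            (heisenberg n hn).hGradSq b Ω u g ∂((heisenberg n hn).perimeterMeasure b Ω)) :=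
  ⟨fun E _ _ _ _ _ 𝔾 m b Ω u hΩ _ hu hconv =>
      theoremT_general.1 E 𝔾 m b Ω u hΩ hu (hconv 2 one_le_two le_rfl),
    fun n hn m b Ω u hΩ _ hu hconv =>
      theoremT_general.{0}.2 n hn m b Ω u hΩ hu (hconv 2 one_le_two le_rfl)⟩
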